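/- Let $n,m\ge 1$ and let $L(D_t,D_x)=D_t^m+\sum_{k=0}^{m-1}A_k(D_x)D_t^k$, where $D_t=-i\partial_t$, $D_x=-i\partial_x$ and $A_k\in\mathbb C[\xi_1,\dots,\xi_n]$ has degree at most $m-k$, with full symbol $L(\tau,\xi)=\tau^m+\sum_{k<m}A_k(\xi)\tau^k$. Assume that $L$ is strictly hyperbolic: for every $\xi\in\mathbb R^n\setminus\{0\}$ the principal symbol $L_m(\tau,\xi)$ (the part of $L(\tau,\xi)$ homogeneous of degree $m$ in $(\tau,\xi)$) has $m$ distinct real roots in $\tau$. Let $\tau_1(\xi),\dots,\tau_m(\xi)$ be the roots in $\tau$ of $L(\tau,\xi)=0$, listed with multiplicity, where the labelling is such that $\tau_k$ is continuous at every $\xi^0\in\mathbb R^n$ with $\operatorname{Im}\tau_k(\xi^0)=0$. Let $s>0$, and assume that $\operatorname{Im}\tau_k(\xi)\ge 0$ for all $k$ and all $\xi\in\mathbb R^n$, and that: (H1) $\liminf_{|\xi|\to\infty}\operatorname{Im}\tau_k(\xi)>0$ for every $k=1,\dots,m$; (H2) for each $\xi^0\in\mathbb R^n$ there is at most one index $k$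 with $\operatorname{Im}\tau_k(\xi^0)=0$, and if there is one, then for some constant $c>0$ we have $|\xi-\xi^0|^s\le c\operatorname{Im}\tau_k(\xi)$ for all $\xi$ in some neighbourhood of $\xi^0$; moreover there are only finitely many points $\xi^0$ at which $\operatorname{Im}\tau_k(\xi^0)=0$ for some $k$. Let $1\le p\le 2\le q\le\infty$ with $\frac1p+\frac1q=1$, let $r\ge 0$ be an integer, $\alpha$ a multi-index, and let $N_p\in\mathbb R$ satisfy $N_p\ge n\left(\frac1p-\frac1q\right)$ if $1<p\le 2$ and $N_1>n$ if $p=1$. For $\sigma\in\mathbb R$ let $W_p^\sigma$ be the space of tempered distributions $f$ on $\mathbb R^n$ with $\langle D\rangle^\sigma f=(1-\Delta)^{\sigma/2}f\in L^p(\mathbb R^n)$, with norm $\|f\|_{W_p^\sigma}=\|\langle D\rangle^\sigma f\|_{L^p}$, and write $\langle t\rangle=(1+t^2)^{1/2}$. Then there is a constant $C>0$, independent of $t$, of the data and of the solution, such that for all $f_j\in W_p^{N_p+|\alpha|+r-j}$ ($0\le j\le m-1$) and every solution $u$ of $$L(D_t,D_x)u=0\quad(t>0),\qquad \partial_t^ju(0,\cdot)=f_j\quad(0\le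 j\le m-1),$$ where $u$ is an $m$ times differentiable function of $t\in[0,\infty)$ with values in the tempered distributions on $\mathbb R^n$ (differentiability being understood after pairing with each Schwartz function), the derivative $\partial_t^ru$ exists on $[0,\infty)$ and $$\|\partial_t^r\partial_x^\alpha u(t,\cdot)\|_{L^q}\le C\langle t\rangle^{-\frac ns\left(\frac1p-\frac1q\right)}\sum_{j=0}^{m-1}\|f_j\|_{W_p^{N_p+|\alpha|+r-j}}\qquad\text{for all }t\ge 0.$$ Moreover, under additional assumptions the factor $\langle t\rangle^{-\frac ns(\frac1p-\frac1q)}$ in this estimate may be replaced as follows. (a) If $\operatorname{Im}\tau_k(\xi^0)=0$ (for some $k$) implies $\xi^0=0$, by $\langle t\rangle^{-\frac ns\left(\frac1p-\frac1q\right)-\frac{|\alpha|}{s}}$. (b) If $s_1>0$ and whenever $\operatorname{Im}\tau_k(\xi^0)=0$ there is a constant $c_1>0$ with $|\tau_k(\xi)|\le c_1|\xi-\xi^0|^{s_1}$ for all $\xi$ sufficiently close to $\xi^0$, by $\langle t\rangle^{-\frac ns\left(\frac1p-\frac1q\right)-\frac{rs_1}{s}}$. (c) If the assumptions of both (a) and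 (b) hold, by $\langle t\rangle^{-\frac ns\left(\frac1p-\frac1q\right)-\frac{|\alpha|}{s}-\frac{rs_1}{s}}$. -/

import Mathlib

open MeasureTheory Filter Topology
open scoped ENNReal SchwartzMap

noncomputable section

namespace HypCauchy

/-- The Euclidean space `ℝⁿ`. -/
abbrev Space (n : ℕ) : Type := EuclideanSpace ℝ (Fin n)

/-- Complex-valued tempered distributions on `ℝⁿ`. -/
abbrev Distr (n : ℕ) : Type := 𝓢'(Space n, ℂ)

/-! ### Differentiation in `x` -/

/-- The partial derivative `∂_{x_i}` on tempered distributions. -/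
def partialX {n : ℕ} (i : Fin n) : Distr n →L[ℂ] Distr n :=
  LineDeriv.lineDerivOpCLM ℂ (Distr n) (EuclideanSpace.single i (1 : ℝ))

/-- `∂_x^α = ∂_{x_1}^{α_1} ⋯ ∂_{x_n}^{α_n}` for a multi-index `α`. -/
def partialXPow {n : ℕ} (α : Fin n →₀ ℕ) : Distr n →L[ℂ] Distr n :=
  ((List.finRange n).map fun i => partialX i ^ α i).prod

/-- The operator `P(D_x) = ∑_α c_α D_x^α`, where `P(ξ) = ∑_α c_α ξ^α` and `D_{x_i} = -i ∂_{x_i}`. -/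
def polyDx {n : ℕ} (P : MvPolynomial (Fin n) ℂ) : Distr n →L[ℂ] Distr n :=
  ∑ α ∈ P.support, (P.coeff α * (-Complex.I) ^ α.degree) • partialXPow α

/-! ### Differentiation in `t` -/

/-- `v = ∂_t^k u` on `[0, ∞)`, for curves `u`, `v` of tempered distributions; derivatives in `t` are
taken after pairing with an arbitrary Schwartz function, and are one-sided at `t = 0`. -/
def IsTimeDeriv {n : ℕ} : ℕ → (ℝ → Distr n) → (ℝ → Distr n) → Prop
  | 0, u, v => ∀ t : ℝ, 0 ≤ t → v t = u t
  | k + 1, u, v => ∃ w : ℝ → Distr n, IsTimeDeriv k u w ∧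
      ∀ t : ℝ, 0 ≤ t → ∀ φ : 𝓢(Space n, ℂ),
        HasDerivWithinAt (fun s : ℝ => w s φ) (v t φ) (Set.Ici 0) t

/-! ### Constant coefficient operators of order `m` -/

/-- An operator `L(D_t, D_x) = D_t^m + ∑_{k < m} A_k(D_x) D_t^k` with constant complex coefficients
and of order `m`: the polynomial `A_k` has degree at most `m - k`. Its homogeneous part of degree
`m - k` contributes to the principal part of `L`, the rest of it consists of lower order terms. -/
structure Operator (n m : ℕ) where
  coeff : Fin m → MvPolynomial (Fin n) ℂ
  totalDegree_le : ∀ k : Fin m, (coeff k).totalDegree ≤ m - (k : ℕ)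

namespace Operator

variable {n m : ℕ}

/-- The full symbol `L(τ, ξ) = τ^m + ∑_{k < m} A_k(ξ) τ^k`. -/
def symbol (L : Operator n m) (z : ℂ) (ξ : Space n) : ℂ :=
  z ^ m + ∑ k : Fin m, MvPolynomial.eval (fun i => (ξ i : ℂ)) (L.coeff k) * z ^ (k : ℕ)

/-- The principal symbol `L_m(τ, ξ)`, the part of `L(τ, ξ)` homogeneous of degree `m`. -/
def principalSymbol (L : Operator n m) (z : ℂ) (ξ : Space n) : ℂ :=
  z ^ m + ∑ k : Fin m,
    MvPolynomial.eval (fun i => (ξ i : ℂ))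
      (MvPolynomial.homogeneousComponent (m - (k : ℕ)) (L.coeff k)) * z ^ (k : ℕ)

/-- Strict hyperbolicity: for `ξ ≠ 0` the polynomial `L_m(·, ξ)` has `m` distinct real roots. -/
def StrictlyHyperbolic (L : Operator n m) : Prop :=
  ∀ ξ : Space n, ξ ≠ 0 → ∃ φ : Fin m → ℝ, Function.Injective φ ∧
    ∀ z : ℂ, L.principalSymbol z ξ = ∏ k : Fin m, (z - (φ k : ℂ))

/-- `τ_1(ξ), …, τ_m(ξ)` are the roots of `L(·, ξ)`, listed with multiplicity, for each `ξ`. -/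
def IsCharRoots (L : Operator n m) (τ : Fin m → Space n → ℂ) : Prop :=
  ∀ (ξ : Space n) (z : ℂ), L.symbol z ξ = ∏ k : Fin m, (z - τ k ξ)

/-- `u` is a solution, with values in tempered distributions, of `L(D_t, D_x) u = 0` for `t > 0` and
`∂_t^j u(0) = f_j` for `j < m`. Here `D_t = -i ∂_t`. -/
def IsSolution (L : Operator n m) (f : Fin m → Distr n) (u : ℝ → Distr n) : Prop :=
  ∃ U : ℕ → ℝ → Distr n,
    (∀ k : ℕ, k ≤ m → IsTimeDeriv k u (U k)) ∧
    (∀ t : ℝ, 0 < t →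
      (-Complex.I) ^ m • U m t +
        ∑ k : Fin m, (-Complex.I) ^ (k : ℕ) • polyDx (L.coeff k) (U k t) = 0) ∧
    ∀ j : Fin m, U j 0 = f j

end Operator

/-! ### Lebesgue and Sobolev norms of tempered distributions -/

/-- The `L^p` norm of a tempered distribution `T`: the norm of the (unique) `L^p` function that
represents `T`, and `∞` if there is no such function. -/
def lpNorm {n : ℕ} (p : ℝ≥0∞) [Fact (1 ≤ p)] (T : Distr n) : ℝ≥0∞ :=
  ⨅ (g : Lp ℂ p (volume : Measure (Space n))) (_ : (g : Distr n) = T), eLpNorm g p volume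

/-- `⟨D⟩^σ = (1 - Δ)^{σ/2}`. With the normalisation `∫ e^{-2πi x·ξ} f(x) dx` of the Fourier transform
it is the multiplier with symbol `(1 + |2πξ|²)^{σ/2}`. -/
def bracketD (n : ℕ) (σ : ℝ) : Distr n →L[ℂ] Distr n :=
  TemperedDistribution.fourierMultiplierCLM ℂ
    (fun ξ : Space n => (((1 + ‖(2 * Real.pi) • ξ‖ ^ 2) ^ (σ / 2) : ℝ) : ℂ))

/-- The norm of `T` in the Sobolev space `W_p^σ = {T : ⟨D⟩^σ T ∈ L^p}`, and `∞` outside of it. -/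
def sobolevNorm {n : ℕ} (σ : ℝ) (p : ℝ≥0∞) [Fact (1 ≤ p)] (T : Distr n) : ℝ≥0∞ :=
  lpNorm p (bracketD n σ T)

/-- The symbol of `⟨D⟩^σ` is an admissible Fourier multiplier. -/
theorem bracket_hasTemperateGrowth (n : ℕ) (σ : ℝ) :
    (fun ξ : Space n =>
      (((1 + ‖(2 * Real.pi) • ξ‖ ^ 2) ^ (σ / 2) : ℝ) : ℂ)).HasTemperateGrowth := by
  have h : (fun ξ : Space n => (2 * Real.pi) • ξ).HasTemperateGrowth := by fun_prop
  have h2 : (fun ξ : Space n => (1 + ‖ξ‖ ^ 2) ^ (σ / 2)).HasTemperateGrowth := by fun_prop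
  have h3 : (fun ξ : Space n => (1 + ‖(2 * Real.pi) • ξ‖ ^ 2) ^ (σ / 2)).HasTemperateGrowth :=
    h2.comp h
  fun_prop

/-- On an `L^p` function `lpNorm` is the usual norm. -/
theorem lpNorm_coe {n : ℕ} (p : ℝ≥0∞) [Fact (1 ≤ p)]
    (g : Lp ℂ p (volume : Measure (Space n))) :
    lpNorm p (g : Distr n) = eLpNorm g p volume := by
  apply le_antisymm
  · exact iInf₂_le (f := fun (g' : Lp ℂ p (volume : Measure (Space n)))
      (_ : (g' : Distr n) = (g : Distr n)) => eLpNorm g' p volume) g rfl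
  · refine le_iInf₂ fun g' h => ?_
    have hinj : Function.Injective
        (Lp.toTemperedDistributionCLM ℂ (volume : Measure (Space n)) p) :=
      LinearMap.ker_eq_bot.mp Lp.ker_toTemperedDistributionCLM_eq_bot
    rw [hinj h]

/-! ### The estimate -/

/-- `⟨t⟩ = (1 + t²)^{1/2}`. -/
def bracket (t : ℝ) : ℝ := Real.sqrt (1 + t ^ 2)

/-- The decay estimate at rate `ρ`: there is a constant `C` such that for all data
`f_j ∈ W_p^{N+|α|+r-j}` and every solution `u`, the derivative `∂_t^r u` exists and
`‖∂_t^r ∂_x^α u(t)‖_{L^q} ≤ C ⟨t⟩^{-ρ} ∑_j ‖f_j‖_{W_p^{N+|α|+r-j}}` for all `t ≥ 0`. -/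
def DecayEstimate {n m : ℕ} (L : Operator n m) (p q : ℝ≥0∞) [Fact (1 ≤ p)] [Fact (1 ≤ q)]
    (N : ℝ) (r : ℕ) (α : Fin n →₀ ℕ) (ρ : ℝ) : Prop :=
  ∃ C : ℝ, 0 < C ∧ ∀ f : Fin m → Distr n,
    (∀ j : Fin m, sobolevNorm (N + α.degree + r - (j : ℕ)) p (f j) < ∞) →
    ∀ u : ℝ → Distr n, L.IsSolution f u →
      ∃ v : ℝ → Distr n, IsTimeDeriv r u v ∧ ∀ t : ℝ, 0 ≤ t →
        lpNorm q (partialXPow α (v t)) ≤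
          ENNReal.ofReal (C * bracket t ^ (-ρ)) *
            ∑ j : Fin m, sobolevNorm (N + α.degree + r - (j : ℕ)) p (f j)

end HypCauchy

end

noncomputable section

namespace HypCauchy

/-! ### The Schwartz space is a Fréchet space -/

section Complete

variable {E F : Type*} [NormedAddCommGroup E] [NormedSpace ℝ E]
  [NormedAddCommGroup F] [NormedSpace ℝ F]

/-! The Fourier transform in `x` turns the Cauchy problem into the ordinary differential equation
`L(D_t, ξ) y = 0` with parameter `ξ`. If `E_j(t, ξ)` is the solution with `E_j^{(k)}(0) = δ_{jk}`,
then the transform of `u(t)` is `∑_j E_j(t, ξ) f̂_j(ξ)`. Three things are needed: pointwise bounds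
of the `E_j`, a theorem on multipliers from `L^p` to `L^q`, and uniqueness for solutions that are
merely tempered distributions.

Pointwise bounds. For large `ξ`, strict hyperbolicity separates the roots by a multiple of `⟨ξ⟩`,
and Lagrange interpolation gives `|∂_t^r E_j| ≤ K ⟨ξ⟩^{r-j} e^{-δt}`. At bounded frequencies where
all imaginary parts are positive the roots may collide, but peeling off first order factors one by
one still gives exponential decay. Near a point `ξ⁰` where `Im τ_k` vanishes, the simple root `τ_k`
splits off and contributes at most a multiple of `|τ_k|^r e^{-t Im τ_k}`, with `Im τ_k ≥
c⁻¹|ξ-ξ⁰|^s`. A compactness argument (`fundSolBound_univ`) glues the regions. If `ξ^α τ_k^r` is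
`O(|ξ-ξ⁰|^κ)` near each such point, the slow part is `|ξ-ξ⁰|^κ exp(-ct|ξ-ξ⁰|^s)`. The general
estimate and the cases (a), (b), (c) differ only in the value of `κ`.

Multipliers. Put `a = n(1/p - 1/q)`. For `p > 1` the elementary bound of `x^{a+κ} exp(-ctx^s)` by
`C⟨t⟩^{-(a+κ)/s}` for `0 < x < 1` dominates the whole multiplier by `⟨t⟩^{-(a+κ)/s} ∑_z |ξ-z|^{-a}`,
where `0` is added to the points `z` so that `⟨ξ⟩^{-N}` with `N ≥ a` is covered as well. Such
multipliers map `L^p` to `L^q` (`multiplierBound_singular`). The proof is a `TT*` argument: with `w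
= ∑_z |ξ-z|^{-a/2}`, a Paley type inequality (`exists_hasFT_weighted`) shows that `h ↦ (w h)^` is
bounded from `L²` to `L^q`, its dual says that `w ĝ ∈ L²` for `g ∈ L^p`, and `M ĝ = w · (M/w²) · (w
ĝ)`. For `p = 2` the weight is constant and Plancherel suffices. For `p = 1` the `L¹` norm of the
multiplier is estimated instead, by scaling.

Uniqueness (`cauchy_problem_unique`). The coefficients are unbounded in `ξ`, but on test functions
supported in a fixed ball of frequencies multiplication by them costs no seminorms. Banach–Steinhaus
gives one seminorm bound on `[0, T]`, the `k`-th time derivative then grows at most like `K^k`, and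
a Taylor expansion with vanishing data gives zero. -/

theorem schwartz_seminorm_cauchy {u : ℕ → 𝓢(E, F)} (hu : CauchySeq u) (k l : ℕ) {ε : ℝ}
    (hε : 0 < ε) :
    ∃ N, ∀ a ≥ N, ∀ b ≥ N, SchwartzMap.seminorm ℝ k l (u a - u b) < ε := by
  have hc : Continuous (SchwartzMap.seminorm ℝ k l : 𝓢(E, F) → ℝ) :=
    (schwartz_withSeminorms ℝ E F).continuous_seminorm (k, l)
  have h1 : Tendsto (fun x : ℕ × ℕ => u x.2 - u x.1) atTop (𝓝 0) := by
    have := hu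
    rw [cauchySeq_iff_tendsto, uniformity_eq_comap_nhds_zero, tendsto_comap_iff] at this
    exact this
  have h2 := (hc.tendsto 0).comp h1
  rw [map_zero] at h2
  have h3 := h2.eventually (gt_mem_nhds hε)
  rw [eventually_atTop] at h3
  obtain ⟨⟨a0, b0⟩, h⟩ := h3
  refine ⟨max a0 b0, fun a ha b hb => ?_⟩
  exact h (b, a) ⟨(le_max_left _ _).trans hb, (le_max_right _ _).trans ha⟩

theorem schwartz_norm_iteratedFDeriv_sub_le (f g : 𝓢(E, F)) (k l : ℕ) (x : E) :
    ‖x‖ ^ k * ‖iteratedFDeriv ℝ l f x - iteratedFDeriv ℝ l g x‖ ≤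
      SchwartzMap.seminorm ℝ k l (f - g) := by
  have h := SchwartzMap.le_seminorm ℝ k l (f - g) x
  have e : iteratedFDeriv ℝ l (⇑(f - g)) x = iteratedFDeriv ℝ l f x - iteratedFDeriv ℝ l g x := by
    have : (⇑(f - g) : E → F) = (f : E → F) - g := rfl
    rw [this]
    exact iteratedFDeriv_sub_apply (f.smooth l).contDiffAt (g.smooth l).contDiffAt
  rwa [e] at h

/-- All derivatives converge uniformly, so their limits form the Taylor series of a single function;
the weighted bounds survive the limit. Completeness is wanted for Banach–Steinhaus. -/
theorem schwartz_cauchySeq_tendsto [CompleteSpace F] {u : ℕ → 𝓢(E, F)} (hu : CauchySeq u) :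
    ∃ f : 𝓢(E, F), Tendsto u atTop (𝓝 f) := by
  have hc : ∀ l x, CauchySeq fun a => iteratedFDeriv ℝ l (u a) x := by
    intro l x
    rw [Metric.cauchySeq_iff]
    intro ε hε
    obtain ⟨N, hN⟩ := schwartz_seminorm_cauchy hu 0 l hε
    refine ⟨N, fun a ha b hb => ?_⟩
    rw [dist_eq_norm]
    have := schwartz_norm_iteratedFDeriv_sub_le (u a) (u b) 0 l x
    rw [pow_zero, one_mul] at this
    exact this.trans_lt (hN a ha b hb)
  choose p hp using fun l x => cauchySeq_tendsto_of_complete (hc l x)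
  -- Let the second index tend to infinity in the Cauchy estimate of each seminorm, at a fixed
  -- point.
  have hbd : ∀ k l, ∀ ε > 0, ∃ N, ∀ a ≥ N, ∀ x,
      ‖x‖ ^ k * ‖iteratedFDeriv ℝ l (u a) x - p l x‖ ≤ ε := by
    intro k l ε hε
    obtain ⟨N, hN⟩ := schwartz_seminorm_cauchy hu k l hε
    refine ⟨N, fun a ha x => ?_⟩
    have h1 : Tendsto (fun b => ‖x‖ ^ k * ‖iteratedFDeriv ℝ l (u a) x - iteratedFDeriv ℝ l (u b) x‖)
        atTop (𝓝 (‖x‖ ^ k * ‖iteratedFDeriv ℝ l (u a) x - p l x‖)) :=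
      ((tendsto_const_nhds.sub (hp l x)).norm).const_mul _
    refine le_of_tendsto h1 ?_
    filter_upwards [eventually_ge_atTop N] with b hb
    exact (schwartz_norm_iteratedFDeriv_sub_le _ _ _ _ _).trans (hN a ha b hb).le
  have hunif : ∀ l, TendstoUniformly (fun a x => iteratedFDeriv ℝ l (u a) x) (p l) atTop := by
    intro l
    rw [Metric.tendstoUniformly_iff]
    intro ε hε
    obtain ⟨N, hN⟩ := hbd 0 l (ε / 2) (half_pos hε)
    filter_upwards [eventually_ge_atTop N] with a ha x
    have := hN a ha x
    rw [pow_zero, one_mul] at this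
    rw [dist_comm, dist_eq_norm]
    linarith
  have hT : HasFTaylorSeriesUpTo (⊤ : ℕ∞) (fun x => (p 0 x).curry0) (fun x l => p l x) := by
    constructor
    · intro x; rfl
    · intro l _ x
      refine hasFDerivAt_of_tendstoUniformly (l := atTop)
        (f := fun a y => iteratedFDeriv ℝ l (u a) y)
        (f' := fun a y => (iteratedFDeriv ℝ (l + 1) (u a) y).curryLeft)
        (g' := fun y => (p (l + 1) y).curryLeft) ?_ ?_ (fun y => hp l y) x
      · have hiso : UniformContinuous
            (continuousMultilinearCurryLeftEquiv ℝ (fun _ : Fin (l + 1) => E) F) :=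
          (continuousMultilinearCurryLeftEquiv ℝ (fun _ : Fin (l + 1) => E) F).isometry.uniformContinuous
        exact hiso.comp_tendstoUniformly (hunif (l + 1))
      · intro a y
        have := contDiff_iff_ftaylorSeries.1 ((u a).smooth (⊤ : ℕ∞))
        exact this.fderiv l (by exact_mod_cast WithTop.coe_lt_top l) y
    · intro l _
      refine (hunif l).continuous (Frequently.of_forall fun a => ?_)
      exact ((u a).smooth l).continuous_iteratedFDeriv'
  have hit : ∀ l x, iteratedFDeriv ℝ l (fun x => (p 0 x).curry0) x = p l x := by
    intro l x
    exact (hT.eq_iteratedFDeriv (by exact_mod_cast le_top) x).symm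
  let f : 𝓢(E, F) :=
    { toFun := fun x => (p 0 x).curry0
      smooth' := hT.contDiff
      decay' := by
        intro k l
        obtain ⟨N, hN⟩ := hbd k l 1 one_pos
        refine ⟨SchwartzMap.seminorm ℝ k l (u N) + 1, fun x => ?_⟩
        rw [hit]
        have h1 := hN N le_rfl x
        have h2 := SchwartzMap.le_seminorm ℝ k l (u N) x
        have h3 : ‖p l x‖ ≤ ‖iteratedFDeriv ℝ l (u N) x‖ + ‖iteratedFDeriv ℝ l (u N) x - p l x‖ := by
          rw [norm_sub_rev]
          have := norm_add_le (iteratedFDeriv ℝ l (u N) x) (p l x - iteratedFDeriv ℝ l (u N) x)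
          simpa using this
        calc ‖x‖ ^ k * ‖p l x‖ ≤ ‖x‖ ^ k * (‖iteratedFDeriv ℝ l (u N) x‖ +
              ‖iteratedFDeriv ℝ l (u N) x - p l x‖) := by gcongr
          _ ≤ _ := by rw [mul_add]; linarith }
  refine ⟨f, ?_⟩
  rw [(schwartz_withSeminorms ℝ E F).tendsto_nhds_atTop]
  rintro ⟨k, l⟩ ε hε
  obtain ⟨N, hN⟩ := hbd k l (ε / 2) (half_pos hε)
  refine ⟨N, fun a ha => ?_⟩
  change SchwartzMap.seminorm ℝ k l (u a - f) < ε
  refine (SchwartzMap.seminorm_le_bound ℝ k l (u a - f) (half_pos hε).le fun x => ?_).trans_lt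
    (half_lt_self hε)
  have e : iteratedFDeriv ℝ l (⇑(u a - f)) x = iteratedFDeriv ℝ l (u a) x - p l x := by
    have : (⇑(u a - f) : E → F) = (u a : E → F) - f := rfl
    rw [this, iteratedFDeriv_sub_apply ((u a).smooth l).contDiffAt (f.smooth l).contDiffAt]
    congr 1
    exact hit l x
  rw [e]
  exact hN a ha x

instance schwartz_uniformity_isCountablyGenerated :
    (uniformity 𝓢(E, F)).IsCountablyGenerated :=
  IsUniformAddGroup.uniformity_countably_generated

instance schwartz_completeSpace [CompleteSpace F] : CompleteSpace 𝓢(E, F) :=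
  UniformSpace.complete_of_cauchySeq_tendsto fun _ hu => schwartz_cauchySeq_tendsto hu

/-- A weakly bounded family of tempered distributions is bounded by one Schwartz seminorm. -/
theorem exists_seminorm_bound {ι : Type*} (T : ι → 𝓢'(E, ℂ))
    (hT : ∀ φ, ∃ M : ℝ, ∀ i, ‖T i φ‖ ≤ M) :
    ∃ (s : Finset (ℕ × ℕ)) (C : ℝ), 0 ≤ C ∧
      ∀ i φ, ‖T i φ‖ ≤ C * s.sup (schwartzSeminormFamily ℂ E ℂ) φ := by
  let q : ι → Seminorm ℂ 𝓢(E, ℂ) := fun i =>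
    (normSeminorm ℂ ℂ).comp (T i : 𝓢(E, ℂ) →L[ℂ] ℂ).toLinearMap
  have hq : ∀ i φ, q i φ = ‖T i φ‖ := fun i φ => rfl
  have hqc : ∀ i, Continuous (q i) := fun i =>
    (continuous_norm.comp (T i : 𝓢(E, ℂ) →L[ℂ] ℂ).continuous)
  have hb : BddAbove (Set.range q) := by
    rw [Seminorm.bddAbove_range_iff]
    intro φ
    obtain ⟨M, hM⟩ := hT φ
    exact ⟨M, by rintro _ ⟨i, rfl⟩; exact hM i⟩
  -- Banach–Steinhaus: the Schwartz space is complete and metrizable, hence barrelled, so a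
  -- pointwise finite supremum of continuous seminorms is continuous.
  have hc : Continuous (⨆ i, q i : Seminorm ℂ 𝓢(E, ℂ)) := by
    rw [Seminorm.coe_iSup_eq hb]
    exact Seminorm.continuous_iSup q hqc hb
  obtain ⟨s, C, -, hC⟩ := Seminorm.bound_of_continuous (schwartz_withSeminorms ℂ E ℂ) _ hc
  refine ⟨s, C, C.2, fun i φ => ?_⟩
  have h0 : q i ≤ ⨆ i, q i := le_ciSup (f := q) hb i
  have h1 : q i φ ≤ (⨆ i, q i : Seminorm ℂ 𝓢(E, ℂ)) φ := h0 φ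
  have h2 := hC φ
  exact h1.trans h2

end Complete

/-! ### Density of compactly supported functions in the Schwartz space. -/

section Dense

variable {E : Type*} [NormedAddCommGroup E] [InnerProductSpace ℝ E] [FiniteDimensional ℝ E]

/-- The product of a Schwartz function with a smooth cutoff at scale `N + 1`. -/
theorem exists_cutoff_tendsto (φ : 𝓢(E, ℂ)) :
    ∃ ψ : ℕ → 𝓢(E, ℂ), (∀ N, HasCompactSupport (ψ N)) ∧ Tendsto ψ atTop (𝓝 φ) := by
  let χ : ContDiffBump (0 : E) := ⟨1, 2, one_pos, one_lt_two⟩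
  let c : ℕ → ℝ := fun N => ((N : ℝ) + 1)⁻¹
  have hc0 : ∀ N, 0 < c N := fun N => by positivity
  have hc1 : ∀ N, c N ≤ 1 := fun N => inv_le_one_of_one_le₀ (by linarith [Nat.cast_nonneg (α := ℝ) N])
  let g : ℕ → E → ℂ := fun N x => ((χ (c N • x) : ℝ) : ℂ)
  have hχ : ContDiff ℝ (⊤ : ℕ∞) (fun x : E => ((χ x : ℝ) : ℂ)) :=
    Complex.ofRealCLM.contDiff.comp χ.contDiff
  have hχs : HasCompactSupport (fun x : E => ((χ x : ℝ) : ℂ)) :=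
    χ.hasCompactSupport.comp_left (g := Complex.ofReal) rfl
  have hg : ∀ N, ContDiff ℝ (⊤ : ℕ∞) (g N) := fun N =>
    hχ.comp (contDiff_const_smul (c N))
  have hgs : ∀ N, HasCompactSupport (g N) := fun N =>
    hχs.comp_homeomorph (Homeomorph.smulOfNeZero (c N) (hc0 N).ne')
  have hgt : ∀ N, (g N).HasTemperateGrowth := fun N => (hgs N).hasTemperateGrowth (hg N)
  -- Each derivative of the cutoff at scale `N + 1` produces a factor `c N ≤ 1`, so the bounds are
  -- uniform in `N`.
  have hB : ∀ i : ℕ, ∃ B : ℝ, 0 ≤ B ∧ ∀ N x, ‖iteratedFDeriv ℝ i (fun y => 1 - g N y) x‖ ≤ B := by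
    intro i
    obtain ⟨B, hB⟩ := (hχs.iteratedFDeriv (𝕜 := ℝ) i).exists_bound_of_continuous
      ((hχ.of_le (m := i) (by exact_mod_cast le_top)).continuous_iteratedFDeriv')
    have hB0 : 0 ≤ B := (norm_nonneg _).trans (hB 0)
    refine ⟨‖iteratedFDeriv ℝ i (fun _ : E => (1 : ℂ)) 0‖ + B, by positivity, fun N x => ?_⟩
    have e1 : iteratedFDeriv ℝ i (fun y => 1 - g N y) x =
        iteratedFDeriv ℝ i (fun _ : E => (1 : ℂ)) x - iteratedFDeriv ℝ i (g N) x :=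
      iteratedFDeriv_sub_apply contDiff_const.contDiffAt
        ((hg N).of_le (m := i) (by exact_mod_cast le_top)).contDiffAt
    have e2 : ‖iteratedFDeriv ℝ i (g N) x‖ ≤ B := by
      have := congrFun (iteratedFDeriv_comp_const_smul (𝕜 := ℝ) (c N)
        (hχ.of_le (m := i) (by exact_mod_cast le_top))) x
      change ‖iteratedFDeriv ℝ i (fun z => (fun x : E => ((χ x : ℝ) : ℂ)) (c N • z)) x‖ ≤ B
      rw [this, norm_smul]
      calc ‖c N ^ i‖ * _ ≤ 1 * B := by
            gcongr
            · rw [norm_pow, Real.norm_of_nonneg (hc0 N).le]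
              exact pow_le_one₀ (hc0 N).le (hc1 N)
            · exact hB _
        _ = B := one_mul B
    have e3 : ‖iteratedFDeriv ℝ i (fun _ : E => (1 : ℂ)) x‖ =
        ‖iteratedFDeriv ℝ i (fun _ : E => (1 : ℂ)) 0‖ := by
      rcases Nat.eq_zero_or_pos i with h | h
      · subst h; simp
      · rw [iteratedFDeriv_const_of_ne h.ne']; rfl
    rw [e1, ← e3]
    exact (norm_sub_le _ _).trans (by gcongr)
  choose B hB0 hB using hB
  have hvan : ∀ (N i : ℕ) (x : E), ‖x‖ < N + 1 → iteratedFDeriv ℝ i (fun y => 1 - g N y) x = 0 := by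
    intro N i x hx
    have h0 : (fun y => 1 - g N y) =ᶠ[𝓝 x] fun _ => (0 : ℂ) := by
      have : ∀ᶠ y in 𝓝 x, ‖y‖ < N + 1 := continuous_norm.continuousAt.eventually (gt_mem_nhds hx)
      filter_upwards [this] with y hy
      have : χ (c N • y) = 1 := by
        apply χ.one_of_mem_closedBall
        rw [mem_closedBall_zero_iff, norm_smul, Real.norm_of_nonneg (hc0 N).le]
        change ((N : ℝ) + 1)⁻¹ * ‖y‖ ≤ 1
        rw [inv_mul_le_iff₀ (by positivity)]
        linarith
      simp [g, this]
    rw [(h0.iteratedFDeriv ℝ i).eq_of_nhds]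
    have := iteratedFDeriv_fun_zero (𝕜 := ℝ) (E := E) (F := ℂ) (n := i)
    exact congrFun this x
  refine ⟨fun N => SchwartzMap.smulLeftCLM ℂ (g N) φ, fun N => ?_, ?_⟩
  · rw [SchwartzMap.smulLeftCLM_apply (hgt N)]
    exact (hgs N).smul_right
  · rw [(schwartz_withSeminorms ℝ E ℂ).tendsto_nhds_atTop]
    rintro ⟨k, l⟩ ε hε
    let K : ℝ := ∑ i ∈ Finset.range (l + 1), (l.choose i : ℝ) * B i *
      SchwartzMap.seminorm ℝ (k + 1) (l - i) φ
    have hK : 0 ≤ K := Finset.sum_nonneg fun i _ => by have := hB0 i; positivity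
    obtain ⟨N₀, hN₀⟩ := exists_nat_gt (K / ε)
    refine ⟨N₀, fun N hN => ?_⟩
    change SchwartzMap.seminorm ℝ k l (SchwartzMap.smulLeftCLM ℂ (g N) φ - φ) < ε
    have hlt : c N * K < ε := by
      change ((N : ℝ) + 1)⁻¹ * K < ε
      rw [inv_mul_lt_iff₀ (by positivity)]
      rw [div_lt_iff₀ hε] at hN₀
      have : (N₀ : ℝ) ≤ N := by exact_mod_cast hN
      nlinarith
    refine lt_of_le_of_lt ?_ hlt
    refine SchwartzMap.seminorm_le_bound ℝ k l _ (mul_nonneg (hc0 N).le hK) fun x => ?_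
    have e : (⇑(SchwartzMap.smulLeftCLM ℂ (g N) φ - φ) : E → ℂ) =
        -(fun y => (1 - g N y) • φ y) := by
      ext y
      have : (SchwartzMap.smulLeftCLM ℂ (g N) φ - φ) y =
        SchwartzMap.smulLeftCLM ℂ (g N) φ y - φ y := rfl
      rw [this, SchwartzMap.smulLeftCLM_apply_apply (hgt N)]
      simp only [smul_eq_mul, Pi.neg_apply]
      ring
    rw [e, iteratedFDeriv_neg_apply, norm_neg]
    rcases lt_or_ge ‖x‖ (N + 1) with hx | hx
    · have := norm_iteratedFDeriv_smul_le (𝕜 := ℝ) (f := fun y => 1 - g N y) (N := (⊤ : ℕ∞)) (contDiff_const.sub (hg N))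
        (φ.smooth ⊤) x (n := l) (by exact_mod_cast le_top)
      have h0 : ‖iteratedFDeriv ℝ l (fun y => (1 - g N y) • φ y) x‖ ≤ 0 := by
        refine this.trans (le_of_eq (Finset.sum_eq_zero fun i _ => ?_))
        rw [hvan N i x hx]; simp
      have h1 := le_antisymm h0 (norm_nonneg _)
      rw [h1, mul_zero]
      exact mul_nonneg (hc0 N).le hK
    · have := norm_iteratedFDeriv_smul_le (𝕜 := ℝ) (f := fun y => 1 - g N y) (N := (⊤ : ℕ∞)) (contDiff_const.sub (hg N))
        (φ.smooth ⊤) x (n := l) (by exact_mod_cast le_top)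
      -- The difference lives on `‖x‖ ≥ N + 1`, where one extra power of `‖x‖` buys the factor `1 /
      -- (N + 1)`. This is why `K` uses the seminorms with weight `k + 1`.
      have hcx : 1 ≤ c N * ‖x‖ := by
        change 1 ≤ ((N : ℝ) + 1)⁻¹ * ‖x‖
        rw [le_inv_mul_iff₀ (by positivity)]; linarith
      calc ‖x‖ ^ k * ‖iteratedFDeriv ℝ l (fun y => (1 - g N y) • φ y) x‖
          ≤ (c N * ‖x‖) * (‖x‖ ^ k * ∑ i ∈ Finset.range (l + 1), (l.choose i : ℝ) *
            ‖iteratedFDeriv ℝ i (fun y => 1 - g N y) x‖ * ‖iteratedFDeriv ℝ (l - i) φ x‖) := by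
            refine le_trans ?_ (le_mul_of_one_le_left (by positivity) hcx)
            gcongr
        _ = c N * ∑ i ∈ Finset.range (l + 1), (l.choose i : ℝ) *
            ‖iteratedFDeriv ℝ i (fun y => 1 - g N y) x‖ *
              (‖x‖ ^ (k + 1) * ‖iteratedFDeriv ℝ (l - i) φ x‖) := by
            rw [Finset.mul_sum, Finset.mul_sum, Finset.mul_sum]
            refine Finset.sum_congr rfl fun i _ => ?_
            ring
        _ ≤ c N * K := by
            refine mul_le_mul_of_nonneg_left (Finset.sum_le_sum fun i _ => ?_) (hc0 N).le
            gcongr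
            · exact mul_nonneg (Nat.cast_nonneg _) (hB0 i)
            · exact hB i N x
            · exact SchwartzMap.le_seminorm ℝ (k + 1) (l - i) φ x

theorem temperedDistribution_eq_zero_of_compactSupport {T : 𝓢'(E, ℂ)}
    (h : ∀ φ : 𝓢(E, ℂ), HasCompactSupport φ → T φ = 0) : T = 0 := by
  ext φ
  obtain ⟨ψ, hψ, ht⟩ := exists_cutoff_tendsto φ
  have h1 := ((T : 𝓢(E, ℂ) →L[ℂ] ℂ).continuous.tendsto φ).comp ht
  have h2 : ∀ N, T (ψ N) = 0 := fun N => h _ (hψ N)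
  refine tendsto_nhds_unique h1 ?_
  refine tendsto_const_nhds.congr fun N => (h2 N).symm

end Dense

/-! ### Uniqueness for the Cauchy problem on the Fourier side -/

section Uniqueness

variable {E : Type*} [NormedAddCommGroup E] [InnerProductSpace ℝ E]

/-- Multiplication by a fixed smooth function is bounded, without loss of seminorms, on Schwartz
functions supported in a fixed bounded set. -/
theorem exists_sup_seminorm_smulLeft_le [FiniteDimensional ℝ E] {a : E → ℂ} (ha : a.HasTemperateGrowth) (R : ℝ) (M : ℕ) :
    ∃ A : ℝ, 0 ≤ A ∧ ∀ φ : 𝓢(E, ℂ), tsupport φ ⊆ Metric.closedBall 0 R →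
      (Finset.Iic (M, M)).sup (schwartzSeminormFamily ℂ E ℂ) (SchwartzMap.smulLeftCLM ℂ a φ) ≤
        A * (Finset.Iic (M, M)).sup (schwartzSeminormFamily ℂ E ℂ) φ := by
  have hac : ∀ i : ℕ, ∃ B : ℝ, 0 ≤ B ∧ ∀ x ∈ Metric.closedBall (0 : E) R,
      ‖iteratedFDeriv ℝ i a x‖ ≤ B := by
    intro i
    have hcont := (ha.1.of_le (m := i) (by exact_mod_cast le_top)).continuous_iteratedFDeriv'
    obtain ⟨B, hB⟩ := (isCompact_closedBall (0 : E) R).exists_bound_of_continuousOn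
      hcont.continuousOn
    exact ⟨max B 0, le_max_right _ _, fun x hx => (hB x hx).trans (le_max_left _ _)⟩
  choose B hB0 hB using hac
  let A : ℝ := ∑ l ∈ Finset.range (M + 1), ∑ i ∈ Finset.range (l + 1), (l.choose i : ℝ) * B i
  have hA0 : 0 ≤ A := Finset.sum_nonneg fun l _ => Finset.sum_nonneg fun i _ => by
    have := hB0 i; positivity
  refine ⟨A, hA0, fun φ hφ => ?_⟩
  set S := (Finset.Iic (M, M)).sup (schwartzSeminormFamily ℂ E ℂ) φ with hS
  have hS0 : 0 ≤ S := apply_nonneg _ _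
  refine Seminorm.finset_sup_apply_le (mul_nonneg hA0 hS0) ?_
  rintro ⟨k, l⟩ hkl
  rw [Finset.mem_Iic, Prod.mk_le_mk] at hkl
  change SchwartzMap.seminorm ℂ k l _ ≤ _
  refine SchwartzMap.seminorm_le_bound ℂ k l _ (mul_nonneg hA0 hS0) fun x => ?_
  by_cases hx : x ∈ Metric.closedBall (0 : E) R
  · have e : (⇑(SchwartzMap.smulLeftCLM ℂ a φ) : E → ℂ) = fun y => a y • φ y := by
      ext y; exact SchwartzMap.smulLeftCLM_apply_apply ha φ y
    rw [e]
    have h1 := norm_iteratedFDeriv_smul_le (𝕜 := ℝ) (N := (⊤ : ℕ∞)) ha.1 (φ.smooth ⊤) x (n := l)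
      (by exact_mod_cast le_top)
    calc ‖x‖ ^ k * ‖iteratedFDeriv ℝ l (fun y => a y • φ y) x‖
        ≤ ‖x‖ ^ k * ∑ i ∈ Finset.range (l + 1), (l.choose i : ℝ) * ‖iteratedFDeriv ℝ i a x‖ *
          ‖iteratedFDeriv ℝ (l - i) φ x‖ := by gcongr
      _ = ∑ i ∈ Finset.range (l + 1), (l.choose i : ℝ) * ‖iteratedFDeriv ℝ i a x‖ *
          (‖x‖ ^ k * ‖iteratedFDeriv ℝ (l - i) φ x‖) := by
          rw [Finset.mul_sum]; exact Finset.sum_congr rfl fun i _ => by ring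
      _ ≤ ∑ i ∈ Finset.range (l + 1), (l.choose i : ℝ) * B i * S := by
          refine Finset.sum_le_sum fun i hi => ?_
          gcongr
          · exact mul_nonneg (Nat.cast_nonneg _) (hB0 i)
          · exact hB i x hx
          · refine (SchwartzMap.le_seminorm ℂ k (l - i) φ x).trans ?_
            have : (schwartzSeminormFamily ℂ E ℂ (k, l - i)) ≤
              (Finset.Iic (M, M)).sup (schwartzSeminormFamily ℂ E ℂ) :=
              Finset.le_sup (f := schwartzSeminormFamily ℂ E ℂ) (by
                rw [Finset.mem_Iic, Prod.mk_le_mk]; exact ⟨hkl.1, (Nat.sub_le _ _).trans hkl.2⟩)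
            exact this φ
      _ = (∑ i ∈ Finset.range (l + 1), (l.choose i : ℝ) * B i) * S := by rw [Finset.sum_mul]
      _ ≤ A * S := by
          gcongr
          exact Finset.single_le_sum (f := fun l => ∑ i ∈ Finset.range (l + 1),
            (l.choose i : ℝ) * B i) (fun l _ => Finset.sum_nonneg fun i _ => by
              have := hB0 i; positivity) (Finset.mem_range.2 (Nat.lt_succ_of_le hkl.2))
  · have h0 : x ∉ tsupport (iteratedFDeriv ℝ l (⇑(SchwartzMap.smulLeftCLM ℂ a φ) : E → ℂ)) := by
      intro h
      have h2 := tsupport_iteratedFDeriv_subset (𝕜 := ℝ) l h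
      exact hx (hφ ((SchwartzMap.tsupport_smulLeftCLM_subset a φ h2).1))
    rw [image_eq_zero_of_notMem_tsupport h0, norm_zero, mul_zero]
    exact mul_nonneg hA0 hS0

/-- All higher time derivatives of a solution of a linear equation of order `m`. -/
def extendDeriv {m : ℕ} (a : Fin m → E → ℂ) (V : ℕ → ℝ → 𝓢'(E, ℂ)) : ℕ → ℝ → 𝓢'(E, ℂ)
  | k => if k < m then V k else fun t => ∑ j : Fin m,
      TemperedDistribution.smulLeftCLM ℂ (a j) (extendDeriv a V (k - m + j) t)
  termination_by k => k
  decreasing_by omega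

theorem extendDeriv_of_lt {m : ℕ} (a : Fin m → E → ℂ) (V : ℕ → ℝ → 𝓢'(E, ℂ)) {k : ℕ} (h : k < m) :
    extendDeriv a V k = V k := by
  rw [extendDeriv, if_pos h]

theorem extendDeriv_add {m : ℕ} (a : Fin m → E → ℂ) (V : ℕ → ℝ → 𝓢'(E, ℂ)) (k : ℕ) :
    extendDeriv a V (k + m) = fun t => ∑ j : Fin m,
      TemperedDistribution.smulLeftCLM ℂ (a j) (extendDeriv a V (k + j) t) := by
  rw [extendDeriv, if_neg (by omega)]
  simp

theorem sum_distr_apply {ι : Type*} (s : Finset ι) (T : ι → 𝓢'(E, ℂ)) (φ : 𝓢(E, ℂ)) :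
    (∑ i ∈ s, T i) φ = ∑ i ∈ s, T i φ := by
  classical
  induction s using Finset.induction_on with
  | empty => simp
  | insert i s hi ih => rw [Finset.sum_insert hi, Finset.sum_insert hi, ← ih]; rfl

theorem extendDeriv_add_apply {m : ℕ} (a : Fin m → E → ℂ) (V : ℕ → ℝ → 𝓢'(E, ℂ)) (k : ℕ) (t : ℝ)
    (φ : 𝓢(E, ℂ)) :
    extendDeriv a V (k + m) t φ = ∑ j : Fin m,
      extendDeriv a V (k + j) t (SchwartzMap.smulLeftCLM ℂ (a j) φ) := by
  rw [extendDeriv_add, sum_distr_apply]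
  rfl

variable {m : ℕ} {a : Fin m → E → ℂ} {V : ℕ → ℝ → 𝓢'(E, ℂ)}

/-- The equation may be differentiated in time because its coefficients do not depend on `t`. Only
the passage from order `m - 1` to `m` at `t = 0` is delicate, since the equation is assumed for `t >
0` alone. -/
theorem extendDeriv_hasDerivWithinAt
    (hV : ∀ k < m, ∀ t : ℝ, 0 ≤ t → ∀ φ : 𝓢(E, ℂ),
      HasDerivWithinAt (fun s => V k s φ) (V (k + 1) t φ) (Set.Ici 0) t)
    (hEq : ∀ t : ℝ, 0 < t → ∀ φ : 𝓢(E, ℂ),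
      V m t φ = ∑ j : Fin m, V j t (SchwartzMap.smulLeftCLM ℂ (a j) φ)) (k : ℕ) :
    ∀ t : ℝ, 0 ≤ t → ∀ φ : 𝓢(E, ℂ),
      HasDerivWithinAt (fun s => extendDeriv a V k s φ) (extendDeriv a V (k + 1) t φ)
        (Set.Ici 0) t := by
  induction k using Nat.strong_induction_on with
  | _ k ih =>
  intro t ht φ
  rcases lt_or_ge k m with hk | hk
  · rw [extendDeriv_of_lt a V hk]
    rcases lt_or_ge (k + 1) m with hk1 | hk1
    · rw [extendDeriv_of_lt a V hk1]
      exact hV k hk t ht φ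
    · have hkm : k + 1 = 0 + m := by omega
      have hform : ∀ s φ, extendDeriv a V (k + 1) s φ =
          ∑ j : Fin m, V j s (SchwartzMap.smulLeftCLM ℂ (a j) φ) := by
        intro s φ
        rw [hkm, extendDeriv_add_apply]
        refine Finset.sum_congr rfl fun j _ => ?_
        rw [zero_add, extendDeriv_of_lt a V j.2]
      rcases ht.eq_or_lt with h0 | h0
      · subst h0
        rw [hform]
        have hd : ∀ s : ℝ, 0 < s → HasDerivAt (fun s => V k s φ) (V (k + 1) s φ) s := fun s hs =>
          (hV k hk s hs.le φ).hasDerivAt (Ici_mem_nhds hs)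
        -- At `t = 0` the derivative is recovered as the limit of the derivatives at `t > 0`, which
        -- the equation expresses by quantities continuous up to `0`.
        refine hasDerivWithinAt_Ici_of_tendsto_deriv (s := Set.Ioi 0)
          (fun s hs => (hd s hs).differentiableAt.differentiableWithinAt)
          ((hV k hk 0 le_rfl φ).continuousWithinAt.mono Set.Ioi_subset_Ici_self)
          self_mem_nhdsWithin ?_
        have hcont : Tendsto (fun s => ∑ j : Fin m, V j s (SchwartzMap.smulLeftCLM ℂ (a j) φ))
            (𝓝[>] 0) (𝓝 (∑ j : Fin m, V j 0 (SchwartzMap.smulLeftCLM ℂ (a j) φ))) :=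
          tendsto_finsetSum _ fun j _ =>
            ((hV j j.2 0 le_rfl _).continuousWithinAt.mono Set.Ioi_subset_Ici_self)
        refine hcont.congr' ?_
        filter_upwards [self_mem_nhdsWithin] with s hs
        rw [(hd s hs).deriv, hkm, zero_add, hEq s hs]
      · rw [hform, ← hEq t h0, show m = k + 1 by omega]
        exact hV k hk t ht φ
  · obtain ⟨i, rfl⟩ : ∃ i, k = i + m := ⟨k - m, by omega⟩
    have e : i + m + 1 = (i + 1) + m := by omega
    simp_rw [e, extendDeriv_add_apply]
    refine HasDerivWithinAt.fun_sum fun j _ => ?_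
    have := ih (i + j) (by omega) t ht (SchwartzMap.smulLeftCLM ℂ (a j) φ)
    rwa [show i + 1 + (j : ℕ) = i + j + 1 by omega]

theorem extendDeriv_zero (hinit : ∀ k < m, V k 0 = 0) (k : ℕ) : extendDeriv a V k 0 = 0 := by
  induction k using Nat.strong_induction_on with
  | _ k ih =>
  rcases lt_or_ge k m with hk | hk
  · rw [extendDeriv_of_lt a V hk, hinit k hk]
  · obtain ⟨i, rfl⟩ : ∃ i, k = i + m := ⟨k - m, by omega⟩
    rw [extendDeriv_add]
    refine Finset.sum_eq_zero fun j _ => ?_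
    rw [ih (i + j) (by omega), map_zero]

/-- On test functions supported in a fixed ball the multipliers `a j` are bounded for one fixed
seminorm. All time derivatives then obey geometric bounds, so Taylor's formula with vanishing data
at `0` forces the solution to vanish. Compactly supported tests suffice by density. -/
theorem cauchy_problem_unique [FiniteDimensional ℝ E] (hm : 0 < m) (ha : ∀ j, (a j).HasTemperateGrowth)
    (hV : ∀ k < m, ∀ t : ℝ, 0 ≤ t → ∀ φ : 𝓢(E, ℂ),
      HasDerivWithinAt (fun s => V k s φ) (V (k + 1) t φ) (Set.Ici 0) t)
    (hEq : ∀ t : ℝ, 0 < t → ∀ φ : 𝓢(E, ℂ),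
      V m t φ = ∑ j : Fin m, V j t (SchwartzMap.smulLeftCLM ℂ (a j) φ))
    (hinit : ∀ k < m, V k 0 = 0) : ∀ T : ℝ, 0 ≤ T → V 0 T = 0 := by
  intro T hT
  have hD := extendDeriv_hasDerivWithinAt hV hEq
  set W := extendDeriv a V with hW
  apply temperedDistribution_eq_zero_of_compactSupport
  intro φ₀ hφ₀
  obtain ⟨R, hR⟩ := hφ₀.isBounded.subset_closedBall 0
  -- a uniform seminorm bound for `W k t`, `k < m`, `t ∈ [0, T]`
  obtain ⟨s, C, hC0, hC⟩ := exists_seminorm_bound (E := E)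
    (fun i : Fin m × Set.Icc (0 : ℝ) T => W i.1 i.2) (by
      intro φ
      have : ∀ j : Fin m, ∃ M : ℝ, ∀ t ∈ Set.Icc (0 : ℝ) T, ‖W j t φ‖ ≤ M := fun j =>
        isCompact_Icc.exists_bound_of_continuousOn fun t ht =>
          ((hD j t ht.1 φ).continuousWithinAt).mono Set.Icc_subset_Ici_self
      choose M hM using this
      refine ⟨∑ j, |M j|, fun i => ?_⟩
      exact (hM i.1 i.2 i.2.2).trans ((le_abs_self _).trans
        (Finset.single_le_sum (f := fun j => |M j|) (fun j _ => abs_nonneg _)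
          (Finset.mem_univ i.1))))
  obtain ⟨M, hM⟩ : ∃ M : ℕ, s ⊆ Finset.Iic (M, M) := by
    refine ⟨s.sup fun x => max x.1 x.2, fun x hx => ?_⟩
    have := Finset.le_sup (f := fun x : ℕ × ℕ => max x.1 x.2) hx
    rw [Finset.mem_Iic]
    exact ⟨(le_max_left _ _).trans this, (le_max_right _ _).trans this⟩
  set p := (Finset.Iic (M, M)).sup (schwartzSeminormFamily ℂ E ℂ) with hp
  have hC' : ∀ j : Fin m, ∀ t ∈ Set.Icc (0 : ℝ) T, ∀ φ, ‖W j t φ‖ ≤ C * p φ := fun j t ht φ =>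
    (hC (j, ⟨t, ht⟩) φ).trans (mul_le_mul_of_nonneg_left
      ((Finset.sup_mono hM : s.sup (schwartzSeminormFamily ℂ E ℂ) ≤ p) φ) hC0)
  choose A hA0 hA using fun j => exists_sup_seminorm_smulLeft_le (ha j) R M
  -- The summand `1` ensures `K ≥ 1`, so that lower powers of `K` are dominated by higher ones.
  set K : ℝ := 1 + ∑ j, A j with hK
  have hsA : 0 ≤ ∑ j, A j := Finset.sum_nonneg fun j _ => hA0 j
  have hK1 : 1 ≤ K := by linarith
  have hWb : ∀ k : ℕ, ∀ t ∈ Set.Icc (0 : ℝ) T, ∀ φ : 𝓢(E, ℂ), tsupport φ ⊆ Metric.closedBall 0 R →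
      ‖W k t φ‖ ≤ C * K ^ k * p φ := by
    intro k
    induction k using Nat.strong_induction_on with
    | _ k ih =>
    intro t ht φ hφ
    have hp0 : 0 ≤ p φ := apply_nonneg _ _
    rcases lt_or_ge k m with hk | hk
    · refine (hC' ⟨k, hk⟩ t ht φ).trans ?_
      gcongr
      exact le_mul_of_one_le_right hC0 (one_le_pow₀ hK1)
    · obtain ⟨i, rfl⟩ : ∃ i, k = i + m := ⟨k - m, by omega⟩
      rw [hW, extendDeriv_add_apply]
      calc ‖∑ j : Fin m, W (i + j) t (SchwartzMap.smulLeftCLM ℂ (a j) φ)‖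
          ≤ ∑ j : Fin m, ‖W (i + j) t (SchwartzMap.smulLeftCLM ℂ (a j) φ)‖ := norm_sum_le _ _
        _ ≤ ∑ j : Fin m, C * K ^ (i + m - 1) * (A j * p φ) := by
            refine Finset.sum_le_sum fun j _ => ?_
            refine (ih (i + j) (by omega) t ht _
              (((SchwartzMap.tsupport_smulLeftCLM_subset (a j) φ).trans
                Set.inter_subset_left).trans hφ)).trans ?_
            have h1 : K ^ (i + (j : ℕ)) ≤ K ^ (i + m - 1) := pow_le_pow_right₀ hK1 (by omega)
            have h2 := hA j φ hφ
            have h3 : 0 ≤ p (SchwartzMap.smulLeftCLM ℂ (a j) φ) := apply_nonneg _ _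
            gcongr
        _ = C * K ^ (i + m - 1) * ((∑ j, A j) * p φ) := by
            rw [← Finset.mul_sum, Finset.sum_mul]
        _ ≤ C * K ^ (i + m - 1) * (K * p φ) := by gcongr; linarith
        _ = C * K ^ (i + m) * p φ := by
            rw [show i + m = (i + m - 1) + 1 by omega, pow_succ]
            simp only [Nat.add_sub_cancel]
            ring
  -- Taylor's remainder by induction on `N`, for all `k` at once: the bound with `N` for the
  -- derivative of order `k + 1` is integrated from the zero value at `t = 0`.
  have hTay : ∀ N k : ℕ, ∀ t ∈ Set.Icc (0 : ℝ) T,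
      ‖W k t φ₀‖ ≤ C * K ^ (N + k) * p φ₀ * (t ^ N / N.factorial) := by
    intro N
    induction N with
    | zero =>
      intro k t ht
      simpa using hWb k t ht φ₀ hR
    | succ N ih =>
      intro k t ht
      have hb := image_norm_le_of_norm_deriv_right_le_deriv_boundary
        (f := fun s => W k s φ₀) (f' := fun s => W (k + 1) s φ₀) (a := 0) (b := T)
        (B := fun s => C * K ^ (N + 1 + k) * p φ₀ * (s ^ (N + 1) / (N + 1).factorial))
        (B' := fun s => C * K ^ (N + 1 + k) * p φ₀ * (s ^ N / N.factorial))
        (fun s hs => ((hD k s hs.1 φ₀).continuousWithinAt).mono Set.Icc_subset_Ici_self)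
        (fun s hs => (hD k s hs.1 φ₀).mono (Set.Ici_subset_Ici.2 hs.1))
        (by
          have : W k 0 = 0 := extendDeriv_zero hinit k
          rw [this]
          simp)
        (fun s => by
          have h1 := ((hasDerivAt_pow (N + 1) s).div_const ((N + 1).factorial : ℝ)).const_mul
            (C * K ^ (N + 1 + k) * p φ₀)
          refine h1.congr_deriv ?_
          rw [Nat.factorial_succ]
          push_cast
          have : (N.factorial : ℝ) ≠ 0 := by positivity
          have h3 : (N : ℝ) + 1 ≠ 0 := by positivity
          field_simp)
        (fun s hs => by
          have := ih (k + 1) s ⟨hs.1, hs.2.le⟩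
          rwa [show N + (k + 1) = N + 1 + k by omega] at this)
      exact hb ht
  have hlim : Tendsto (fun N : ℕ => C * K ^ (N + 0) * p φ₀ * (T ^ N / N.factorial)) atTop (𝓝 0) := by
    have h1 := (FloorSemiring.tendsto_pow_div_factorial_atTop (K * T)).const_mul (C * p φ₀)
    rw [mul_zero] at h1
    refine h1.congr fun N => ?_
    rw [mul_pow, add_zero]; ring
  have h0 : ‖W 0 T φ₀‖ ≤ 0 := ge_of_tendsto' hlim fun N => hTay N 0 T ⟨hT, le_rfl⟩
  rw [hW, extendDeriv_of_lt a V hm] at h0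
  exact norm_le_zero_iff.1 h0

end Uniqueness

/-! ### Fundamental solutions of ordinary differential equations -/

section Ode

open Polynomial

variable {m : ℕ}

/-- The companion operator of `y^{(m)} = ∑ b_j y^{(j)}`. -/
def companion (b : Fin m → ℂ) : (Fin m → ℂ) →L[ℂ] (Fin m → ℂ) :=
  ContinuousLinearMap.pi fun k =>
    if h : (k : ℕ) + 1 < m then ContinuousLinearMap.proj ⟨k + 1, h⟩
    else ∑ j, b j • ContinuousLinearMap.proj j

theorem companion_apply_of_lt (b : Fin m → ℂ) (x : Fin m → ℂ) (k : Fin m) (h : (k : ℕ) + 1 < m) :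
    companion b x k = x ⟨k + 1, h⟩ := by
  simp [companion, h]

theorem companion_apply_last (b : Fin m → ℂ) (x : Fin m → ℂ) (k : Fin m) (h : ¬ (k : ℕ) + 1 < m) :
    companion b x k = ∑ j, b j * x j := by
  simp [companion, h]

theorem continuous_companion : Continuous (companion : (Fin m → ℂ) → _) := by
  rw [continuous_clm_apply]
  intro x
  refine continuous_pi fun k => ?_
  by_cases h : (k : ℕ) + 1 < m
  · simp only [companion_apply_of_lt _ _ _ h]
    exact continuous_const
  · simp only [companion_apply_last _ _ _ h]
    fun_prop

/-- The flow `exp(tA)` of a linear vector field. -/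
def flow (A : (Fin m → ℂ) →L[ℂ] (Fin m → ℂ)) (t : ℝ) : (Fin m → ℂ) →L[ℂ] (Fin m → ℂ) :=
  NormedSpace.exp ((t : ℂ) • A)

theorem flow_zero_apply (A : (Fin m → ℂ) →L[ℂ] (Fin m → ℂ)) (x : Fin m → ℂ) : flow A 0 x = x := by
  have : (((0 : ℝ) : ℂ) • A) = 0 := by ext x; simp
  rw [flow, this, NormedSpace.exp_zero]
  rfl

theorem flow_hasDerivAt (A : (Fin m → ℂ) →L[ℂ] (Fin m → ℂ)) (t : ℝ) :
    HasDerivAt (flow A) (A * flow A t) t := by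
  have h1 : HasDerivAt (fun u : ℂ => NormedSpace.exp (u • A))
      (A * NormedSpace.exp ((t : ℂ) • A)) (t : ℂ) :=
    hasDerivAt_exp_smul_const' A (t : ℂ)
  have := h1.scomp t (Complex.ofRealCLM.hasDerivAt (x := t))
  simpa using! this

theorem continuous_flow :
    Continuous fun x : ((Fin m → ℂ) →L[ℂ] (Fin m → ℂ)) × ℝ => flow x.1 x.2 := by
  let _ := NormedAlgebra.restrictScalars ℚ ℂ ((Fin m → ℂ) →L[ℂ] (Fin m → ℂ))
  exact NormedSpace.exp_continuous.comp
    ((Complex.continuous_ofReal.comp continuous_snd).smul continuous_fst)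

/-- The characteristic polynomial `X^m - ∑ b_j X^j`. -/
def charPoly (b : Fin m → ℂ) : ℂ[X] := X ^ m - ∑ j : Fin m, C (b j) * X ^ (j : ℕ)

variable [NeZero m]

theorem companion_pow_apply_zero (b : Fin m → ℂ) (x : Fin m → ℂ) (k : ℕ) (hk : k < m) :
    (companion b ^ k) x 0 = x ⟨k, hk⟩ := by
  induction k generalizing x with
  | zero => rfl
  | succ k ih =>
    rw [pow_succ, mul_apply_eq_comp, ih _ (by omega), companion_apply_of_lt]

/-- The part of Cayley–Hamilton that is needed: the powers of the companion operator, read in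
coordinate `0`, return the successive coordinates, and the last row is the recursion itself. -/
theorem aeval_charPoly_apply_zero (b : Fin m → ℂ) (x : Fin m → ℂ) :
    (aeval (companion b) (charPoly b)) x 0 = 0 := by
  have hm : 0 < m := Nat.pos_of_ne_zero (NeZero.ne m)
  have h1 : (companion b ^ m) x 0 = ∑ j, b j * x j := by
    obtain ⟨k, hk⟩ : ∃ k, m = k + 1 := ⟨m - 1, by omega⟩
    have e : companion b ^ m = companion b ^ k * companion b := by rw [← pow_succ, ← hk]
    rw [e, mul_apply_eq_comp, companion_pow_apply_zero b _ k (by omega),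
      companion_apply_last]
    simp; omega
  simp only [charPoly, map_sub, map_pow, aeval_X, map_sum, map_mul, aeval_C]
  rw [sub_apply, Pi.sub_apply, h1, sum_apply,
    Finset.sum_apply, sub_eq_zero]
  refine Finset.sum_congr rfl fun j _ => ?_
  rw [← Algebra.smul_def, smul_apply, Pi.smul_apply,
    companion_pow_apply_zero b x j j.2, smul_eq_mul]

/-- `Q(d/dt) E_j(t)`, where `E_j` is the solution of `y^{(m)} = ∑ b_k y^{(k)}` with
`y^{(k)}(0) = δ_{jk}`. -/
def fundSol (b : Fin m → ℂ) (j : Fin m) (Q : ℂ[X]) (t : ℝ) : ℂ :=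
  (aeval (companion b) Q) (flow (companion b) t (Pi.single j 1)) 0

theorem fundSol_add (b : Fin m → ℂ) (j : Fin m) (Q R : ℂ[X]) (t : ℝ) :
    fundSol b j (Q + R) t = fundSol b j Q t + fundSol b j R t := by
  simp [fundSol]

theorem fundSol_sub (b : Fin m → ℂ) (j : Fin m) (Q R : ℂ[X]) (t : ℝ) :
    fundSol b j (Q - R) t = fundSol b j Q t - fundSol b j R t := by
  simp [fundSol]

theorem fundSol_C_mul (b : Fin m → ℂ) (j : Fin m) (c : ℂ) (Q : ℂ[X]) (t : ℝ) :
    fundSol b j (C c * Q) t = c * fundSol b j Q t := by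
  rw [← smul_eq_C_mul]
  simp [fundSol]

theorem fundSol_sum {ι : Type*} (s : Finset ι) (b : Fin m → ℂ) (j : Fin m) (Q : ι → ℂ[X]) (t : ℝ) :
    fundSol b j (∑ i ∈ s, Q i) t = ∑ i ∈ s, fundSol b j (Q i) t := by
  simp [fundSol]

/-- Time differentiation becomes multiplication by `X`. Together with `fundSol_charPoly_mul` this
reduces the analysis of the equation to algebra modulo the characteristic polynomial. -/
theorem fundSol_hasDerivAt (b : Fin m → ℂ) (j : Fin m) (Q : ℂ[X]) (t : ℝ) :
    HasDerivAt (fundSol b j Q) (fundSol b j (X * Q) t) t := by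
  let ev : ((Fin m → ℂ) →L[ℂ] (Fin m → ℂ)) →L[ℂ] ℂ :=
    (ContinuousLinearMap.proj (R := ℂ) (φ := fun _ : Fin m => ℂ) (0 : Fin m)).comp
      ((aeval (companion b) Q).comp (ContinuousLinearMap.apply ℂ (Fin m → ℂ) (Pi.single j 1)))
  have h3 := (ev.restrictScalars ℝ).hasFDerivAt.comp_hasDerivAt t (flow_hasDerivAt (companion b) t)
  refine h3.congr_deriv ?_
  change (aeval (companion b) Q) ((companion b * flow (companion b) t)
    (Pi.single j 1)) 0 = _
  rw [fundSol, mul_comm X Q, map_mul, aeval_X]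
  rfl

theorem fundSol_charPoly_mul (b : Fin m → ℂ) (j : Fin m) (R : ℂ[X]) (t : ℝ) :
    fundSol b j (charPoly b * R) t = 0 := by
  rw [fundSol, map_mul, mul_apply_eq_comp]
  exact aeval_charPoly_apply_zero b _

theorem fundSol_X_pow_zero (b : Fin m → ℂ) (j : Fin m) (i : ℕ) (hi : i < m) :
    fundSol b j (X ^ i) 0 = if i = (j : ℕ) then 1 else 0 := by
  rw [fundSol]
  simp only [map_pow, aeval_X]
  rw [flow_zero_apply, companion_pow_apply_zero b _ i hi, Pi.single_apply]
  simp [Fin.ext_iff]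

theorem norm_fundSol_zero_le (b : Fin m → ℂ) (j : Fin m) (Q : ℂ[X]) :
    ‖fundSol b j Q 0‖ ≤ ‖aeval (companion b) Q‖ := by
  rw [fundSol, flow_zero_apply]
  refine (norm_le_pi_norm _ 0).trans ((ContinuousLinearMap.le_opNorm _ _).trans ?_)
  simp [Pi.norm_single]

theorem continuous_fundSol (j : Fin m) (Q : ℂ[X]) :
    Continuous fun x : (Fin m → ℂ) × ℝ => fundSol x.1 j Q x.2 := by
  unfold fundSol
  have h1 : Continuous fun x : (Fin m → ℂ) × ℝ => aeval (companion x.1) Q :=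
    (Polynomial.continuous_aeval Q).comp (continuous_companion.comp continuous_fst)
  have h2 : Continuous fun x : (Fin m → ℂ) × ℝ => flow (companion x.1) x.2 :=
    continuous_flow.comp ((continuous_companion.comp continuous_fst).prodMk continuous_snd)
  exact (continuous_apply 0).comp (h1.clm_apply (h2.clm_apply continuous_const))

/-- Exponential decay is inherited through a first order equation. -/
theorem norm_le_of_first_order {v g : ℝ → ℂ} {τ : ℂ} {B γ : ℝ} (hγ : γ < τ.im)
    (hv : ∀ t, HasDerivAt v (Complex.I * τ * v t + g t) t)
    (hg : ∀ t, 0 ≤ t → ‖g t‖ ≤ B * Real.exp (-γ * t)) {t : ℝ} (ht : 0 ≤ t) :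
    ‖v t‖ ≤ (‖v 0‖ + B / (τ.im - γ)) * Real.exp (-γ * t) := by
  have hd : 0 < τ.im - γ := sub_pos.2 hγ
  have hB : 0 ≤ B := by
    have := (norm_nonneg _).trans (hg 0 le_rfl)
    simpa using this
  have hne : ∀ s : ℝ, ‖Complex.exp (-(Complex.I * τ * s))‖ = Real.exp (τ.im * s) := by
    intro s
    rw [Complex.norm_exp]
    congr 1
    simp
  have hh : ∀ s : ℝ, HasDerivAt (fun s : ℝ => Complex.exp (-(Complex.I * τ * s)) * v s)
      (Complex.exp (-(Complex.I * τ * s)) * g s) s := by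
    intro s
    have h1 : HasDerivAt (fun s : ℝ => Complex.exp (-(Complex.I * τ * s)))
        (Complex.exp (-(Complex.I * τ * s)) * (-(Complex.I * τ * 1))) s :=
      (((Complex.ofRealCLM.hasDerivAt (x := s)).const_mul (Complex.I * τ)).neg).cexp
    refine (h1.mul (hv s)).congr_deriv ?_
    ring
  -- The factor `e^{-iτs}` removes the homogeneous part; the comparison function is the primitive of
  -- the bound `B e^{(Im τ - γ)s}` for what remains, shifted so as to dominate at `s = 0`.
  have hb := image_norm_le_of_norm_deriv_right_le_deriv_boundary
    (f := fun s : ℝ => Complex.exp (-(Complex.I * τ * s)) * v s)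
    (f' := fun s : ℝ => Complex.exp (-(Complex.I * τ * s)) * g s) (a := 0) (b := t)
    (B := fun s => ‖v 0‖ + B / (τ.im - γ) * Real.exp ((τ.im - γ) * s))
    (B' := fun s => B * Real.exp ((τ.im - γ) * s))
    (fun s _ => (hh s).continuousAt.continuousWithinAt)
    (fun s _ => (hh s).hasDerivWithinAt)
    (by simp; positivity)
    (fun s => by
      have h1 := (((hasDerivAt_id s).const_mul (τ.im - γ)).exp.const_mul (B / (τ.im - γ))).const_add
        ‖v 0‖
      refine h1.congr_deriv ?_
      simp only [id]
      field_simp)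
    (fun s hs => by
      rw [norm_mul, hne]
      calc Real.exp (τ.im * s) * ‖g s‖ ≤ Real.exp (τ.im * s) * (B * Real.exp (-γ * s)) := by
            gcongr; exact hg s hs.1
        _ = B * Real.exp ((τ.im - γ) * s) := by
            rw [show (τ.im - γ) * s = τ.im * s + -γ * s by ring, Real.exp_add]; ring)
    (x := t) ⟨ht, le_rfl⟩
  rw [norm_mul, hne] at hb
  have h2 : ‖v t‖ = Real.exp (-(τ.im * t)) * (Real.exp (τ.im * t) * ‖v t‖) := by
    rw [← mul_assoc, ← Real.exp_add]; simp
  rw [h2]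
  calc _ ≤ Real.exp (-(τ.im * t)) * (‖v 0‖ + B / (τ.im - γ) * Real.exp ((τ.im - γ) * t)) := by gcongr
    _ = ‖v 0‖ * Real.exp (-(τ.im * t)) + B / (τ.im - γ) * Real.exp (-γ * t) := by
        rw [show -γ * t = -(τ.im * t) + (τ.im - γ) * t by ring, Real.exp_add]; ring
    _ ≤ ‖v 0‖ * Real.exp (-γ * t) + B / (τ.im - γ) * Real.exp (-γ * t) := by
        gcongr
        nlinarith
    _ = _ := by ring

/-- `∏ (X - iτ)` over a list of characteristic roots. -/
def rootProd (l : List ℂ) : ℂ[X] := (l.map fun τ => X - C (Complex.I * τ)).prod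

/-- If `v = R(d/dt)E_j`, then `v' = iτ v + g` where `g` belongs to `(X - iτ) R`, so one factor is
peeled off at a time, each costing `1 + ρ / (δ - γ)`. Giving up `δ - γ` in the rate makes the
constant indifferent to coinciding roots. -/
theorem norm_fundSol_le_of_roots (b : Fin m → ℂ) (j : Fin m) {ρ δ γ : ℝ} (hρ : 0 ≤ ρ) (hγ : γ < δ)
    (l : List ℂ) (hl : ∀ τ ∈ l, δ ≤ τ.im ∧ ‖companion b‖ + ‖τ‖ ≤ ρ) (R : ℂ[X])
    (hR : ∀ t, fundSol b j (rootProd l * R) t = 0) {t : ℝ} (ht : 0 ≤ t) :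
    ‖fundSol b j R t‖ ≤
      ‖aeval (companion b) R‖ * (1 + ρ / (δ - γ)) ^ l.length * Real.exp (-γ * t) := by
  have hd : 0 < δ - γ := sub_pos.2 hγ
  induction l generalizing R t with
  | nil =>
    have := hR t
    simp only [rootProd, List.map_nil, List.prod_nil, one_mul] at this
    rw [this, norm_zero]
    positivity
  | cons τ l ih =>
    obtain ⟨hτ, hτρ⟩ := hl τ (by simp)
    set R' : ℂ[X] := (X - C (Complex.I * τ)) * R with hR'
    have h1 : ∀ t, fundSol b j (rootProd l * R') t = 0 := by
      intro t
      rw [← hR t]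
      congr 1
      simp only [rootProd, List.map_cons, List.prod_cons, hR']
      ring
    have hR'n : ‖aeval (companion b) R'‖ ≤ ρ * ‖aeval (companion b) R‖ := by
      rw [hR', map_mul, map_sub, aeval_X, aeval_C]
      refine (norm_mul_le _ _).trans ?_
      gcongr
      refine (norm_sub_le _ _).trans ?_
      refine le_trans ?_ hτρ
      gcongr
      rw [Algebra.algebraMap_eq_smul_one, norm_smul, norm_mul, Complex.norm_I, one_mul]
      exact mul_le_of_le_one_right (norm_nonneg _) ContinuousLinearMap.norm_id_le
    set q : ℝ := 1 + ρ / (δ - γ) with hq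
    have hq1 : 1 ≤ q := by rw [hq]; linarith [div_nonneg hρ hd.le]
    have h2 : ∀ t, 0 ≤ t → ‖fundSol b j R' t‖ ≤
        (ρ * ‖aeval (companion b) R‖ * q ^ l.length) * Real.exp (-γ * t) := by
      intro t ht
      refine (ih (fun σ hσ => hl σ (by simp [hσ])) R' h1 ht).trans ?_
      gcongr
    have h3 := norm_le_of_first_order (v := fundSol b j R) (g := fundSol b j R') (τ := τ)
      (hγ.trans_le hτ) (fun t => by
        refine (fundSol_hasDerivAt b j R t).congr_deriv ?_
        rw [hR', sub_mul, fundSol_sub, fundSol_C_mul]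
        ring) h2 ht
    refine h3.trans ?_
    gcongr
    have h4 : ‖fundSol b j R 0‖ ≤ ‖aeval (companion b) R‖ := norm_fundSol_zero_le b j R
    have h5 : ρ * ‖aeval (companion b) R‖ * q ^ l.length / (τ.im - γ) ≤
        ρ * ‖aeval (companion b) R‖ * q ^ l.length / (δ - γ) := by gcongr
    have h6 : 1 ≤ q ^ l.length := one_le_pow₀ hq1
    calc _ ≤ ‖aeval (companion b) R‖ + ρ * ‖aeval (companion b) R‖ * q ^ l.length / (δ - γ) := by
          linarith
      _ = ‖aeval (companion b) R‖ * (1 + ρ / (δ - γ) * q ^ l.length) := by ring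
      _ ≤ ‖aeval (companion b) R‖ * (q ^ l.length + ρ / (δ - γ) * q ^ l.length) := by gcongr
      _ = _ := by rw [List.length_cons, pow_succ, hq]; ring

/-- A factor `X - iτ` of the characteristic polynomial contributes an exact exponential. -/
theorem fundSol_of_simple_root (b : Fin m → ℂ) (j : Fin m) {τ : ℂ} {Q : ℂ[X]}
    (hQ : charPoly b = (X - C (Complex.I * τ)) * Q) (R : ℂ[X]) (t : ℝ) :
    fundSol b j (Q * R) t = R.eval (Complex.I * τ) * Complex.exp (Complex.I * τ * t) *
      fundSol b j Q 0 := by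
  have hX : ∀ t, fundSol b j (X * Q) t = Complex.I * τ * fundSol b j Q t := by
    intro t
    have := fundSol_charPoly_mul b j 1 t
    rw [mul_one, hQ, sub_mul, fundSol_sub, fundSol_C_mul, sub_eq_zero] at this
    exact this
  have h0 : ∀ t : ℝ, fundSol b j Q t = Complex.exp (Complex.I * τ * t) * fundSol b j Q 0 := by
    intro t
    have hc : ∀ s : ℝ, HasDerivAt
        (fun s : ℝ => Complex.exp (-(Complex.I * τ * s)) * fundSol b j Q s) 0 s := by
      intro s
      have h1 : HasDerivAt (fun s : ℝ => Complex.exp (-(Complex.I * τ * s)))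
          (Complex.exp (-(Complex.I * τ * s)) * (-(Complex.I * τ * 1))) s :=
        (((Complex.ofRealCLM.hasDerivAt (x := s)).const_mul (Complex.I * τ)).neg).cexp
      refine (h1.mul (fundSol_hasDerivAt b j Q s)).congr_deriv ?_
      rw [hX]; ring
    have h2 := is_const_of_deriv_eq_zero (fun s => (hc s).differentiableAt)
      (fun s => (hc s).deriv) t 0
    simp only [Complex.ofReal_zero, mul_zero, neg_zero, Complex.exp_zero, one_mul] at h2
    rw [← h2, ← mul_assoc, ← Complex.exp_add]
    simp
  have h3 : fundSol b j (Q * R) t = R.eval (Complex.I * τ) * fundSol b j Q t := by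
    obtain ⟨S, hS⟩ := X_sub_C_dvd_sub_C_eval (p := R) (a := Complex.I * τ)
    -- Modulo `X - iτ` the polynomial `R` is its value at `iτ`; multiplied by `Q` this becomes a
    -- congruence modulo the characteristic polynomial.
    have : Q * R = C (R.eval (Complex.I * τ)) * Q + charPoly b * S := by
      rw [hQ]
      linear_combination Q * hS
    rw [this, fundSol_add, fundSol_charPoly_mul, fundSol_C_mul, add_zero]
  rw [h3, h0]
  ring

end Ode

/-! ### Uniform bounds of the fundamental solutions in the three frequency regimes. -/

section OdeBounds

open Polynomial

variable {m : ℕ} [NeZero m]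

theorem norm_aeval_rootProd_le (A : (Fin m → ℂ) →L[ℂ] (Fin m → ℂ)) {ρ : ℝ} (hρ : 0 ≤ ρ) (l : List ℂ)
    (hl : ∀ τ ∈ l, ‖A‖ + ‖τ‖ ≤ ρ) : ‖aeval A (rootProd l)‖ ≤ ρ ^ l.length := by
  induction l with
  | nil => simp [rootProd]
  | cons τ l ih =>
    have h1 := ih fun σ hσ => hl σ (by simp [hσ])
    have e : rootProd (τ :: l) = (X - C (Complex.I * τ)) * rootProd l := by simp [rootProd]
    rw [e, map_mul, map_sub, aeval_X, aeval_C, List.length_cons, pow_succ']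
    refine (norm_mul_le _ _).trans ?_
    gcongr
    refine (norm_sub_le _ _).trans (le_trans ?_ (hl τ (by simp)))
    gcongr
    rw [Algebra.algebraMap_eq_smul_one, norm_smul, norm_mul, Complex.norm_I, one_mul]
    exact mul_le_of_le_one_right (norm_nonneg _) ContinuousLinearMap.norm_id_le

theorem rootProd_toList_map {ι : Type*} (s : Finset ι) (τ : ι → ℂ) :
    rootProd (s.toList.map τ) = ∏ k ∈ s, (X - C (Complex.I * τ k)) := by
  rw [rootProd, List.map_map, ← Finset.prod_map_toList]
  rfl

theorem exists_norm_fundSol_le_of_im_ge (m r : ℕ) [NeZero m] {ρ δ : ℝ} (hρ : 0 ≤ ρ) (hδ : 0 < δ) :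
    ∃ K : ℝ, 0 < K ∧ ∀ (b : Fin m → ℂ) (τ : Fin m → ℂ),
      charPoly b = ∏ k, (X - C (Complex.I * τ k)) →
      (∀ k, δ ≤ (τ k).im) → (∀ k, ‖companion b‖ + ‖τ k‖ ≤ ρ) → ∀ (j : Fin m) (t : ℝ), 0 ≤ t →
      ‖fundSol b j (X ^ r) t‖ ≤ K * Real.exp (-(δ / 2) * t) := by
  -- The rate `δ / 2` is an arbitrary choice below `δ`; the summand `1` only makes the constant
  -- strictly positive.
  refine ⟨ρ ^ r * (1 + ρ / (δ - δ / 2)) ^ m + 1, by have := half_lt_self hδ; have : 0 < δ - δ / 2 := by linarith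
                                                    positivity, ?_⟩
  intro b τ hb hτ hn j t ht
  have hm : 0 < m := Nat.pos_of_ne_zero (NeZero.ne m)
  have hd : 0 < δ - δ / 2 := by linarith
  have hA : ‖companion b‖ ≤ ρ := le_trans (by linarith [norm_nonneg (τ 0)]) (hn 0)
  have h := norm_fundSol_le_of_roots b j hρ (half_lt_self hδ) (Finset.univ.toList.map τ) (by
    intro σ hσ
    simp only [List.mem_map, Finset.mem_toList, Finset.mem_univ, true_and] at hσ
    obtain ⟨k, rfl⟩ := hσ
    exact ⟨hτ k, hn k⟩) (X ^ r) (by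
    intro t
    rw [rootProd_toList_map, ← hb, fundSol_charPoly_mul]) ht
  refine h.trans ?_
  rw [List.length_map, Finset.length_toList, Finset.card_univ, Fintype.card_fin]
  gcongr
  have h1 : ‖aeval (companion b) ((X : ℂ[X]) ^ r)‖ ≤ ρ ^ r := by
    rw [map_pow, aeval_X]
    rcases Nat.eq_zero_or_pos r with h0 | h0
    · subst h0; simp
    · exact (norm_pow_le' _ h0).trans (by gcongr)
  calc _ ≤ ρ ^ r * (1 + ρ / (δ - δ / 2)) ^ m := by gcongr
    _ ≤ _ := by linarith

/-- With `Q = ∏_{l ≠ k} (X - iτ_l)` and `q = Q(iτ_k)`, split `q = Q + (q - Q)`. The part with `Q`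
solves the first order equation of `τ_k` and is an exact exponential, on which `X^r` acts as
`(iτ_k)^r`. The part with `q - Q` is divisible by `X - iτ_k`, hence annihilated by the other
factors, and decays exponentially. Finally `|q| ≥ κ^{m-1}` allows division by `q`; the other roots
may collide among themselves. -/
theorem exists_norm_fundSol_le_of_isolated (m r : ℕ) [NeZero m] {ρ δ κ : ℝ} (hρ : 0 ≤ ρ)
    (hδ : 0 < δ) (hκ : 0 < κ) :
    ∃ K : ℝ, 0 < K ∧ ∀ (b : Fin m → ℂ) (τ : Fin m → ℂ) (k : Fin m),
      charPoly b = ∏ k, (X - C (Complex.I * τ k)) →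
      (∀ l, l ≠ k → δ ≤ (τ l).im) → (∀ l, l ≠ k → κ ≤ ‖τ k - τ l‖) →
      (∀ l, ‖companion b‖ + ‖τ l‖ ≤ ρ) → ∀ (j : Fin m) (t : ℝ), 0 ≤ t →
      ‖fundSol b j (X ^ r) t‖ ≤
        K * (‖τ k‖ ^ r * Real.exp (-(τ k).im * t) + Real.exp (-(δ / 2) * t)) := by
  have hd : 0 < δ - δ / 2 := by linarith
  set K₁ : ℝ := ρ ^ (m - 1) with hK₁
  set K₂ : ℝ := ((2 * ρ) ^ (m - 1) + ρ ^ (m - 1)) * ρ ^ r * (1 + ρ / (δ - δ / 2)) ^ (m - 1) with hK₂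
  have hK₁0 : 0 ≤ K₁ := by positivity
  have hK₂0 : 0 ≤ K₂ := by positivity
  refine ⟨(κ ^ (m - 1))⁻¹ * (K₁ + K₂) + 1, by positivity, ?_⟩
  intro b τ k hb hτ hsep hn j t ht
  have hA : ‖companion b‖ ≤ ρ := le_trans (by linarith [norm_nonneg (τ 0)]) (hn 0)
  have hτρ : ∀ l, ‖τ l‖ ≤ ρ := fun l => le_trans (by linarith [norm_nonneg (companion b)]) (hn l)
  set Q : ℂ[X] := ∏ l ∈ Finset.univ.erase k, (X - C (Complex.I * τ l)) with hQ
  set L : List ℂ := (Finset.univ.erase k).toList.map τ with hL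
  have hLlen : L.length = m - 1 := by
    rw [hL, List.length_map, Finset.length_toList, Finset.card_erase_of_mem (Finset.mem_univ _),
      Finset.card_univ, Fintype.card_fin]
  have hQL : rootProd L = Q := rootProd_toList_map _ _
  have hLmem : ∀ σ ∈ L, δ ≤ σ.im ∧ ‖companion b‖ + ‖σ‖ ≤ ρ := by
    intro σ hσ
    simp only [hL, List.mem_map, Finset.mem_toList, Finset.mem_erase, Finset.mem_univ,
      and_true] at hσ
    obtain ⟨l, hl, rfl⟩ := hσ
    exact ⟨hτ l hl, hn l⟩
  have hbQ : charPoly b = (X - C (Complex.I * τ k)) * Q := by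
    rw [hb, hQ]
    exact (Finset.mul_prod_erase Finset.univ (fun l => X - C (Complex.I * τ l))
      (Finset.mem_univ k)).symm
  set q : ℂ := Q.eval (Complex.I * τ k) with hq
  have hqe : ‖q‖ = ∏ l ∈ Finset.univ.erase k, ‖τ k - τ l‖ := by
    rw [hq, hQ, eval_prod, norm_prod]
    refine Finset.prod_congr rfl fun l _ => ?_
    rw [eval_sub, eval_X, eval_C, ← mul_sub, norm_mul, Complex.norm_I, one_mul]
  have hcard : (Finset.univ.erase k).card = m - 1 := by
    rw [Finset.card_erase_of_mem (Finset.mem_univ _), Finset.card_univ, Fintype.card_fin]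
  have hqlow : κ ^ (m - 1) ≤ ‖q‖ := by
    rw [hqe, ← hcard, ← Finset.prod_const]
    exact Finset.prod_le_prod (fun l _ => hκ.le) fun l hl => hsep l (Finset.ne_of_mem_erase hl)
  have hqup : ‖q‖ ≤ (2 * ρ) ^ (m - 1) := by
    rw [hqe, ← hcard, ← Finset.prod_const]
    refine Finset.prod_le_prod (fun l _ => norm_nonneg _) fun l _ => ?_
    exact (norm_sub_le _ _).trans (by linarith [hτρ k, hτρ l])
  have hq0 : 0 < ‖q‖ := lt_of_lt_of_le (by positivity) hqlow
  have hQn : ‖aeval (companion b) Q‖ ≤ K₁ := by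
    rw [← hQL, hK₁, ← hLlen]
    exact norm_aeval_rootProd_le _ hρ L fun σ hσ => (hLmem σ hσ).2
  have hXr : ‖aeval (companion b) ((X : ℂ[X]) ^ r)‖ ≤ ρ ^ r := by
    rw [map_pow, aeval_X]
    rcases Nat.eq_zero_or_pos r with h0 | h0
    · subst h0; simp
    · exact (norm_pow_le' _ h0).trans (by gcongr)
  -- the part annihilated by the other factors
  have h1 := norm_fundSol_le_of_roots b j hρ (half_lt_self hδ) L hLmem ((C q - Q) * X ^ r) (by
    intro t
    obtain ⟨S, hS⟩ := X_sub_C_dvd_sub_C_eval (p := Q) (a := Complex.I * τ k)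
    have : rootProd L * ((C q - Q) * X ^ r) = charPoly b * (-S * X ^ r) := by
      rw [hQL, hbQ]
      linear_combination (-Q * X ^ r) * hS
    rw [this, fundSol_charPoly_mul]) ht
  have h1n : ‖aeval (companion b) ((C q - Q) * X ^ r)‖ ≤
      ((2 * ρ) ^ (m - 1) + ρ ^ (m - 1)) * ρ ^ r := by
    rw [map_mul, map_sub, aeval_C]
    refine (norm_mul_le _ _).trans ?_
    gcongr
    refine (norm_sub_le _ _).trans ?_
    gcongr
    rw [Algebra.algebraMap_eq_smul_one, norm_smul]
    exact (mul_le_of_le_one_right (norm_nonneg _) ContinuousLinearMap.norm_id_le).trans hqup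
  have h2 := fundSol_of_simple_root b j hbQ (X ^ r) t
  have h3 : q * fundSol b j (X ^ r) t =
      fundSol b j (Q * X ^ r) t + fundSol b j ((C q - Q) * X ^ r) t := by
    rw [← fundSol_add, ← fundSol_C_mul]
    congr 1
    ring
  have h2n : ‖fundSol b j (Q * X ^ r) t‖ ≤ K₁ * (‖τ k‖ ^ r * Real.exp (-(τ k).im * t)) := by
    rw [h2, norm_mul, norm_mul, eval_pow, eval_X, norm_pow, norm_mul, Complex.norm_I, one_mul,
      Complex.norm_exp]
    have e : (Complex.I * τ k * t).re = -(τ k).im * t := by simp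
    rw [e, mul_comm]
    gcongr
    exact (norm_fundSol_zero_le b j Q).trans hQn
  have h4 : ‖q‖ * ‖fundSol b j (X ^ r) t‖ ≤
      K₁ * (‖τ k‖ ^ r * Real.exp (-(τ k).im * t)) + K₂ * Real.exp (-(δ / 2) * t) := by
    rw [← norm_mul, h3]
    refine (norm_add_le _ _).trans (add_le_add h2n (h1.trans ?_))
    rw [hLlen, hK₂]
    gcongr
  have hX0 : 0 ≤ ‖τ k‖ ^ r * Real.exp (-(τ k).im * t) := by positivity
  have hE0 : 0 ≤ Real.exp (-(δ / 2) * t) := (Real.exp_pos _).le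
  have h5 : κ ^ (m - 1) * ‖fundSol b j (X ^ r) t‖ ≤
      (K₁ + K₂) * (‖τ k‖ ^ r * Real.exp (-(τ k).im * t) + Real.exp (-(δ / 2) * t)) := by
    refine (mul_le_mul_of_nonneg_right hqlow (norm_nonneg _)).trans (h4.trans ?_)
    nlinarith [mul_nonneg hK₁0 hE0, mul_nonneg hK₂0 hX0]
  have hκm : 0 < κ ^ (m - 1) := by positivity
  rw [← le_div_iff₀' hκm] at h5
  refine h5.trans ?_
  rw [div_eq_inv_mul, ← mul_assoc]
  gcongr
  linarith

/-- For a polynomial of degree below `m`, the normalisation of `E_j` at `t = 0` picks out the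
coefficient of `X^j`, an elementary symmetric function of the roots. The exponent `m - 1 - j` is the
source of the gain `⟨ξ⟩^{-j}` on the datum `f_j`. -/
theorem norm_fundSol_zero_le_of_roots (b : Fin m → ℂ) (j : Fin m) (τ : Fin m → ℂ) (k : Fin m)
    {B : ℝ} (hB : ∀ l, ‖τ l‖ ≤ B) :
    ‖fundSol b j (∏ l ∈ Finset.univ.erase k, (X - C (Complex.I * τ l))) 0‖ ≤
      B ^ (m - 1 - (j : ℕ)) * (m - 1).choose j := by
  have hm : 0 < m := Nat.pos_of_ne_zero (NeZero.ne m)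
  set Q : ℂ[X] := ∏ l ∈ Finset.univ.erase k, (X - C (Complex.I * τ l)) with hQ
  have hcard : (Finset.univ.erase k).card = m - 1 := by
    rw [Finset.card_erase_of_mem (Finset.mem_univ _), Finset.card_univ, Fintype.card_fin]
  have hmon : Q.Monic := monic_prod_of_monic _ _ fun l _ => monic_X_sub_C _
  have hdeg : Q.natDegree = m - 1 := by
    rw [hQ, natDegree_prod_of_monic _ _ fun l _ => monic_X_sub_C _]
    simp only [natDegree_X_sub_C, Finset.sum_const, hcard, smul_eq_mul, mul_one]
  have hval : fundSol b j Q 0 = Q.coeff j := by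
    conv_lhs => rw [Q.as_sum_range' m (by omega)]
    rw [fundSol_sum]
    simp_rw [← C_mul_X_pow_eq_monomial, fundSol_C_mul]
    rw [Finset.sum_eq_single (j : ℕ)]
    · rw [fundSol_X_pow_zero b j j j.2, if_pos rfl, mul_one]
    · intro i hi hij
      rw [fundSol_X_pow_zero b j i (Finset.mem_range.1 hi), if_neg hij, mul_zero]
    · intro h; exact absurd (Finset.mem_range.2 j.2) h
  rw [hval]
  have h := coeff_le_of_roots_le (f := RingHom.id ℂ) (B := B) (j : ℕ) hmon
    (IsAlgClosed.splits _) (by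
      intro z hz
      rw [Polynomial.map_id] at hz
      have hz' := isRoot_of_mem_roots hz
      rw [IsRoot, hQ, eval_prod, Finset.prod_eq_zero_iff] at hz'
      obtain ⟨l, -, hl⟩ := hz'
      rw [eval_sub, eval_X, eval_C, sub_eq_zero] at hl
      rw [hl]
      rw [norm_mul, Complex.norm_I, one_mul]
      exact hB l)
  rwa [Polynomial.map_id, hdeg] at h

theorem exists_norm_fundSol_le_of_separated (m r : ℕ) [NeZero m] {c₁ C₁ : ℝ} (hc₁ : 0 < c₁)
    (hC₁ : 0 ≤ C₁) :
    ∃ K : ℝ, 0 < K ∧ ∀ (b : Fin m → ℂ) (τ : Fin m → ℂ) (Λ δ : ℝ), 0 < Λ →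
      charPoly b = ∏ k, (X - C (Complex.I * τ k)) →
      (∀ k, δ ≤ (τ k).im) → (∀ k l, k ≠ l → c₁ * Λ ≤ ‖τ k - τ l‖) →
      (∀ k, ‖τ k‖ ≤ C₁ * Λ) → ∀ (j : Fin m) (t : ℝ), 0 ≤ t →
      ‖fundSol b j (X ^ r) t‖ ≤ K * (Λ ^ r / Λ ^ (j : ℕ)) * Real.exp (-δ * t) := by
  set D : ℝ := ∑ i ∈ Finset.range m, C₁ ^ (m - 1 - i) * (m - 1).choose i with hD
  have hD0 : 0 ≤ D := by positivity
  refine ⟨m * ((c₁ ^ (m - 1))⁻¹ * C₁ ^ r * D) + 1, by positivity, ?_⟩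
  intro b τ Λ δ hΛ hb hδ hsep hn j t ht
  have hm : 0 < m := Nat.pos_of_ne_zero (NeZero.ne m)
  have hinj : Set.InjOn (fun k => Complex.I * τ k) (↑(Finset.univ : Finset (Fin m))) := by
    intro k _ l _ h
    by_contra hkl
    have := hsep k l hkl
    rw [mul_left_cancel₀ Complex.I_ne_zero h, sub_self, norm_zero] at this
    have : 0 < c₁ * Λ := by positivity
    linarith
  -- The Lagrange basis at the nodes `iτ_k` is a partition of unity whose `k`-th member is a
  -- multiple of `∏_{l ≠ k} (X - iτ_l)`, so each term is an exact exponential. The denominators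
  -- contribute `Λ^{-(m-1)}`, the value at `0` contributes `Λ^{m-1-j}` and `X^r` contributes `Λ^r`.
  have hL := Lagrange.sum_basis hinj ⟨0, Finset.mem_univ _⟩
  have hbas : ∀ k, Lagrange.basis Finset.univ (fun k => Complex.I * τ k) k =
      C (∏ l ∈ Finset.univ.erase k, (Complex.I * τ k - Complex.I * τ l)⁻¹) *
        ∏ l ∈ Finset.univ.erase k, (X - C (Complex.I * τ l)) := by
    intro k
    rw [Lagrange.basis, map_prod, ← Finset.prod_mul_distrib]
    rfl
  have hterm : ∀ k, ‖fundSol b j (Lagrange.basis Finset.univ (fun k => Complex.I * τ k) k * X ^ r) t‖ ≤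
      ((c₁ ^ (m - 1))⁻¹ * C₁ ^ r * D) * (Λ ^ r / Λ ^ (j : ℕ)) * Real.exp (-δ * t) := by
    intro k
    have hcard : (Finset.univ.erase k).card = m - 1 := by
      rw [Finset.card_erase_of_mem (Finset.mem_univ _), Finset.card_univ, Fintype.card_fin]
    have hbQ : charPoly b = (X - C (Complex.I * τ k)) *
        ∏ l ∈ Finset.univ.erase k, (X - C (Complex.I * τ l)) := by
      rw [hb]
      exact (Finset.mul_prod_erase Finset.univ (fun l => X - C (Complex.I * τ l))
        (Finset.mem_univ k)).symm
    rw [hbas, mul_assoc, fundSol_C_mul, fundSol_of_simple_root b j hbQ]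
    rw [norm_mul, norm_mul, norm_mul, eval_pow, eval_X, norm_pow, norm_mul, Complex.norm_I, one_mul,
      Complex.norm_exp]
    have e : (Complex.I * τ k * t).re = -(τ k).im * t := by simp
    rw [e]
    have h1 : ‖∏ l ∈ Finset.univ.erase k, (Complex.I * τ k - Complex.I * τ l)⁻¹‖ ≤
        ((c₁ * Λ) ^ (m - 1))⁻¹ := by
      rw [norm_prod, ← hcard, ← inv_pow, ← Finset.prod_const]
      refine Finset.prod_le_prod (fun l _ => norm_nonneg _) fun l hl => ?_
      rw [norm_inv, ← mul_sub, norm_mul, Complex.norm_I, one_mul]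
      exact inv_anti₀ (by positivity) (hsep k l (Finset.ne_of_mem_erase hl).symm)
    have h2 := norm_fundSol_zero_le_of_roots b j τ k hn
    have h3 : Real.exp (-(τ k).im * t) ≤ Real.exp (-δ * t) := by
      apply Real.exp_le_exp.2
      have := hδ k
      nlinarith
    have h4 : (C₁ * Λ) ^ (m - 1 - (j : ℕ)) * (m - 1).choose j ≤ D * Λ ^ (m - 1 - (j : ℕ)) := by
      have : C₁ ^ (m - 1 - (j : ℕ)) * (m - 1).choose j ≤ D :=
        Finset.single_le_sum (f := fun i => C₁ ^ (m - 1 - i) * ((m - 1).choose i : ℝ))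
          (fun i _ => by positivity) (Finset.mem_range.2 j.2)
      calc _ = (C₁ ^ (m - 1 - (j : ℕ)) * (m - 1).choose j) * Λ ^ (m - 1 - (j : ℕ)) := by
            rw [mul_pow]; ring
        _ ≤ _ := by gcongr
    calc _ ≤ ((c₁ * Λ) ^ (m - 1))⁻¹ * ((C₁ * Λ) ^ r * Real.exp (-δ * t) *
          (D * Λ ^ (m - 1 - (j : ℕ)))) := by
          gcongr
          · exact hn k
          · exact h2.trans h4
      _ = _ := by
          have e2 : Λ ^ (m - 1) = Λ ^ (m - 1 - (j : ℕ)) * Λ ^ (j : ℕ) := by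
            rw [← pow_add]; congr 1; have := j.2; omega
          rw [mul_pow, mul_pow, e2]
          have : Λ ^ (m - 1 - (j : ℕ)) ≠ 0 := by positivity
          have : Λ ^ (j : ℕ) ≠ 0 := by positivity
          have : c₁ ^ (m - 1) ≠ 0 := by positivity
          field_simp
  have hsum : fundSol b j (X ^ r) t = ∑ k, fundSol b j
      (Lagrange.basis Finset.univ (fun k => Complex.I * τ k) k * X ^ r) t := by
    rw [← fundSol_sum, ← Finset.sum_mul, hL, one_mul]
  rw [hsum]
  refine (norm_sum_le _ _).trans ((Finset.sum_le_sum fun k _ => hterm k).trans ?_)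
  rw [Finset.sum_const, Finset.card_univ, Fintype.card_fin, nsmul_eq_mul, ← mul_assoc, ← mul_assoc]
  gcongr
  linarith

end OdeBounds

/-! ### Characteristic roots -/

section Roots

variable {n m : ℕ}

/-- `⟨ξ⟩ = (1 + |ξ|²)^{1/2}`. -/
def jb (ξ : Space n) : ℝ := Real.sqrt (1 + ‖ξ‖ ^ 2)

theorem one_le_jb (ξ : Space n) : 1 ≤ jb ξ := by
  rw [jb, Real.one_le_sqrt]; nlinarith [sq_nonneg ‖ξ‖]

theorem jb_pos (ξ : Space n) : 0 < jb ξ := one_pos.trans_le (one_le_jb ξ)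

theorem norm_le_jb (ξ : Space n) : ‖ξ‖ ≤ jb ξ := by
  rw [jb]; apply Real.le_sqrt_of_sq_le; linarith

theorem jb_le_one_add (ξ : Space n) : jb ξ ≤ 1 + ‖ξ‖ := by
  rw [jb, Real.sqrt_le_left (by positivity)]; nlinarith [norm_nonneg ξ]

theorem continuous_jb : Continuous (jb : Space n → ℝ) := by
  unfold jb; fun_prop

theorem norm_coord_le_jb (ξ : Space n) (i : Fin n) : ‖(ξ i : ℂ)‖ ≤ jb ξ := by
  rw [Complex.norm_real]
  exact (PiLp.norm_apply_le ξ i).trans (norm_le_jb ξ)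

/-- The monomial `ξ^α`. -/
def xiPow (α : Fin n →₀ ℕ) (ξ : Space n) : ℂ := ∏ i, (ξ i : ℂ) ^ α i

theorem continuous_xiPow (α : Fin n →₀ ℕ) : Continuous (xiPow α) := by
  unfold xiPow; fun_prop

theorem norm_xiPow_le (α : Fin n →₀ ℕ) (ξ : Space n) : ‖xiPow α ξ‖ ≤ jb ξ ^ α.degree := by
  rw [xiPow, norm_prod, Finsupp.degree_eq_sum, ← Finset.prod_pow_eq_pow_sum]
  refine Finset.prod_le_prod (fun i _ => norm_nonneg _) fun i _ => ?_
  rw [norm_pow]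
  exact pow_le_pow_left₀ (norm_nonneg _) (norm_coord_le_jb ξ i) _

theorem norm_xiPow_le_norm_pow (α : Fin n →₀ ℕ) (ξ : Space n) : ‖xiPow α ξ‖ ≤ ‖ξ‖ ^ α.degree := by
  rw [xiPow, norm_prod, Finsupp.degree_eq_sum, ← Finset.prod_pow_eq_pow_sum]
  refine Finset.prod_le_prod (fun i _ => norm_nonneg _) fun i _ => ?_
  rw [norm_pow, Complex.norm_real]
  exact pow_le_pow_left₀ (norm_nonneg _) (PiLp.norm_apply_le ξ i) _

/-- Evaluation of a polynomial at a real point. -/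
def evalAt (P : MvPolynomial (Fin n) ℂ) (ξ : Space n) : ℂ :=
  MvPolynomial.eval (fun i => (ξ i : ℂ)) P

theorem continuous_evalAt (P : MvPolynomial (Fin n) ℂ) : Continuous (evalAt P) := by
  unfold evalAt
  exact (MvPolynomial.continuous_eval P).comp (by fun_prop)

theorem exists_norm_evalAt_le (P : MvPolynomial (Fin n) ℂ) {d : ℕ} (hd : P.totalDegree ≤ d) :
    ∃ C : ℝ, 0 ≤ C ∧ ∀ ξ : Space n, ‖evalAt P ξ‖ ≤ C * jb ξ ^ d := by
  refine ⟨∑ α ∈ P.support, ‖P.coeff α‖, Finset.sum_nonneg fun _ _ => norm_nonneg _, fun ξ => ?_⟩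
  rw [evalAt, MvPolynomial.eval_eq', Finset.sum_mul]
  refine (norm_sum_le _ _).trans (Finset.sum_le_sum fun α hα => ?_)
  rw [norm_mul]
  gcongr
  refine (norm_xiPow_le α ξ).trans (pow_le_pow_right₀ (one_le_jb ξ) ?_)
  refine le_trans ?_ ((MvPolynomial.le_totalDegree hα).trans hd)
  rw [Finsupp.degree_eq_sum, Finsupp.sum_fintype _ _ fun _ => rfl]

namespace Operator

theorem continuous_symbol (L : Operator n m) (z : ℂ) : Continuous (L.symbol z) := by
  unfold symbol
  exact continuous_const.add (continuous_finsetSum _ fun k _ =>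
    (continuous_evalAt (L.coeff k)).mul continuous_const)

/-- The coefficients of the ordinary differential equation `L(D_t, ξ) y = 0`, solved for the
derivative of highest order. -/
def odeCoeff (L : Operator n m) (ξ : Space n) (k : Fin m) : ℂ :=
  -(Complex.I ^ (m - (k : ℕ)) * evalAt (L.coeff k) ξ)

theorem continuous_odeCoeff (L : Operator n m) : Continuous L.odeCoeff :=
  continuous_pi fun k => (continuous_const.mul (continuous_evalAt (L.coeff k))).neg

variable {L : Operator n m} {τ : Fin m → Space n → ℂ}

/-- At `iz` the characteristic polynomial takes the value `i^m L(z, ξ)`, since `∂_t = i D_t`. -/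
theorem charPoly_odeCoeff (hτ : L.IsCharRoots τ) (ξ : Space n) :
    charPoly (L.odeCoeff ξ) =
      ∏ k, (Polynomial.X - Polynomial.C (Complex.I * τ k ξ)) := by
  refine Polynomial.funext fun w => ?_
  obtain ⟨z, rfl⟩ : ∃ z, w = Complex.I * z := ⟨-Complex.I * w, by
    rw [← mul_assoc, mul_neg, Complex.I_mul_I, neg_neg, one_mul]⟩
  have h := hτ ξ z
  rw [Polynomial.eval_prod]
  simp only [charPoly, Polynomial.eval_sub, Polynomial.eval_X, Polynomial.eval_C,
    Polynomial.eval_pow, Polynomial.eval_finsetSum, Polynomial.eval_mul, ← mul_sub]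
  rw [Finset.prod_mul_distrib, ← h, Finset.prod_const, Finset.card_univ, Fintype.card_fin, symbol,
    mul_add, mul_pow, sub_eq_add_neg, ← Finset.sum_neg_distrib, Finset.mul_sum]
  congr 1
  refine Finset.sum_congr rfl fun k _ => ?_
  have e : Complex.I ^ m = Complex.I ^ (m - (k : ℕ)) * Complex.I ^ (k : ℕ) := by
    rw [← pow_add]; congr 1; omega
  rw [odeCoeff, mul_pow, e, evalAt]
  ring

theorem symbol_root (hτ : L.IsCharRoots τ) (k : Fin m) (ξ : Space n) : L.symbol (τ k ξ) ξ = 0 := by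
  rw [hτ ξ]
  exact Finset.prod_eq_zero (Finset.mem_univ k) (sub_self _)

/-- Cauchy's bound for roots: as the coefficient of `τ^l` is `O(⟨ξ⟩^{m-l})`, the term `τ^m`
dominates all the others once `|τ|` is a large multiple of `⟨ξ⟩`. -/
theorem exists_norm_root_le (hτ : L.IsCharRoots τ) :
    ∃ C : ℝ, 0 ≤ C ∧ ∀ k ξ, ‖τ k ξ‖ ≤ C * jb ξ := by
  choose C hC0 hC using fun k => exists_norm_evalAt_le (L.coeff k) (L.totalDegree_le k)
  refine ⟨1 + ∑ k, C k, by have := Finset.sum_nonneg fun k (_ : k ∈ Finset.univ) => hC0 k; linarith,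
    fun k ξ => ?_⟩
  have hS : 0 ≤ ∑ k, C k := Finset.sum_nonneg fun k _ => hC0 k
  have hJ := jb_pos ξ
  by_contra hlt
  push Not at hlt
  have hJt : jb ξ ≤ ‖τ k ξ‖ := by nlinarith
  have h0 := symbol_root hτ k ξ
  rw [symbol, add_eq_zero_iff_eq_neg] at h0
  have hm : 0 < m := k.pos
  have ht0 : 0 < ‖τ k ξ‖ := hJ.trans_le hJt
  have h1 : ‖τ k ξ‖ ^ m ≤ ∑ l, C l * (jb ξ * ‖τ k ξ‖ ^ (m - 1)) := by
    rw [← norm_pow, h0, norm_neg]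
    refine (norm_sum_le _ _).trans (Finset.sum_le_sum fun l _ => ?_)
    rw [norm_mul, norm_pow]
    have e1 : m - (l : ℕ) = (m - 1 - l) + 1 := by omega
    have e2 : ‖τ k ξ‖ ^ (m - 1) = ‖τ k ξ‖ ^ (m - 1 - (l : ℕ)) * ‖τ k ξ‖ ^ (l : ℕ) := by
      rw [← pow_add]; congr 1; omega
    calc _ ≤ C l * jb ξ ^ (m - (l : ℕ)) * ‖τ k ξ‖ ^ (l : ℕ) := by gcongr; exact hC l ξ
      _ = C l * (jb ξ * (jb ξ ^ (m - 1 - (l : ℕ)) * ‖τ k ξ‖ ^ (l : ℕ))) := by rw [e1, pow_succ]; ring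
      _ ≤ _ := by
        rw [e2]
        gcongr
        exact hC0 l
  rw [← Finset.sum_mul] at h1
  have e3 : ‖τ k ξ‖ ^ m = ‖τ k ξ‖ * ‖τ k ξ‖ ^ (m - 1) := by
    rw [← pow_succ']; congr 1; omega
  rw [e3, ← mul_assoc] at h1
  have h2 := le_of_mul_le_mul_right h1 (by positivity)
  nlinarith

/-- The labelling need not be continuous. The root tuple is locally bounded, so it converges along
every ultrafilter, and the factorisation of the symbol passes to the limit. This serves as
continuity of the unordered roots. -/
theorem exists_tendsto_roots (hτ : L.IsCharRoots τ) {ξ₀ : Space n} (𝒰 : Ultrafilter (Space n))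
    (h𝒰 : (𝒰 : Filter (Space n)) ≤ 𝓝 ξ₀) :
    ∃ z : Fin m → ℂ, (∀ k, Tendsto (τ k) 𝒰 (𝓝 (z k))) ∧
      ∀ w, L.symbol w ξ₀ = ∏ k, (w - z k) := by
  obtain ⟨C, hC0, hC⟩ := exists_norm_root_le hτ
  have hb : ∀ᶠ ξ in (𝒰 : Filter (Space n)), (fun k => τ k ξ) ∈
      Metric.closedBall (0 : Fin m → ℂ) (C * (jb ξ₀ + 1)) := by
    have h1 : ∀ᶠ ξ in 𝓝 ξ₀, jb ξ < jb ξ₀ + 1 :=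
      continuous_jb.continuousAt.eventually (gt_mem_nhds (by linarith))
    filter_upwards [h𝒰 h1] with ξ hξ
    rw [mem_closedBall_zero_iff, pi_norm_le_iff_of_nonneg (by have := jb_pos ξ₀; positivity)]
    exact fun k => (hC k ξ).trans (mul_le_mul_of_nonneg_left hξ.le hC0)
  obtain ⟨z, -, hz⟩ := (isCompact_closedBall (0 : Fin m → ℂ) (C * (jb ξ₀ + 1))).ultrafilter_le_nhds
    (𝒰.map fun ξ k => τ k ξ) (by rw [le_principal_iff]; exact hb)
  have hz' : Tendsto (fun ξ k => τ k ξ) (𝒰 : Filter (Space n)) (𝓝 z) := hz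
  rw [tendsto_pi_nhds] at hz'
  refine ⟨z, hz', fun w => ?_⟩
  have h1 : Tendsto (L.symbol w) 𝒰 (𝓝 (L.symbol w ξ₀)) :=
    ((L.continuous_symbol w).tendsto ξ₀).mono_left h𝒰
  have h2 : Tendsto (fun ξ => ∏ k, (w - τ k ξ)) 𝒰 (𝓝 (∏ k, (w - z k))) :=
    tendsto_finsetProd _ fun k _ => tendsto_const_nhds.sub (hz' k)
  refine tendsto_nhds_unique h1 (h2.congr fun ξ => (hτ ξ w).symm)

theorem exists_pos_forall_le {ι : Type*} [Finite ι] (c : ι → ℝ) (h : ∀ i, 0 < c i) :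
    ∃ d : ℝ, 0 < d ∧ ∀ i, d ≤ c i := by
  cases isEmpty_or_nonempty ι
  · exact ⟨1, one_pos, fun i => isEmptyElim i⟩
  · obtain ⟨i, hi⟩ := Finite.exists_min c
    exact ⟨c i, h i, hi⟩

theorem eventually_im_ge_of_forall_pos (hτ : L.IsCharRoots τ) {ξ₀ : Space n}
    (h : ∀ k, 0 < (τ k ξ₀).im) : ∃ δ : ℝ, 0 < δ ∧ ∀ᶠ ξ in 𝓝 ξ₀, ∀ k, δ ≤ (τ k ξ).im := by
  obtain ⟨d, hd, hdk⟩ := exists_pos_forall_le _ h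
  refine ⟨d / 2, half_pos hd, ?_⟩
  rw [eventually_all]
  intro k
  rw [Filter.Eventually, Filter.mem_iff_ultrafilter]
  intro 𝒰 h𝒰
  obtain ⟨z, hz, hroot⟩ := exists_tendsto_roots hτ 𝒰 h𝒰
  have h0 : L.symbol (z k) ξ₀ = 0 := by
    rw [hroot]; exact Finset.prod_eq_zero (Finset.mem_univ k) (sub_self _)
  rw [hτ ξ₀, Finset.prod_eq_zero_iff] at h0
  obtain ⟨l, -, hl⟩ := h0
  have hzk : d / 2 < (z k).im := by rw [sub_eq_zero.1 hl]; linarith [hdk l]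
  have := (Complex.continuous_im.tendsto (z k)).comp (hz k)
  filter_upwards [this.eventually (lt_mem_nhds hzk)] with ξ hξ using hξ.le

/-- Continuity of `τ k` identifies one limit root. After its factor is cancelled, the other limits
lie among the remaining roots at `ξ₀`, whose imaginary parts are positive. The separation is seen in
the imaginary parts alone. -/
theorem eventually_im_ge_of_simple (hτ : L.IsCharRoots τ) {ξ₀ : Space n} {k : Fin m}
    (hk : (τ k ξ₀).im = 0) (hc : ContinuousAt (τ k) ξ₀) (h : ∀ l, l ≠ k → 0 < (τ l ξ₀).im) :
    ∃ δ : ℝ, 0 < δ ∧ ∀ᶠ ξ in 𝓝 ξ₀, (∀ l, l ≠ k → δ ≤ (τ l ξ).im) ∧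
      ∀ l, l ≠ k → δ / 2 ≤ ‖τ k ξ - τ l ξ‖ := by
  obtain ⟨d, hd, hdk⟩ := exists_pos_forall_le (fun l : {l // l ≠ k} => (τ l ξ₀).im)
    fun l => h l l.2
  have hev : ∀ᶠ ξ in 𝓝 ξ₀, ∀ l, l ≠ k → d / 2 ≤ (τ l ξ).im := by
    rw [eventually_all]
    intro l
    by_cases hlk : l = k
    · exact Eventually.of_forall fun _ h => absurd hlk h
    rw [Filter.Eventually, Filter.mem_iff_ultrafilter]
    intro 𝒰 h𝒰
    obtain ⟨z, hz, hroot⟩ := exists_tendsto_roots hτ 𝒰 h𝒰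
    have hzk : z k = τ k ξ₀ := tendsto_nhds_unique (hz k) (hc.tendsto.mono_left h𝒰)
    have hpoly : (∏ i, (Polynomial.X - Polynomial.C (z i)) : Polynomial ℂ) =
        ∏ i, (Polynomial.X - Polynomial.C (τ i ξ₀)) := by
      refine Polynomial.funext fun w => ?_
      simp only [Polynomial.eval_prod, Polynomial.eval_sub, Polynomial.eval_X, Polynomial.eval_C]
      rw [← hroot, hτ ξ₀]
    rw [← Finset.mul_prod_erase Finset.univ (fun i => Polynomial.X - Polynomial.C (z i))
      (Finset.mem_univ k), ← Finset.mul_prod_erase Finset.univ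
      (fun i => Polynomial.X - Polynomial.C (τ i ξ₀)) (Finset.mem_univ k), hzk] at hpoly
    -- Without this cancellation a limit of another root could still be the real root `τ k ξ₀`.
    have hpoly' := mul_left_cancel₀ (Polynomial.X_sub_C_ne_zero _) hpoly
    have h0 := congrArg (Polynomial.eval (z l)) hpoly'
    simp only [Polynomial.eval_prod, Polynomial.eval_sub, Polynomial.eval_X,
      Polynomial.eval_C] at h0
    rw [Finset.prod_eq_zero (i := l) (by simp [hlk]) (sub_self _), eq_comm,
      Finset.prod_eq_zero_iff] at h0
    obtain ⟨i, hi, hzi⟩ := h0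
    have hzl : d / 2 < (z l).im := by
      rw [sub_eq_zero.1 hzi]
      linarith [hdk ⟨i, Finset.ne_of_mem_erase hi⟩]
    have := (Complex.continuous_im.tendsto (z l)).comp (hz l)
    filter_upwards [this.eventually (lt_mem_nhds hzl)] with ξ hξ _ using le_of_lt hξ
  have hkim : ∀ᶠ ξ in 𝓝 ξ₀, (τ k ξ).im < d / 4 := by
    have h1 : Tendsto (fun ξ => (τ k ξ).im) (𝓝 ξ₀) (𝓝 0) := by
      rw [← hk]; exact (Complex.continuous_im.tendsto _).comp hc.tendsto
    exact h1.eventually (gt_mem_nhds (by linarith))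
  refine ⟨d / 2, half_pos hd, ?_⟩
  filter_upwards [hev, hkim] with ξ h1 h2
  refine ⟨h1, fun l hl => ?_⟩
  have h3 := h1 l hl
  have h4 := Complex.abs_im_le_norm (τ k ξ - τ l ξ)
  rw [Complex.sub_im] at h4
  have h5 := neg_abs_le ((τ k ξ).im - (τ l ξ).im)
  linarith

/-! ### Behaviour of the roots at infinity. -/

theorem evalAt_smul_of_isHomogeneous {P : MvPolynomial (Fin n) ℂ} {d : ℕ} (hP : P.IsHomogeneous d)
    (a : ℝ) (ξ : Space n) : evalAt P (a • ξ) = (a : ℂ) ^ d * evalAt P ξ := by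
  rw [evalAt, evalAt, MvPolynomial.eval_eq', MvPolynomial.eval_eq', Finset.mul_sum]
  refine Finset.sum_congr rfl fun α hα => ?_
  have hd : ∑ i, α i = d := by
    have := hP (MvPolynomial.mem_support_iff.1 hα)
    rw [← this, Finsupp.weight_apply, Finsupp.sum_fintype _ _ fun _ => by simp]
    simp
  simp only [PiLp.smul_apply, smul_eq_mul, Complex.ofReal_mul, mul_pow]
  rw [Finset.prod_mul_distrib, Finset.prod_pow_eq_pow_sum, hd]
  ring

theorem tendsto_scaled_evalAt {P : MvPolynomial (Fin n) ℂ} {d : ℕ} (hd : P.totalDegree ≤ d)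
    {𝒰 : Filter (Space n)} (h𝒰 : 𝒰 ≤ Bornology.cobounded _) {ω : Space n}
    (hω : Tendsto (fun ξ => ‖ξ‖⁻¹ • ξ) 𝒰 (𝓝 ω)) :
    Tendsto (fun ξ => ((‖ξ‖ : ℂ) ^ d)⁻¹ * evalAt P ξ) 𝒰
      (𝓝 (evalAt (MvPolynomial.homogeneousComponent d P) ω)) := by
  have hnorm : Tendsto (fun ξ : Space n => ‖ξ‖) 𝒰 atTop :=
    tendsto_norm_cobounded_atTop.mono_left h𝒰
  have hsum : P = ∑ i ∈ Finset.range (d + 1), MvPolynomial.homogeneousComponent i P := by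
    conv_lhs => rw [← MvPolynomial.sum_homogeneousComponent P]
    refine Finset.sum_subset (Finset.range_mono (by omega)) fun i _ hi => ?_
    rw [Finset.mem_range, not_lt] at hi
    exact MvPolynomial.homogeneousComponent_eq_zero _ _ (by omega)
  have hterm : ∀ i ∈ Finset.range (d + 1), Tendsto (fun ξ : Space n =>
      ((‖ξ‖ : ℂ) ^ (d - i))⁻¹ * evalAt (MvPolynomial.homogeneousComponent i P) (‖ξ‖⁻¹ • ξ)) 𝒰
      (𝓝 (if i = d then evalAt (MvPolynomial.homogeneousComponent i P) ω else 0)) := by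
    intro i hi
    have h1 := ((continuous_evalAt (MvPolynomial.homogeneousComponent i P)).tendsto ω).comp hω
    split_ifs with hid
    · subst hid
      simpa using! h1
    · have h2 : Tendsto (fun ξ : Space n => ((‖ξ‖ : ℂ) ^ (d - i))⁻¹) 𝒰 (𝓝 0) := by
        have h3 : Tendsto (fun ξ : Space n => (‖ξ‖ ^ (d - i))⁻¹) 𝒰 (𝓝 0) :=
          tendsto_inv_atTop_zero.comp ((tendsto_pow_atTop
            (by rw [Finset.mem_range] at hi; omega)).comp hnorm)
        have h4 := (Complex.continuous_ofReal.tendsto 0).comp h3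
        simpa [Function.comp_def] using h4
      have := h2.mul h1
      rwa [zero_mul] at this
  have hlim := tendsto_finsetSum _ hterm
  rw [Finset.sum_ite_eq' , if_pos (by simp)] at hlim
  refine hlim.congr' ?_
  filter_upwards [hnorm.eventually_gt_atTop 0] with ξ hξ
  have hx : ξ = ‖ξ‖ • (‖ξ‖⁻¹ • ξ) := by rw [smul_smul, mul_inv_cancel₀ hξ.ne', one_smul]
  have hξ' : (‖ξ‖ : ℂ) ≠ 0 := by exact_mod_cast hξ.ne'
  have hev : evalAt P ξ = ∑ i ∈ Finset.range (d + 1),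
      (‖ξ‖ : ℂ) ^ i * evalAt (MvPolynomial.homogeneousComponent i P) (‖ξ‖⁻¹ • ξ) := by
    conv_lhs => rw [hsum]
    rw [evalAt, map_sum]
    refine Finset.sum_congr rfl fun i _ => ?_
    rw [← evalAt_smul_of_isHomogeneous (MvPolynomial.homogeneousComponent_isHomogeneous i P),
      ← hx]
    rfl
  rw [hev, Finset.mul_sum]
  refine Finset.sum_congr rfl fun i hi => ?_
  have e : (‖ξ‖ : ℂ) ^ d = (‖ξ‖ : ℂ) ^ (d - i) * (‖ξ‖ : ℂ) ^ i := by
    rw [← pow_add]; congr 1; rw [Finset.mem_range] at hi; omega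
  rw [e]
  field_simp

/-- Divided by `|ξ|`, the roots converge along ultrafilters at infinity to the roots of the
principal symbol in the limit direction `ω`, because lower order terms scale away. These limits are
distinct, so two rescaled roots cannot approach each other. -/
theorem exists_separation (hL : L.StrictlyHyperbolic) (hτ : L.IsCharRoots τ) :
    ∃ c : ℝ, 0 < c ∧ ∀ᶠ ξ in Bornology.cobounded (Space n),
      ∀ k l, k ≠ l → c * ‖ξ‖ ≤ ‖τ k ξ - τ l ξ‖ := by
  obtain ⟨C, hC0, hC⟩ := exists_norm_root_le hτ
  have key : ∀ k l, k ≠ l → ∃ c : ℝ, 0 < c ∧ ∀ᶠ ξ in Bornology.cobounded (Space n),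
      c * ‖ξ‖ ≤ ‖τ k ξ - τ l ξ‖ := by
    intro k l hkl
    by_contra hcon
    push Not at hcon
    let f : Space n → ℝ := fun ξ => ‖ξ‖⁻¹ * ‖τ k ξ - τ l ξ‖
    -- Failure for every `c` provides a filter at infinity along which the rescaled difference of
    -- the two roots tends to `0`.
    have hne : (Bornology.cobounded (Space n) ⊓ comap f (𝓝 0)).NeBot := by
      rw [(Filter.basis_sets _).inf_basis_neBot_iff (Metric.nhds_basis_ball.comap f)]
      intro S hS ε hε
      have h1 := (hcon ε hε).and_eventually
        (eventually_mem_set.2 hS |>.and (eventually_cobounded_le_norm (1 : ℝ)))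
      obtain ⟨ξ, h2, h3, h4⟩ := h1.exists
      refine ⟨ξ, h3, ?_⟩
      have h5 : 0 < ‖ξ‖ := by linarith
      rw [Set.mem_preimage, mem_ball_zero_iff, Real.norm_of_nonneg (by positivity)]
      change ‖ξ‖⁻¹ * ‖τ k ξ - τ l ξ‖ < ε
      rw [inv_mul_lt_iff₀ h5]
      linarith
    obtain ⟨𝒰, h𝒰⟩ := @Filter.exists_ultrafilter_le _ _ hne
    have h𝒰1 : (𝒰 : Filter (Space n)) ≤ Bornology.cobounded (Space n) := h𝒰.trans inf_le_left
    have h𝒰2 : Tendsto f 𝒰 (𝓝 0) := tendsto_iff_comap.2 (h𝒰.trans inf_le_right)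
    have hn1 : ∀ᶠ ξ in (𝒰 : Filter (Space n)), 1 ≤ ‖ξ‖ := h𝒰1 (eventually_cobounded_le_norm 1)
    obtain ⟨ω, hω1, hω⟩ := (isCompact_sphere (0 : Space n) 1).ultrafilter_le_nhds
      (𝒰.map fun ξ => ‖ξ‖⁻¹ • ξ) (by
        rw [le_principal_iff]
        change ∀ᶠ ξ in (𝒰 : Filter (Space n)), ‖ξ‖⁻¹ • ξ ∈ Metric.sphere (0 : Space n) 1
        filter_upwards [hn1] with ξ hξ
        rw [mem_sphere_zero_iff_norm, norm_smul, norm_inv, norm_norm, inv_mul_cancel₀ (by linarith)])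
    have hω' : Tendsto (fun ξ : Space n => ‖ξ‖⁻¹ • ξ) 𝒰 (𝓝 ω) := hω
    obtain ⟨z, -, hz⟩ := (isCompact_closedBall (0 : Fin m → ℂ) (C * 2)).ultrafilter_le_nhds
      (𝒰.map fun ξ i => ((‖ξ‖ : ℂ))⁻¹ * τ i ξ) (by
        rw [le_principal_iff]
        change ∀ᶠ ξ in (𝒰 : Filter (Space n)), _ ∈ Metric.closedBall (0 : Fin m → ℂ) (C * 2)
        filter_upwards [hn1] with ξ hξ
        rw [mem_closedBall_zero_iff, pi_norm_le_iff_of_nonneg (by positivity)]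
        intro i
        rw [norm_mul, norm_inv, Complex.norm_real, norm_norm, inv_mul_le_iff₀ (by linarith)]
        have h1 := jb_le_one_add ξ
        calc ‖τ i ξ‖ ≤ C * jb ξ := hC i ξ
          _ ≤ C * (2 * ‖ξ‖) := by gcongr; linarith
          _ = _ := by ring)
    have hz' : Tendsto (fun (ξ : Space n) i => ((‖ξ‖ : ℂ))⁻¹ * τ i ξ) 𝒰 (𝓝 z) := hz
    rw [tendsto_pi_nhds] at hz'
    have hω0 : ω ≠ 0 := by
      intro h0
      rw [h0, mem_sphere_zero_iff_norm, norm_zero] at hω1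
      exact zero_ne_one hω1
    obtain ⟨φ, hφ, hφr⟩ := hL ω hω0
    have hprod : ∀ w, L.principalSymbol w ω = ∏ i, (w - z i) := by
      intro w
      have h1 : Tendsto (fun ξ : Space n => ((‖ξ‖ : ℂ) ^ m)⁻¹ * L.symbol (‖ξ‖ * w) ξ) 𝒰
          (𝓝 (L.principalSymbol w ω)) := by
        have h2 : Tendsto (fun ξ : Space n => w ^ m + ∑ i : Fin m,
            (((‖ξ‖ : ℂ) ^ (m - (i : ℕ)))⁻¹ * evalAt (L.coeff i) ξ) * w ^ (i : ℕ)) 𝒰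
            (𝓝 (L.principalSymbol w ω)) :=
          tendsto_const_nhds.add (tendsto_finsetSum _ fun i _ =>
            (tendsto_scaled_evalAt (L.totalDegree_le i) h𝒰1 hω').mul_const _)
        refine h2.congr' ?_
        filter_upwards [hn1] with ξ hξ
        have hξ' : (‖ξ‖ : ℂ) ≠ 0 := by
          have : ‖ξ‖ ≠ 0 := by linarith
          exact_mod_cast this
        rw [symbol, mul_add, Finset.mul_sum]
        congr 1
        · rw [mul_pow, inv_mul_cancel_left₀ (pow_ne_zero _ hξ')]
        · refine Finset.sum_congr rfl fun i _ => ?_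
          have e : (‖ξ‖ : ℂ) ^ m = (‖ξ‖ : ℂ) ^ (m - (i : ℕ)) * (‖ξ‖ : ℂ) ^ (i : ℕ) := by
            rw [← pow_add]; congr 1; omega
          rw [e, mul_pow, evalAt]
          field_simp
      have h3 : Tendsto (fun ξ : Space n => ∏ i, (w - ((‖ξ‖ : ℂ))⁻¹ * τ i ξ)) 𝒰
          (𝓝 (∏ i, (w - z i))) :=
        tendsto_finsetProd _ fun i _ => tendsto_const_nhds.sub (hz' i)
      refine tendsto_nhds_unique h1 (h3.congr' ?_)
      filter_upwards [hn1] with ξ hξ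
      have hξ' : (‖ξ‖ : ℂ) ≠ 0 := by
        have : ‖ξ‖ ≠ 0 := by linarith
        exact_mod_cast this
      have e : (‖ξ‖ : ℂ) ^ m = ∏ _i : Fin m, (‖ξ‖ : ℂ) := by simp
      rw [hτ ξ, e, ← Finset.prod_inv_distrib, ← Finset.prod_mul_distrib]
      refine Finset.prod_congr rfl fun i _ => ?_
      rw [mul_sub, inv_mul_cancel_left₀ hξ']
    have hpoly : (∏ i, (Polynomial.X - Polynomial.C (z i)) : Polynomial ℂ) =
        ∏ i, (Polynomial.X - Polynomial.C ((φ i : ℂ))) := by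
      refine Polynomial.funext fun w => ?_
      simp only [Polynomial.eval_prod, Polynomial.eval_sub, Polynomial.eval_X, Polynomial.eval_C]
      rw [← hprod, hφr]
    -- The tuples `z` and `φ` are the same multiset of roots, and the latter has no repetition.
    have hzinj : Function.Injective z := by
      have hroots : ∀ v : Fin m → ℂ, (∏ i, (Polynomial.X - Polynomial.C (v i))).roots =
          Finset.univ.val.map v := fun v => by
        have := Polynomial.roots_multiset_prod_X_sub_C (Finset.univ.val.map v)
        rwa [Multiset.map_map] at this
      have hm1 := congrArg Polynomial.roots hpoly
      rw [hroots, hroots] at hm1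
      have hnd : (Finset.univ.val.map z).Nodup := by
        rw [hm1]
        exact Finset.univ.nodup.map fun a b hab => hφ (Complex.ofReal_injective hab)
      intro a b hab
      exact Multiset.inj_on_of_nodup_map hnd a (Finset.mem_univ a) b (Finset.mem_univ b) hab
    have hlim : Tendsto f 𝒰 (𝓝 ‖z k - z l‖) := by
      refine ((hz' k).sub (hz' l)).norm.congr fun ξ => ?_
      rw [← mul_sub, norm_mul, norm_inv, Complex.norm_real, norm_norm]
    have := tendsto_nhds_unique hlim h𝒰2
    rw [norm_eq_zero, sub_eq_zero] at this
    exact hkl (hzinj this)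
  choose! c hc0 hc using key
  obtain ⟨d, hd, hdle⟩ := exists_pos_forall_le (fun x : {x : Fin m × Fin m // x.1 ≠ x.2} =>
    c x.1.1 x.1.2) fun x => hc0 _ _ x.2
  refine ⟨d, hd, ?_⟩
  rw [eventually_all]; intro k
  rw [eventually_all]; intro l
  by_cases hkl : k = l
  · exact Eventually.of_forall fun _ h => absurd hkl h
  filter_upwards [hc k l hkl] with ξ hξ _
  refine le_trans ?_ hξ
  gcongr
  exact hdle ⟨(k, l), hkl⟩

end Operator

end Roots

/-! ### Pointwise bounds of the fundamental solutions -/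

section Pointwise

variable {n m : ℕ}

theorem eventually_jb_and_norm_le (L : Operator n m) {τ : Fin m → Space n → ℂ}
    (hτ : L.IsCharRoots τ) (ξ₀ : Space n) :
    ∃ ρ : ℝ, 0 ≤ ρ ∧ ∀ᶠ ξ in 𝓝 ξ₀, jb ξ ≤ ρ ∧
      ∀ k, ‖companion (L.odeCoeff ξ)‖ + ‖τ k ξ‖ ≤ ρ := by
  obtain ⟨C, hC0, hC⟩ := Operator.exists_norm_root_le hτ
  have hcomp : Continuous fun ξ => ‖companion (L.odeCoeff ξ)‖ :=
    (continuous_companion.comp L.continuous_odeCoeff).norm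
  have e1 : ∀ᶠ ξ in 𝓝 ξ₀, jb ξ < jb ξ₀ + 1 :=
    continuous_jb.continuousAt.eventually (gt_mem_nhds (by linarith))
  have e2 : ∀ᶠ ξ in 𝓝 ξ₀, ‖companion (L.odeCoeff ξ)‖ < ‖companion (L.odeCoeff ξ₀)‖ + 1 :=
    hcomp.continuousAt.eventually (gt_mem_nhds (by linarith))
  have hJ := jb_pos ξ₀
  have hn := norm_nonneg (companion (L.odeCoeff ξ₀))
  have hCJ : 0 ≤ C * (jb ξ₀ + 1) := by positivity
  refine ⟨jb ξ₀ + 1 + (‖companion (L.odeCoeff ξ₀)‖ + 1) + C * (jb ξ₀ + 1), by positivity, ?_⟩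
  filter_upwards [e1, e2] with ξ h1 h2
  refine ⟨by linarith, fun k => ?_⟩
  have h3 : ‖τ k ξ‖ ≤ C * (jb ξ₀ + 1) := (hC k ξ).trans (by gcongr)
  linarith

/-- On bounded sets the weight `⟨ξ⟩^{|α|+r-j}` required by `FundSolBound` can be inserted for free.
Since `j < m`, the exponent is at least `-m`. -/
theorem one_le_jb_pow_mul_rpow {R : ℝ} {ξ : Space n} (hξ : jb ξ ≤ R) (α : Fin n →₀ ℕ) (r : ℕ)
    (j : Fin m) : 1 ≤ R ^ m * jb ξ ^ ((α.degree : ℝ) + r - (j : ℕ)) := by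
  have h1 := one_le_jb ξ
  have hJ := jb_pos ξ
  have h2 : jb ξ ^ (-(m : ℝ)) ≤ jb ξ ^ ((α.degree : ℝ) + r - (j : ℕ)) := by
    refine Real.rpow_le_rpow_of_exponent_le h1 ?_
    have : ((j : ℕ) : ℝ) ≤ m := by exact_mod_cast j.2.le
    have h3 : (0 : ℝ) ≤ α.degree := by positivity
    have h4 : (0 : ℝ) ≤ r := by positivity
    linarith
  rw [Real.rpow_neg hJ.le, Real.rpow_natCast] at h2
  calc (1 : ℝ) = jb ξ ^ m * (jb ξ ^ m)⁻¹ := (mul_inv_cancel₀ (by positivity)).symm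
    _ ≤ _ := by
        have := hJ.le.trans hξ
        gcongr

/-- The size at time `t` of the Fourier multipliers solving the Cauchy problem, relative to a
power of `⟨ξ⟩`; the finite set `Z` consists of the frequencies of slow decay. -/
def envelope (Z : Finset (Space n)) (δ c κ s t : ℝ) (ξ : Space n) : ℝ :=
  Real.exp (-δ * t) + ∑ z ∈ Z,
    if ‖ξ - z‖ < 1 then ‖ξ - z‖ ^ κ * Real.exp (-c * t * ‖ξ - z‖ ^ s) else 0

theorem envelope_nonneg (Z : Finset (Space n)) (δ c κ s t : ℝ) (ξ : Space n) :
    0 ≤ envelope Z δ c κ s t ξ := by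
  unfold envelope
  refine add_nonneg (Real.exp_pos _).le (Finset.sum_nonneg fun z _ => ?_)
  split_ifs <;> positivity

theorem exp_le_envelope (Z : Finset (Space n)) (δ c κ s t : ℝ) (ξ : Space n) :
    Real.exp (-δ * t) ≤ envelope Z δ c κ s t ξ := by
  unfold envelope
  refine le_add_of_nonneg_right (Finset.sum_nonneg fun z _ => ?_)
  split_ifs <;> positivity

theorem add_le_envelope {Z : Finset (Space n)} {δ c κ s t : ℝ} {ξ z : Space n} (hz : z ∈ Z)
    (hξ : ‖ξ - z‖ < 1) :
    Real.exp (-δ * t) + ‖ξ - z‖ ^ κ * Real.exp (-c * t * ‖ξ - z‖ ^ s) ≤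
      envelope Z δ c κ s t ξ := by
  unfold envelope
  gcongr
  refine le_trans (le_of_eq ?_) (Finset.single_le_sum (f := fun z =>
    if ‖ξ - z‖ < 1 then ‖ξ - z‖ ^ κ * Real.exp (-c * t * ‖ξ - z‖ ^ s) else 0)
    (fun z _ => ?_) hz)
  · rw [if_pos hξ]
  · split_ifs <;> positivity

theorem envelope_anti {Z : Finset (Space n)} {δ c δ' c' κ s t : ℝ} (hδ : δ' ≤ δ) (hc : c' ≤ c)
    (ht : 0 ≤ t) (ξ : Space n) : envelope Z δ c κ s t ξ ≤ envelope Z δ' c' κ s t ξ := by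
  unfold envelope
  gcongr with z hz
  split_ifs
  · gcongr
  · exact le_rfl

/-- The bound of the fundamental solutions on a set of frequencies. -/
def FundSolBound (L : Operator n m) [NeZero m] (Z : Finset (Space n)) (κ s : ℝ) (r : ℕ)
    (α : Fin n →₀ ℕ) (S : Set (Space n)) : Prop :=
  ∃ C δ c : ℝ, 0 < C ∧ 0 < δ ∧ 0 < c ∧ ∀ ξ ∈ S, ∀ (j : Fin m) (t : ℝ), 0 ≤ t →
    ‖xiPow α ξ‖ * ‖fundSol (L.odeCoeff ξ) j (Polynomial.X ^ r) t‖ ≤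
      C * envelope Z δ c κ s t ξ * jb ξ ^ ((α.degree : ℝ) + r - (j : ℕ))

variable {L : Operator n m} [NeZero m] {Z : Finset (Space n)} {κ s : ℝ} {r : ℕ}
  {α : Fin n →₀ ℕ} {S S' : Set (Space n)}

theorem FundSolBound.mono (h : FundSolBound L Z κ s r α S) (hS : S' ⊆ S) :
    FundSolBound L Z κ s r α S' := by
  obtain ⟨C, δ, c, hC, hδ, hc, H⟩ := h
  exact ⟨C, δ, c, hC, hδ, hc, fun ξ hξ => H ξ (hS hξ)⟩

theorem FundSolBound.union (h : FundSolBound L Z κ s r α S) (h' : FundSolBound L Z κ s r α S') :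
    FundSolBound L Z κ s r α (S ∪ S') := by
  obtain ⟨C, δ, c, hC, hδ, hc, H⟩ := h
  obtain ⟨C', δ', c', hC', hδ', hc', H'⟩ := h'
  refine ⟨max C C', min δ δ', min c c', lt_max_of_lt_left hC, lt_min hδ hδ', lt_min hc hc', ?_⟩
  rintro ξ (hξ | hξ) j t ht
  · refine (H ξ hξ j t ht).trans ?_
    have := envelope_nonneg Z δ c κ s t ξ
    have := jb_pos ξ
    gcongr
    · exact le_max_left _ _
    · exact envelope_anti (min_le_left _ _) (min_le_left _ _) ht ξ
  · refine (H' ξ hξ j t ht).trans ?_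
    have := envelope_nonneg Z δ' c' κ s t ξ
    have := jb_pos ξ
    gcongr
    · exact le_max_right _ _
    · exact envelope_anti (min_le_right _ _) (min_le_right _ _) ht ξ

theorem fundSolBound_of_forall_pos {τ : Fin m → Space n → ℂ} (hτ : L.IsCharRoots τ)
    {ξ₀ : Space n} (h : ∀ k, 0 < (τ k ξ₀).im) (Z : Finset (Space n)) (κ s : ℝ) (r : ℕ)
    (α : Fin n →₀ ℕ) : ∃ S ∈ 𝓝 ξ₀, FundSolBound L Z κ s r α S := by
  obtain ⟨δ, hδ, hδe⟩ := Operator.eventually_im_ge_of_forall_pos hτ h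
  obtain ⟨ρ, hρ, hρe⟩ := eventually_jb_and_norm_le L hτ ξ₀
  obtain ⟨K, hK, H⟩ := exists_norm_fundSol_le_of_im_ge m r hρ hδ
  refine ⟨_, hδe.and hρe, K * (ρ + 1) ^ (α.degree) * (ρ + 1) ^ m, δ / 2, 1, by positivity,
    half_pos hδ, one_pos, ?_⟩
  rintro ξ ⟨h1, h2, h3⟩ j t ht
  have h4 := H _ _ (Operator.charPoly_odeCoeff hτ ξ) h1 h3 j t ht
  have h5 : ‖xiPow α ξ‖ ≤ (ρ + 1) ^ α.degree :=
    (norm_xiPow_le α ξ).trans (by have := jb_pos ξ; gcongr; linarith)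
  have h6 := one_le_jb_pow_mul_rpow (m := m) (h2.trans (by linarith : ρ ≤ ρ + 1)) α r j
  calc _ ≤ (ρ + 1) ^ α.degree * (K * Real.exp (-(δ / 2) * t)) := by gcongr
    _ ≤ (ρ + 1) ^ α.degree * (K * envelope Z (δ / 2) 1 κ s t ξ) * 1 := by
        rw [mul_one]; gcongr; exact exp_le_envelope _ _ _ _ _ _ _
    _ ≤ (ρ + 1) ^ α.degree * (K * envelope Z (δ / 2) 1 κ s t ξ) *
        ((ρ + 1) ^ m * jb ξ ^ ((α.degree : ℝ) + r - (j : ℕ))) := by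
      have := envelope_nonneg Z (δ / 2) 1 κ s t ξ
      gcongr
    _ = _ := by ring

/-- The exceptional root produces the slow summand of the envelope at `ξ₀`: `hs` bounds its
exponential and `hκ` its prefactor. The remaining roots go into `e^{-δt/2}`. -/
theorem fundSolBound_of_simple {τ : Fin m → Space n → ℂ} (hτ : L.IsCharRoots τ)
    {ξ₀ : Space n} {k : Fin m} (hk : (τ k ξ₀).im = 0) (hc : ContinuousAt (τ k) ξ₀)
    (h : ∀ l, l ≠ k → 0 < (τ l ξ₀).im) (hZ : ξ₀ ∈ Z) {c c' : ℝ} (hc0 : 0 < c) (hc0' : 0 < c')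
    (hs : ∀ᶠ ξ in 𝓝 ξ₀, ‖ξ - ξ₀‖ ^ s ≤ c * (τ k ξ).im)
    (hκ : ∀ᶠ ξ in 𝓝 ξ₀, ‖xiPow α ξ‖ * ‖τ k ξ‖ ^ r ≤ c' * ‖ξ - ξ₀‖ ^ κ) :
    ∃ S ∈ 𝓝 ξ₀, FundSolBound L Z κ s r α S := by
  obtain ⟨δ, hδ, hδe⟩ := Operator.eventually_im_ge_of_simple hτ hk hc h
  obtain ⟨ρ, hρ, hρe⟩ := eventually_jb_and_norm_le L hτ ξ₀
  obtain ⟨K, hK, H⟩ := exists_norm_fundSol_le_of_isolated m r hρ hδ (half_pos hδ)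
  have hball : ∀ᶠ ξ in 𝓝 ξ₀, ‖ξ - ξ₀‖ < 1 := by
    filter_upwards [Metric.ball_mem_nhds ξ₀ one_pos] with ξ hξ
    rwa [mem_ball_iff_norm] at hξ
  refine ⟨_, (hδe.and hρe).and ((hs.and hκ).and hball),
    K * ((ρ + 1) ^ α.degree + c') * (ρ + 1) ^ m, δ / 2, c⁻¹, by positivity,
    half_pos hδ, by positivity, ?_⟩
  rintro ξ ⟨⟨⟨h1, h1'⟩, h2, h3⟩, ⟨h4, h5⟩, h6⟩ j t ht
  have h7 := H _ _ k (Operator.charPoly_odeCoeff hτ ξ) h1 h1' h3 j t ht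
  have h8 : ‖xiPow α ξ‖ ≤ (ρ + 1) ^ α.degree :=
    (norm_xiPow_le α ξ).trans (by have := jb_pos ξ; gcongr; linarith)
  have h9 := one_le_jb_pow_mul_rpow (m := m) (h2.trans (by linarith : ρ ≤ ρ + 1)) α r j
  have h10 : Real.exp (-(τ k ξ).im * t) ≤ Real.exp (-c⁻¹ * t * ‖ξ - ξ₀‖ ^ s) := by
    rw [Real.exp_le_exp]
    have : c⁻¹ * ‖ξ - ξ₀‖ ^ s ≤ (τ k ξ).im := by rwa [inv_mul_le_iff₀ hc0]
    nlinarith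
  set E := Real.exp (-c⁻¹ * t * ‖ξ - ξ₀‖ ^ s) with hE
  have hEp : 0 < E := Real.exp_pos _
  have henv := add_le_envelope (δ := δ / 2) (c := c⁻¹) (κ := κ) (s := s) (t := t) hZ h6
  have hp : 0 ≤ ‖ξ - ξ₀‖ ^ κ := by positivity
  have hpow : 0 ≤ (ρ + 1) ^ α.degree := by positivity
  have hex := Real.exp_pos (-(δ / 2) * t)
  have henv0 := envelope_nonneg Z (δ / 2) c⁻¹ κ s t ξ
  calc _ ≤ ‖xiPow α ξ‖ * (K * (‖τ k ξ‖ ^ r * Real.exp (-(τ k ξ).im * t)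
          + Real.exp (-(δ / 2) * t))) := by gcongr
    _ = K * ((‖xiPow α ξ‖ * ‖τ k ξ‖ ^ r) * Real.exp (-(τ k ξ).im * t)
          + ‖xiPow α ξ‖ * Real.exp (-(δ / 2) * t)) := by ring
    _ ≤ K * ((c' * ‖ξ - ξ₀‖ ^ κ) * E + (ρ + 1) ^ α.degree * Real.exp (-(δ / 2) * t)) := by
        gcongr
    _ ≤ K * (((ρ + 1) ^ α.degree + c') *
        (Real.exp (-(δ / 2) * t) + ‖ξ - ξ₀‖ ^ κ * E)) := by
        gcongr
        nlinarith [mul_nonneg hpow (mul_nonneg hp hEp.le), mul_nonneg hc0'.le hex.le]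
    _ ≤ K * (((ρ + 1) ^ α.degree + c') * envelope Z (δ / 2) c⁻¹ κ s t ξ) * 1 := by
        rw [mul_one]; gcongr
    _ ≤ K * (((ρ + 1) ^ α.degree + c') * envelope Z (δ / 2) c⁻¹ κ s t ξ) *
        ((ρ + 1) ^ m * jb ξ ^ ((α.degree : ℝ) + r - (j : ℕ))) := by
      gcongr
    _ = _ := by ring

theorem fundSolBound_cobounded {τ : Fin m → Space n → ℂ} (hL : L.StrictlyHyperbolic)
    (hτ : L.IsCharRoots τ) (H1 : ∀ k : Fin m, ∃ δ : ℝ, 0 < δ ∧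
      ∀ᶠ ξ in Bornology.cobounded (Space n), δ ≤ (τ k ξ).im)
    (Z : Finset (Space n)) (κ s : ℝ) (r : ℕ) (α : Fin n →₀ ℕ) :
    ∃ S ∈ Bornology.cobounded (Space n), FundSolBound L Z κ s r α S := by
  choose δ hδ hδe using H1
  obtain ⟨d, hd, hdδ⟩ := Operator.exists_pos_forall_le δ hδ
  obtain ⟨c, hc, hce⟩ := Operator.exists_separation hL hτ
  obtain ⟨C, hC0, hC⟩ := Operator.exists_norm_root_le hτ
  obtain ⟨K, hK, H⟩ := exists_norm_fundSol_le_of_separated m r (half_pos hc) hC0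
  refine ⟨_, ((eventually_all.2 hδe).and hce).and (eventually_cobounded_le_norm (1 : ℝ)),
    K, d, 1, hK, hd, one_pos, ?_⟩
  rintro ξ ⟨⟨h1, h2⟩, h3⟩ j t ht
  have hJ := jb_pos ξ
  have hJ2 : jb ξ ≤ 2 * ‖ξ‖ := (jb_le_one_add ξ).trans (by linarith)
  -- The scale `Λ` is `⟨ξ⟩`. As `⟨ξ⟩ ≤ 2|ξ|` for `|ξ| ≥ 1`, the separation `c|ξ|` is at least
  -- `(c/2)⟨ξ⟩`.
  have h4 := H _ _ (jb ξ) d hJ (Operator.charPoly_odeCoeff hτ ξ) (fun k => (hdδ k).trans (h1 k))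
    (fun k l hkl => le_trans (by nlinarith) (h2 k l hkl)) (fun k => hC k ξ) j t ht
  calc _ ≤ jb ξ ^ α.degree * (K * (jb ξ ^ r / jb ξ ^ (j : ℕ)) * Real.exp (-d * t)) := by
        gcongr
        exact norm_xiPow_le α ξ
    _ = K * Real.exp (-d * t) * jb ξ ^ ((α.degree : ℝ) + r - (j : ℕ)) := by
        rw [Real.rpow_sub hJ, Real.rpow_add hJ, Real.rpow_natCast, Real.rpow_natCast,
          Real.rpow_natCast]
        ring
    _ ≤ _ := by
        gcongr
        exact exp_le_envelope _ _ _ _ _ _ _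

/-- The bound is stable under finite unions, so it may be checked near infinity and near each point
of the compact remainder. By (H2) every point is either free of real roots or carries exactly one.
-/
theorem fundSolBound_univ {τ : Fin m → Space n → ℂ} (hL : L.StrictlyHyperbolic)
    (hτ : L.IsCharRoots τ)
    (hcont : ∀ (k : Fin m) (ξ₀ : Space n), (τ k ξ₀).im = 0 → ContinuousAt (τ k) ξ₀)
    (hstab : ∀ (k : Fin m) (ξ : Space n), 0 ≤ (τ k ξ).im)
    (H1 : ∀ k : Fin m, ∃ δ : ℝ, 0 < δ ∧
      ∀ᶠ ξ in Bornology.cobounded (Space n), δ ≤ (τ k ξ).im)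
    (H2 : ∀ ξ₀ : Space n,
      (∀ k l : Fin m, (τ k ξ₀).im = 0 → (τ l ξ₀).im = 0 → k = l) ∧
      ∀ k : Fin m, (τ k ξ₀).im = 0 →
        ∃ c : ℝ, 0 < c ∧ ∀ᶠ ξ in 𝓝 ξ₀, ‖ξ - ξ₀‖ ^ s ≤ c * (τ k ξ).im)
    (hZ : ∀ (k : Fin m) (ξ₀ : Space n), (τ k ξ₀).im = 0 → ξ₀ ∈ Z)
    (hκ : ∀ (k : Fin m) (ξ₀ : Space n), (τ k ξ₀).im = 0 →
      ∃ c : ℝ, 0 < c ∧ ∀ᶠ ξ in 𝓝 ξ₀, ‖xiPow α ξ‖ * ‖τ k ξ‖ ^ r ≤ c * ‖ξ - ξ₀‖ ^ κ) :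
    FundSolBound L Z κ s r α Set.univ := by
  obtain ⟨S, hS, hSb⟩ := fundSolBound_cobounded hL hτ H1 Z κ s r α
  have hcompact : IsCompact (closure Sᶜ) :=
    (Metric.isCompact_iff_isClosed_bounded.2 ⟨isClosed_closure,
      (Bornology.isBounded_compl_iff.2 (Bornology.isCobounded_def.2 hS)).closure⟩)
  have hb : FundSolBound L Z κ s r α (closure Sᶜ) := by
    refine hcompact.induction_on (p := FundSolBound L Z κ s r α) ?_ (fun _ _ h h' => h'.mono h)
      (fun _ _ h h' => h.union h') fun ξ₀ _ => ?_
    · exact ⟨1, 1, 1, one_pos, one_pos, one_pos, fun ξ h => h.elim⟩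
    · have : ∃ S ∈ 𝓝 ξ₀, FundSolBound L Z κ s r α S := by
        by_cases h : ∃ k, (τ k ξ₀).im = 0
        · obtain ⟨k, hk⟩ := h
          obtain ⟨c, hc, hce⟩ := (H2 ξ₀).2 k hk
          obtain ⟨c', hc', hce'⟩ := hκ k ξ₀ hk
          exact fundSolBound_of_simple hτ hk (hcont k ξ₀ hk) (fun l hl =>
            lt_of_le_of_ne (hstab l ξ₀) fun h0 => hl ((H2 ξ₀).1 l k h0.symm hk)) (hZ k ξ₀ hk)
            hc hc' hce hce'
        · push Not at h
          exact fundSolBound_of_forall_pos hτ (fun k => lt_of_le_of_ne (hstab k ξ₀) (h k).symm)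
            Z κ s r α
      obtain ⟨S, hS, hSb⟩ := this
      exact ⟨S, mem_nhdsWithin_of_mem_nhds hS, hSb⟩
  refine (hSb.union hb).mono fun ξ _ => ?_
  by_cases h : ξ ∈ S
  · exact Or.inl h
  · exact Or.inr (subset_closure h)

end Pointwise

/-! ### Fourier transforms of functions -/

section FourierPairs

open FourierTransform

variable {n : ℕ}

/-- `F` is the Fourier transform of `u`, in the sense of tempered distributions. -/
def HasFT (u F : Space n → ℂ) : Prop :=
  ∀ φ : 𝓢(Space n, ℂ), Integrable (fun x => (𝓕 φ) x * u x) ∧ Integrable (fun ξ => φ ξ * F ξ) ∧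
    ∫ x, (𝓕 φ) x * u x = ∫ ξ, φ ξ * F ξ

/-- `G` is the Fourier transform of the tempered distribution `T`. -/
def IsFT (T : Distr n) (G : Space n → ℂ) : Prop :=
  ∀ φ : 𝓢(Space n, ℂ), Integrable (fun ξ => φ ξ * G ξ) ∧ T (𝓕 φ) = ∫ ξ, φ ξ * G ξ

theorem HasFT.add {u F u' F' : Space n → ℂ} (h : HasFT u F) (h' : HasFT u' F') :
    HasFT (fun x => u x + u' x) (fun ξ => F ξ + F' ξ) := fun φ => by
  obtain ⟨h1, h2, h3⟩ := h φ
  obtain ⟨h1', h2', h3'⟩ := h' φ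
  simp only [mul_add]
  exact ⟨h1.add h1', h2.add h2', by rw [integral_add h1 h1', integral_add h2 h2', h3, h3']⟩

theorem HasFT.const_mul {u F : Space n → ℂ} (h : HasFT u F) (c : ℂ) :
    HasFT (fun x => c * u x) (fun ξ => c * F ξ) := fun φ => by
  obtain ⟨h1, h2, h3⟩ := h φ
  simp only [mul_left_comm _ c]
  exact ⟨h1.const_mul c, h2.const_mul c, by rw [integral_const_mul, integral_const_mul, h3]⟩

theorem HasFT.congr {u F u' F' : Space n → ℂ} (h : HasFT u F) (hu : u =ᵐ[volume] u')
    (hF : F =ᵐ[volume] F') : HasFT u' F' := fun φ => by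
  obtain ⟨h1, h2, h3⟩ := h φ
  have e1 : (fun x => (𝓕 φ) x * u x) =ᵐ[volume] fun x => (𝓕 φ) x * u' x := by
    filter_upwards [hu] with x hx; rw [hx]
  have e2 : (fun x => φ x * F x) =ᵐ[volume] fun x => φ x * F' x := by
    filter_upwards [hF] with x hx; rw [hx]
  exact ⟨h1.congr e1, h2.congr e2, by rw [← integral_congr_ae e1, ← integral_congr_ae e2, h3]⟩

theorem HasFT.ae_eq {u u' F : Space n → ℂ} (hu : LocallyIntegrable u volume)
    (hu' : LocallyIntegrable u' volume) (h : HasFT u F) (h' : HasFT u' F) : u =ᵐ[volume] u' := by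
  refine ae_eq_of_integral_contDiff_smul_eq hu hu' fun g g_smooth g_cpt => ?_
  have hg₁ : HasCompactSupport (Complex.ofRealCLM ∘ g) := g_cpt.comp_left rfl
  have hg₂ : ContDiff ℝ (⊤ : ℕ∞) (Complex.ofRealCLM ∘ g) :=
    Complex.ofRealCLM.contDiff.comp g_smooth
  set ψ : 𝓢(Space n, ℂ) := hg₁.toSchwartzMap hg₂ with hψ
  have h1 := (h (𝓕⁻ ψ)).2.2
  have h2 := (h' (𝓕⁻ ψ)).2.2
  rw [← h2, fourier_fourierInv_eq] at h1
  simpa [hψ] using h1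

theorem IsFT.unique {T T' : Distr n} {G : Space n → ℂ} (h : IsFT T G) (h' : IsFT T' G) :
    T = T' := by
  ext φ
  have := (h (𝓕⁻ φ)).2.trans (h' (𝓕⁻ φ)).2.symm
  rwa [fourier_fourierInv_eq] at this

theorem HasFT.isFT {p : ℝ≥0∞} [Fact (1 ≤ p)] {u : Lp ℂ p (volume : Measure (Space n))}
    {F : Space n → ℂ} (h : HasFT u F) : IsFT (u : Distr n) F := fun φ => by
  refine ⟨(h φ).2.1, ?_⟩
  rw [Lp.toTemperedDistribution_apply, ← (h φ).2.2]
  rfl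

theorem continuous_neg_inner :
    Continuous fun p : Space n × Space n => (-innerₗ (Space n)) p.1 p.2 := by
  change Continuous fun p : Space n × Space n => -inner ℝ p.1 p.2
  fun_prop

theorem continuous_fourierInv {F : Space n → ℂ} (hF : Integrable F) : Continuous (𝓕⁻ F) :=
  VectorFourier.fourierIntegral_continuous Real.continuous_fourierChar continuous_neg_inner hF

theorem norm_fourierInv_le (F : Space n → ℂ) (x : Space n) : ‖𝓕⁻ F x‖ ≤ ∫ ξ, ‖F ξ‖ :=
  VectorFourier.norm_fourierIntegral_le_integral_norm _ _ _ _ _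

/-- Fubini's multiplication formula, applied with the kernel of the inverse transform. -/
theorem hasFT_fourierInv {F : Space n → ℂ} (hF : Integrable F) : HasFT (𝓕⁻ F) F := fun φ => by
  refine ⟨((𝓕 φ).integrable).mul_bdd (continuous_fourierInv hF).aestronglyMeasurable
      (Eventually.of_forall (norm_fourierInv_le F)),
    hF.bdd_mul φ.continuous.aestronglyMeasurable (c := ‖φ.toBoundedContinuousFunction‖)
      (Eventually.of_forall fun ξ => φ.toBoundedContinuousFunction.norm_coe_le_norm ξ), ?_⟩
  set ψ : 𝓢(Space n, ℂ) := 𝓕 φ with hψ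
  have h := VectorFourier.integral_fourierIntegral_smul_eq_flip (μ := volume) (ν := volume)
    (e := Real.fourierChar) (L := -innerₗ (Space n)) (f := F) (g := ψ)
    Real.continuous_fourierChar continuous_neg_inner hF ψ.integrable
  have h2 : ∀ x, VectorFourier.fourierIntegral Real.fourierChar volume (-innerₗ (Space n)).flip
      ψ x = φ x := by
    intro x
    have e1 : (-innerₗ (Space n)).flip = -innerₗ (Space n) := by
      ext a b; simp [real_inner_comm]
    rw [e1]
    change 𝓕⁻ (⇑ψ) x = φ x
    rw [← SchwartzMap.fourierInv_coe, hψ, fourierInv_fourier_eq]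
  simp only [h2, smul_eq_mul] at h
  calc _ = ∫ x, 𝓕⁻ F x * ψ x := by simp only [mul_comm]
    _ = _ := h
    _ = _ := by simp only [mul_comm]

theorem hasFT_fourier (φ : 𝓢(Space n, ℂ)) :
    HasFT (⇑(𝓕 φ : 𝓢(Space n, ℂ))) fun ξ => φ (-ξ) := by
  have h : Integrable fun ξ => φ (-ξ) := φ.integrable.comp_neg
  have := hasFT_fourierInv h
  rwa [show 𝓕⁻ (fun ξ => φ (-ξ)) = ⇑(𝓕 φ : 𝓢(Space n, ℂ)) by
    rw [SchwartzMap.fourier_coe, Real.fourierInv_eq_fourier_comp_neg]; simp] at this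

theorem exists_hasFT_of_memLp_two {F : Space n → ℂ} (hF : MemLp F 2 volume) :
    ∃ u : Lp ℂ 2 (volume : Measure (Space n)), HasFT u F ∧ ‖u‖ = ‖hF.toLp F‖ := by
  set v : Lp ℂ 2 (volume : Measure (Space n)) := hF.toLp F with hv
  set u : Lp ℂ 2 (volume : Measure (Space n)) := 𝓕⁻ v with hu
  have huv : 𝓕 u = v := fourier_fourierInv_eq v
  have hn : ‖u‖ = ‖v‖ := by rw [← huv, Lp.norm_fourier_eq]
  refine ⟨u, fun φ => ⟨?_, ?_, ?_⟩, hn⟩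
  · exact ((𝓕 φ).memLp 2).integrable_mul (Lp.memLp u)
  · exact (φ.memLp 2).integrable_mul hF
  · have h := Lp.fourier_toTemperedDistribution_eq u
    rw [huv] at h
    have h1 := DFunLike.congr_fun h φ
    rw [TemperedDistribution.fourier_apply, Lp.toTemperedDistribution_apply,
      Lp.toTemperedDistribution_apply] at h1
    simp only [smul_eq_mul] at h1
    rw [h1]
    refine integral_congr_ae ?_
    filter_upwards [hF.coeFn_toLp] with x hx
    rw [hx]

end FourierPairs

/-! ### Fourier transforms of weighted square integrable functions -/

section WeakType

open FourierTransform

variable {n : ℕ}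

theorem lintegral_Ioc_rpow {Λ e : ℝ} (hΛ : 0 ≤ Λ) (he : -1 < e) :
    ∫⁻ t in Set.Ioc 0 Λ, ENNReal.ofReal (t ^ e) = ENNReal.ofReal (Λ ^ (e + 1) / (e + 1)) := by
  have hint : IntegrableOn (fun t : ℝ => t ^ e) (Set.Ioc 0 Λ) :=
    (intervalIntegrable_iff_integrableOn_Ioc_of_le hΛ).1 (intervalIntegral.intervalIntegrable_rpow' he)
  rw [← ofReal_integral_eq_lintegral_ofReal hint]
  · rw [← intervalIntegral.integral_of_le hΛ, integral_rpow (Or.inl he),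
      Real.zero_rpow (by linarith), sub_zero]
  · filter_upwards [ae_restrict_mem measurableSet_Ioc] with t ht
    exact Real.rpow_nonneg ht.1.le _

theorem lintegral_Ioi_rpow {A e : ℝ} (hA : 0 < A) (he : e < -1) :
    ∫⁻ t in Set.Ioi A, ENNReal.ofReal (t ^ e) = ENNReal.ofReal (A ^ (e + 1) / -(e + 1)) := by
  rw [← ofReal_integral_eq_lintegral_ofReal (integrableOn_Ioi_rpow_of_lt he hA)]
  · rw [integral_Ioi_rpow_of_lt he hA, neg_div, div_neg]
  · filter_upwards [ae_restrict_mem measurableSet_Ioi] with t ht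
    exact Real.rpow_nonneg (hA.trans ht).le _

variable {w : Space n → ℝ} {θ B : ℝ}

/-- Layer cake formula: levels below `A` all see the set `{w > A}`, levels above `A` see the weak
type tail, which is square integrable because its exponent exceeds `2`. -/
theorem lintegral_sq_tail_le (hw : Measurable w) (hw0 : ∀ ξ, 0 ≤ w ξ) (hθ : 0 < θ) (hB : 0 ≤ B)
    (hwB : ∀ t, 0 < t → volume {ξ | t < w ξ} ≤ ENNReal.ofReal (B * t ^ (-(2 + 2 * θ))))
    {A : ℝ} (hA : 0 < A) :
    ∫⁻ ξ, ENNReal.ofReal ({ξ | A < w ξ}.indicator w ξ ^ (2 : ℝ)) ≤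
      ENNReal.ofReal ((2 * B + B / θ) * A ^ (-(2 * θ))) := by
  have hS : MeasurableSet {ξ | A < w ξ} := measurableSet_lt measurable_const hw
  rw [lintegral_rpow_eq_lintegral_meas_lt_mul _
    (Eventually.of_forall fun ξ => Set.indicator_nonneg (fun ξ _ => hw0 ξ) ξ)
    (hw.indicator hS).aemeasurable two_pos]
  have hmeas : ∀ t, 0 < t → volume {ξ | t < {ξ | A < w ξ}.indicator w ξ} ≤
      ENNReal.ofReal (B * (max t A) ^ (-(2 + 2 * θ))) := by
    intro t ht
    refine le_trans (measure_mono fun ξ hξ => ?_) (hwB (max t A) (lt_max_of_lt_left ht))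
    by_cases h : A < w ξ
    · have : t < w ξ := by simpa [Set.indicator, h] using hξ
      exact max_lt this h
    · exfalso
      have : t < 0 := by simpa [Set.indicator, h] using hξ
      linarith
  have h1 : ∫⁻ t in Set.Ioc 0 A, volume {ξ | t < {ξ | A < w ξ}.indicator w ξ} *
      ENNReal.ofReal (t ^ ((2 : ℝ) - 1)) ≤ ENNReal.ofReal (B * A ^ (-(2 * θ))) := by
    calc _ ≤ ∫⁻ _t in Set.Ioc 0 A, ENNReal.ofReal (B * A ^ (-(2 + 2 * θ)) * A) := by
          refine setLIntegral_mono' measurableSet_Ioc fun t ht => ?_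
          rw [ENNReal.ofReal_mul (by positivity)]
          gcongr
          · refine (hmeas t ht.1).trans ?_
            rw [max_eq_right ht.2]
          · norm_num
            exact ht.2
      _ = ENNReal.ofReal (B * A ^ (-(2 * θ))) := by
          rw [setLIntegral_const, Real.volume_Ioc, sub_zero, ← ENNReal.ofReal_mul (by positivity)]
          congr 1
          rw [show -(2 * θ) = -(2 + 2 * θ) + 1 + 1 by ring, Real.rpow_add hA, Real.rpow_add hA,
            Real.rpow_one]
          ring
  have h2 : ∫⁻ t in Set.Ioi A, volume {ξ | t < {ξ | A < w ξ}.indicator w ξ} *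
      ENNReal.ofReal (t ^ ((2 : ℝ) - 1)) ≤ ENNReal.ofReal (B * (A ^ (-(2 * θ)) / (2 * θ))) := by
    calc _ ≤ ∫⁻ t in Set.Ioi A, ENNReal.ofReal B * ENNReal.ofReal (t ^ (-(1 + 2 * θ))) := by
          refine setLIntegral_mono' measurableSet_Ioi fun t ht => ?_
          have ht0 : 0 < t := hA.trans ht
          refine (mul_le_mul_left (hmeas t ht0) _).trans (le_of_eq ?_)
          rw [max_eq_left (le_of_lt ht), ← ENNReal.ofReal_mul (by positivity),
            ← ENNReal.ofReal_mul hB, mul_assoc, ← Real.rpow_add ht0]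
          congr 3
          ring
      _ = _ := by
          rw [lintegral_const_mul' _ _ ENNReal.ofReal_ne_top, lintegral_Ioi_rpow hA (by linarith),
            ← ENNReal.ofReal_mul hB]
          congr 3
          · congr 1; ring
          · ring
  rw [← Set.Ioc_union_Ioi_eq_Ioi hA.le]
  calc _ ≤ ENNReal.ofReal 2 * (ENNReal.ofReal (B * A ^ (-(2 * θ))) +
        ENNReal.ofReal (B * (A ^ (-(2 * θ)) / (2 * θ)))) := by
        gcongr
        exact (lintegral_union_le _ _ _).trans (add_le_add h1 h2)
    _ = _ := by
        rw [← ENNReal.ofReal_add (by positivity) (by positivity), ← ENNReal.ofReal_mul two_pos.le]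
        congr 1
        field_simp

theorem eLpNorm_two_rpow (f : Space n → ℂ) :
    eLpNorm f 2 volume ^ (2 : ℝ) = ∫⁻ ξ, ‖f ξ‖ₑ ^ (2 : ℝ) := by
  have := eLpNorm_nnreal_pow_eq_lintegral (f := f) (μ := volume) (p := 2) two_ne_zero
  simpa using this

theorem integrable_high (hw : Measurable w) (hw0 : ∀ ξ, 0 ≤ w ξ) (hθ : 0 < θ) (hB : 0 ≤ B)
    (hwB : ∀ t, 0 < t → volume {ξ | t < w ξ} ≤ ENNReal.ofReal (B * t ^ (-(2 + 2 * θ))))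
    {h : Space n → ℂ} (hh : Measurable h) {H : ℝ} (hH : 0 ≤ H)
    (hhH : ∫⁻ ξ, ‖h ξ‖ₑ ^ (2 : ℝ) ≤ ENNReal.ofReal (H ^ (2 : ℝ))) {A : ℝ} (hA : 0 < A) :
    Integrable ({ξ | A < w ξ}.indicator fun ξ => (w ξ : ℂ) * h ξ) ∧
      ∫ ξ, ‖{ξ | A < w ξ}.indicator (fun ξ => (w ξ : ℂ) * h ξ) ξ‖ ≤
        Real.sqrt (2 * B + B / θ) * A ^ (-θ) * H := by
  have hS : MeasurableSet {ξ | A < w ξ} := measurableSet_lt measurable_const hw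
  have hD : 0 ≤ 2 * B + B / θ := by positivity
  have hm : Measurable ({ξ | A < w ξ}.indicator fun ξ => (w ξ : ℂ) * h ξ) :=
    ((Complex.measurable_ofReal.comp hw).mul hh).indicator hS
  have key : ∫⁻ ξ, ‖{ξ | A < w ξ}.indicator (fun ξ => (w ξ : ℂ) * h ξ) ξ‖ₑ ≤
      ENNReal.ofReal (Real.sqrt (2 * B + B / θ) * A ^ (-θ) * H) := by
    calc _ = ∫⁻ ξ, ((fun ξ => ENNReal.ofReal ({ξ | A < w ξ}.indicator w ξ)) *
          fun ξ => ‖h ξ‖ₑ) ξ := by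
          refine lintegral_congr fun ξ => ?_
          by_cases hξ : A < w ξ
          · simp only [Set.indicator, Set.mem_ofPred_eq, hξ, if_true, Pi.mul_apply, enorm_mul]
            rw [← ofReal_norm, Complex.norm_real, Real.norm_of_nonneg (hw0 ξ)]
          · simp [Set.indicator, hξ]
      _ ≤ _ := ENNReal.lintegral_mul_le_Lp_mul_Lq _ Real.HolderConjugate.two_two
          (hw.indicator hS).ennreal_ofReal.aemeasurable hh.enorm.aemeasurable
      _ ≤ ENNReal.ofReal ((2 * B + B / θ) * A ^ (-(2 * θ))) ^ (1 / 2 : ℝ) *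
          ENNReal.ofReal (H ^ (2 : ℝ)) ^ (1 / 2 : ℝ) := by
          gcongr
          refine le_trans (le_of_eq (lintegral_congr fun ξ => ?_))
            (lintegral_sq_tail_le hw hw0 hθ hB hwB hA)
          exact ENNReal.ofReal_rpow_of_nonneg (Set.indicator_nonneg (fun ξ _ => hw0 ξ) ξ) two_pos.le
      _ = _ := by
          rw [ENNReal.ofReal_rpow_of_nonneg (by positivity) (by norm_num),
            ENNReal.ofReal_rpow_of_nonneg (by positivity) (by norm_num),
            ← ENNReal.ofReal_mul (by positivity)]
          congr 1
          rw [Real.mul_rpow hD (by positivity), ← Real.sqrt_eq_rpow, ← Real.rpow_mul hA.le,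
            ← Real.rpow_mul hH]
          rw [show -(2 * θ) * (1 / 2) = -θ by ring, show (2 : ℝ) * (1 / 2) = 1 by norm_num,
            Real.rpow_one]
  have hi : Integrable ({ξ | A < w ξ}.indicator fun ξ => (w ξ : ℂ) * h ξ) :=
    ⟨hm.aestronglyMeasurable, lt_of_le_of_lt key ENNReal.ofReal_lt_top⟩
  refine ⟨hi, ?_⟩
  rw [integral_norm_eq_lintegral_enorm hm.aestronglyMeasurable]
  exact ENNReal.toReal_le_of_le_ofReal (by positivity) key

theorem memLp_low (hw : Measurable w) (hw0 : ∀ ξ, 0 ≤ w ξ) {h : Space n → ℂ} (hh : Measurable h)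
    {H : ℝ} (hhH : ∫⁻ ξ, ‖h ξ‖ₑ ^ (2 : ℝ) ≤ ENNReal.ofReal (H ^ (2 : ℝ))) (A : ℝ) :
    MemLp ({ξ | A < w ξ}ᶜ.indicator fun ξ => (w ξ : ℂ) * h ξ) 2 volume := by
  have hS : MeasurableSet {ξ | A < w ξ} := measurableSet_lt measurable_const hw
  have hh2 : MemLp h 2 volume := by
    refine ⟨hh.aestronglyMeasurable, ?_⟩
    have h2 := (eLpNorm_two_rpow h).trans_le hhH
    by_contra hcon
    rw [not_lt, top_le_iff] at hcon
    rw [hcon, ENNReal.top_rpow_of_pos two_pos, top_le_iff] at h2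
    exact ENNReal.ofReal_ne_top h2
  refine MemLp.of_le_mul (c := |A|) hh2
    (((Complex.measurable_ofReal.comp hw).mul hh).indicator hS.compl).aestronglyMeasurable
    (Eventually.of_forall fun ξ => ?_)
  by_cases hξ : A < w ξ
  · simp only [Set.indicator, Set.mem_compl_iff, Set.mem_ofPred_eq, hξ, not_true_eq_false, if_false,
      norm_zero]
    positivity
  · simp only [Set.indicator, Set.mem_compl_iff, Set.mem_ofPred_eq, hξ, not_false_eq_true, if_true,
      norm_mul, Complex.norm_real, Real.norm_of_nonneg (hw0 ξ)]
    gcongr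
    exact (not_lt.1 hξ).trans (le_abs_self A)

theorem meas_lt_norm_le {u₁ u₂ u F₂ : Space n → ℂ} {l : ℝ} (hl : 0 < l)
    (hu : u =ᵐ[volume] fun x => u₁ x + u₂ x) (hu₁ : ∀ x, ‖u₁ x‖ ≤ l / 2)
    (hu₂m : AEStronglyMeasurable u₂ volume)
    (hu₂ : ∫⁻ x, ‖u₂ x‖ₑ ^ (2 : ℝ) = ∫⁻ ξ, ‖F₂ ξ‖ₑ ^ (2 : ℝ)) :
    volume {x | l < ‖u x‖} ≤ ENNReal.ofReal (4 * l ^ (-2 : ℝ)) * ∫⁻ ξ, ‖F₂ ξ‖ₑ ^ (2 : ℝ) := by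
  have h1 : volume {x | l < ‖u x‖} ≤
      volume {x | ENNReal.ofReal ((l / 2) ^ (2 : ℝ)) ≤ ‖u₂ x‖ₑ ^ (2 : ℝ)} := by
    refine measure_mono_ae ?_
    filter_upwards [hu] with x hx hlx
    change ENNReal.ofReal ((l / 2) ^ (2 : ℝ)) ≤ ‖u₂ x‖ₑ ^ (2 : ℝ)
    have hlx' : l < ‖u x‖ := hlx
    rw [← ENNReal.ofReal_rpow_of_nonneg (by positivity) two_pos.le]
    gcongr
    rw [← ofReal_norm]
    refine ENNReal.ofReal_le_ofReal ?_
    rw [hx] at hlx'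
    have := norm_add_le (u₁ x) (u₂ x)
    linarith [hu₁ x]
  have h2 := mul_meas_ge_le_lintegral₀ (μ := volume) (f := fun x => ‖u₂ x‖ₑ ^ (2 : ℝ))
    (hu₂m.enorm.pow_const 2) (ENNReal.ofReal ((l / 2) ^ (2 : ℝ)))
  rw [hu₂] at h2
  have h3 : ENNReal.ofReal (4 * l ^ (-2 : ℝ)) * ENNReal.ofReal ((l / 2) ^ (2 : ℝ)) = 1 := by
    rw [← ENNReal.ofReal_mul (by positivity), Real.div_rpow hl.le two_pos.le, mul_assoc,
      mul_div_assoc', ← Real.rpow_add hl]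
    norm_num
  calc _ ≤ _ := h1
    _ = ENNReal.ofReal (4 * l ^ (-2 : ℝ)) * (ENNReal.ofReal ((l / 2) ^ (2 : ℝ)) *
        volume {x | ENNReal.ofReal ((l / 2) ^ (2 : ℝ)) ≤ ‖u₂ x‖ₑ ^ (2 : ℝ)}) := by
        rw [← mul_assoc, h3, one_mul]
    _ ≤ _ := by gcongr

/-- At each level `l` the product `w h` is cut where `w` crosses a height depending on `l`. The high
part is integrable by Cauchy–Schwarz and has a transform of size at most `l / 2`; the low part is
square integrable and is treated by Plancherel and Chebyshev. -/
theorem exists_hasFT_layers (hw : Measurable w) (hw0 : ∀ ξ, 0 ≤ w ξ) (hθ : 0 < θ) (hB : 0 < B)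
    (hwB : ∀ t, 0 < t → volume {ξ | t < w ξ} ≤ ENNReal.ofReal (B * t ^ (-(2 + 2 * θ))))
    {h : Space n → ℂ} (hh : Measurable h) {H : ℝ} (hH : 0 < H)
    (hhH : ∫⁻ ξ, ‖h ξ‖ₑ ^ (2 : ℝ) ≤ ENNReal.ofReal (H ^ (2 : ℝ))) :
    ∃ u : Space n → ℂ, AEStronglyMeasurable u volume ∧ HasFT u (fun ξ => (w ξ : ℂ) * h ξ) ∧
      ∀ l, 0 < l → volume {x | l < ‖u x‖} ≤ ENNReal.ofReal (4 * l ^ (-2 : ℝ)) *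
        ∫⁻ ξ, ‖{ξ | (2 * Real.sqrt (2 * B + B / θ) * H / l) ^ (1 / θ) < w ξ}ᶜ.indicator
          (fun ξ => (w ξ : ℂ) * h ξ) ξ‖ₑ ^ (2 : ℝ) := by
  set F : Space n → ℂ := fun ξ => (w ξ : ℂ) * h ξ with hF
  have hD : 0 < 2 * B + B / θ := by positivity
  have split : ∀ A, 0 < A → ∃ u₁ u₂ : Space n → ℂ, (∀ x, ‖u₁ x‖ ≤
      Real.sqrt (2 * B + B / θ) * A ^ (-θ) * H) ∧ Continuous u₁ ∧ MemLp u₂ 2 volume ∧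
      ∫⁻ x, ‖u₂ x‖ₑ ^ (2 : ℝ) = ∫⁻ ξ, ‖{ξ | A < w ξ}ᶜ.indicator F ξ‖ₑ ^ (2 : ℝ) ∧
      HasFT (fun x => u₁ x + u₂ x) F := by
    intro A hA
    obtain ⟨h1, h1'⟩ := integrable_high hw hw0 hθ hB.le hwB hh hH.le hhH hA
    have h2 := memLp_low hw hw0 hh hhH A
    obtain ⟨u₂, hu₂, hn⟩ := exists_hasFT_of_memLp_two h2
    refine ⟨_, u₂, fun x => (norm_fourierInv_le _ x).trans h1', continuous_fourierInv h1,
      Lp.memLp u₂, ?_, ?_⟩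
    · rw [← eLpNorm_two_rpow, ← eLpNorm_two_rpow, ← Lp.enorm_def, ← ofReal_norm, hn,
        ofReal_norm, Lp.enorm_def, eLpNorm_congr_ae h2.coeFn_toLp]
    · refine ((hasFT_fourierInv h1).add hu₂).congr (ae_eq_refl _) (Eventually.of_forall fun ξ => ?_)
      exact congrFun (Set.indicator_self_add_compl {ξ | A < w ξ} F) ξ
  -- The cut at height `1` defines the function; every other cut represents it almost everywhere, by
  -- uniqueness of the Fourier transform.
  obtain ⟨v₁, v₂, -, hv₁, hv₂, -, hv⟩ := split 1 one_pos
  refine ⟨_, hv₁.aestronglyMeasurable.add hv₂.1, hv, fun l hl => ?_⟩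
  -- This `A` solves `√(2B + B/θ) · A^{-θ} · H = l / 2`.
  set A := (2 * Real.sqrt (2 * B + B / θ) * H / l) ^ (1 / θ) with hAdef
  have hA : 0 < A := by positivity
  obtain ⟨u₁, u₂, hu₁, hu₁c, hu₂, hu₂e, hu⟩ := split A hA
  refine meas_lt_norm_le hl (HasFT.ae_eq ?_ ?_ hv hu) (fun x => (hu₁ x).trans (le_of_eq ?_))
    hu₂.1 hu₂e
  · exact hv₁.locallyIntegrable.add (hv₂.locallyIntegrable one_le_two)
  · exact hu₁c.locallyIntegrable.add (hu₂.locallyIntegrable one_le_two)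
  · rw [hAdef, ← Real.rpow_mul (by positivity), mul_neg, one_div_mul_cancel hθ.ne',
      Real.rpow_neg_one]
    have := Real.sqrt_pos.2 hD
    field_simp

/-- A Paley type inequality for `w` in weak `L^{2+2θ}`, by Marcinkiewicz's argument. The layer
bounds are integrated against `l^{q-1}` and the integrals exchanged. For fixed `ξ` only levels `l ≤
K w(ξ)^{-θ}` remain; they yield a multiple of `w(ξ)^{-θ(q-2)} = w(ξ)^{-2}`, which cancels the weight
exactly for this `q`. -/
theorem exists_hasFT_weighted (hw : Measurable w) (hw0 : ∀ ξ, 0 ≤ w ξ) (hθ : 0 < θ) (hB : 0 < B)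
    (hwB : ∀ t, 0 < t → volume {ξ | t < w ξ} ≤ ENNReal.ofReal (B * t ^ (-(2 + 2 * θ))))
    {q : ℝ} (hq : q = 2 + 2 / θ) {h : Space n → ℂ} (hh : Measurable h) {H : ℝ} (hH : 0 < H)
    (hhH : ∫⁻ ξ, ‖h ξ‖ₑ ^ (2 : ℝ) ≤ ENNReal.ofReal (H ^ (2 : ℝ))) :
    ∃ u : Space n → ℂ, AEStronglyMeasurable u volume ∧ HasFT u (fun ξ => (w ξ : ℂ) * h ξ) ∧
      ∫⁻ x, ENNReal.ofReal (‖u x‖ ^ q) ≤ ENNReal.ofReal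
        (q * (4 * (2 * Real.sqrt (2 * B + B / θ)) ^ (q - 2) / (q - 2)) * H ^ q) := by
  obtain ⟨u, hum, hu, hlay⟩ := exists_hasFT_layers hw hw0 hθ hB hwB hh hH hhH
  refine ⟨u, hum, hu, ?_⟩
  have hq2 : 0 < q - 2 := by rw [hq, add_sub_cancel_left]; positivity
  have hθq : θ * (q - 2) = 2 := by rw [hq, add_sub_cancel_left]; field_simp
  have hD : 0 < 2 * B + B / θ := by positivity
  have hsD := Real.sqrt_pos.2 hD
  set K := 2 * Real.sqrt (2 * B + B / θ) * H with hK
  have hK0 : 0 < K := by positivity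
  set F : Space n → ℂ := fun ξ => (w ξ : ℂ) * h ξ with hF
  have hFm : Measurable F := (Complex.measurable_ofReal.comp hw).mul hh
  rw [lintegral_rpow_eq_lintegral_meas_lt_mul _ (Eventually.of_forall fun x => norm_nonneg _)
    hum.norm.aemeasurable (by linarith : 0 < q)]
  -- The truncated integrand is written as an indicator on the product space to make it jointly
  -- measurable, as Tonelli requires.
  set Φ : ℝ → Space n → ℝ≥0∞ := fun l ξ => {p : ℝ × Space n | (K / p.1) ^ (1 / θ) < w p.2}ᶜ.indicator
    (fun p => ENNReal.ofReal (4 * p.1 ^ (q - 3)) * ‖F p.2‖ₑ ^ (2 : ℝ)) (l, ξ) with hΦ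
  have hΦm : Measurable (Function.uncurry Φ) := by
    refine Measurable.indicator ?_ (measurableSet_lt ?_ (hw.comp measurable_snd)).compl
    · exact (((measurable_fst.pow_const _).const_mul _).ennreal_ofReal).mul
        ((hFm.comp measurable_snd).enorm.pow_const _)
    · exact (measurable_const.div measurable_fst).pow_const _
  have hΦ0 : ∀ l ξ, (K / l) ^ (1 / θ) < w ξ → Φ l ξ = 0 := fun l ξ hξ =>
    Set.indicator_of_notMem (s := {p : ℝ × Space n | (K / p.1) ^ (1 / θ) < w p.2}ᶜ)
      (show (l, ξ) ∉ _ from fun hmem => hmem hξ) _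
  have hΦ1 : ∀ l ξ, ¬(K / l) ^ (1 / θ) < w ξ →
      Φ l ξ = ENNReal.ofReal (4 * l ^ (q - 3)) * ‖F ξ‖ₑ ^ (2 : ℝ) := fun l ξ hξ =>
    Set.indicator_of_mem (s := {p : ℝ × Space n | (K / p.1) ^ (1 / θ) < w p.2}ᶜ)
      (show (l, ξ) ∈ _ from hξ) _
  have h1 : ∫⁻ l in Set.Ioi (0 : ℝ), volume {x | l < ‖u x‖} * ENNReal.ofReal (l ^ (q - 1)) ≤
      ∫⁻ l in Set.Ioi (0 : ℝ), ∫⁻ ξ, Φ l ξ := by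
    refine setLIntegral_mono' measurableSet_Ioi fun l hl => ?_
    have hl0 : (0 : ℝ) < l := hl
    calc _ ≤ ENNReal.ofReal (4 * l ^ (-2 : ℝ)) *
          (∫⁻ ξ, ‖{ξ | (K / l) ^ (1 / θ) < w ξ}ᶜ.indicator F ξ‖ₑ ^ (2 : ℝ)) *
            ENNReal.ofReal (l ^ (q - 1)) := by gcongr; exact hlay l hl0
      _ = ENNReal.ofReal (4 * l ^ (q - 3)) *
          (∫⁻ ξ, ‖{ξ | (K / l) ^ (1 / θ) < w ξ}ᶜ.indicator F ξ‖ₑ ^ (2 : ℝ)) := by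
          rw [mul_right_comm, ← ENNReal.ofReal_mul (by positivity), mul_assoc,
            ← Real.rpow_add hl0]
          congr 4; ring
      _ = ∫⁻ ξ, Φ l ξ := by
          rw [← lintegral_const_mul' _ _ ENNReal.ofReal_ne_top]
          refine lintegral_congr fun ξ => ?_
          by_cases hξ : (K / l) ^ (1 / θ) < w ξ
          · rw [hΦ0 l ξ hξ, Set.indicator_of_notMem (show ξ ∉ {ξ | (K / l) ^ (1 / θ) < w ξ}ᶜ from fun hmem => hmem hξ),
              enorm_zero,
              ENNReal.zero_rpow_of_pos two_pos, mul_zero]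
          · rw [hΦ1 l ξ hξ, Set.indicator_of_mem (show ξ ∈ _ from hξ)]
      _ ≤ _ := le_rfl
  have h2 : ∀ ξ, ∫⁻ l in Set.Ioi (0 : ℝ), Φ l ξ ≤
      ENNReal.ofReal (4 * K ^ (q - 2) / (q - 2)) * ‖h ξ‖ₑ ^ (2 : ℝ) := by
    intro ξ
    rcases (hw0 ξ).eq_or_lt with h0 | h0
    · have : ∀ l, Φ l ξ = 0 := fun l => by
        simp [hΦ, hF, Set.indicator, ← h0]
      simp [this]
    · calc _ ≤ ∫⁻ l in Set.Ioi (0 : ℝ), (Set.Ioc 0 (K * w ξ ^ (-θ))).indicator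
            (fun l => ENNReal.ofReal (l ^ (q - 3)) * (ENNReal.ofReal 4 * ‖F ξ‖ₑ ^ (2 : ℝ))) l := by
            refine setLIntegral_mono' measurableSet_Ioi fun l hl => ?_
            have hl0 : (0 : ℝ) < l := hl
            by_cases hξ : (K / l) ^ (1 / θ) < w ξ
            · rw [hΦ0 l ξ hξ]; exact zero_le
            · have hmem : l ∈ Set.Ioc 0 (K * w ξ ^ (-θ)) := by
                refine ⟨hl0, ?_⟩
                have h3 := Real.rpow_le_rpow h0.le (not_lt.1 hξ) hθ.le
                rw [← Real.rpow_mul (by positivity), one_div_mul_cancel hθ.ne', Real.rpow_one,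
                  le_div_iff₀ hl0] at h3
                rw [Real.rpow_neg h0.le, ← div_eq_mul_inv, le_div_iff₀ (by positivity), mul_comm]
                exact h3
              rw [Set.indicator_of_mem hmem, hΦ1 l ξ hξ, ENNReal.ofReal_mul (by norm_num)]
              exact le_of_eq (by ring)
        _ ≤ ∫⁻ l, (Set.Ioc 0 (K * w ξ ^ (-θ))).indicator
            (fun l => ENNReal.ofReal (l ^ (q - 3)) * (ENNReal.ofReal 4 * ‖F ξ‖ₑ ^ (2 : ℝ))) l :=
            setLIntegral_le_lintegral _ _
        _ = ENNReal.ofReal ((K * w ξ ^ (-θ)) ^ (q - 3 + 1) / (q - 3 + 1)) *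
            (ENNReal.ofReal 4 * ‖F ξ‖ₑ ^ (2 : ℝ)) := by
            rw [lintegral_indicator measurableSet_Ioc, lintegral_mul_const _
              (by fun_prop),
              lintegral_Ioc_rpow (by positivity) (by linarith)]
        _ = _ := by
            have e1 : ‖F ξ‖ₑ ^ (2 : ℝ) = ENNReal.ofReal (w ξ ^ (2 : ℝ)) * ‖h ξ‖ₑ ^ (2 : ℝ) := by
              rw [hF, enorm_mul, ENNReal.mul_rpow_of_nonneg _ _ two_pos.le,
                ← ofReal_norm (w ξ : ℂ), Complex.norm_real, Real.norm_of_nonneg h0.le,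
                ENNReal.ofReal_rpow_of_nonneg h0.le two_pos.le]
            have e2 : 0 ≤ (K * w ξ ^ (-θ)) ^ (q - 3 + 1) / (q - 3 + 1) := by
              rw [show q - 3 + 1 = q - 2 by ring]; positivity
            rw [e1, ← mul_assoc, ← mul_assoc, ← ENNReal.ofReal_mul e2,
              ← ENNReal.ofReal_mul (mul_nonneg e2 (by norm_num))]
            congr 2
            rw [show q - 3 + 1 = q - 2 by ring, Real.mul_rpow hK0.le (by positivity),
              ← Real.rpow_mul h0.le, neg_mul, hθq]
            have : w ξ ^ (-2 : ℝ) * w ξ ^ (2 : ℝ) = 1 := by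
              rw [← Real.rpow_add h0]; norm_num
            calc _ = 4 * K ^ (q - 2) / (q - 2) * (w ξ ^ (-2 : ℝ) * w ξ ^ (2 : ℝ)) := by ring
              _ = _ := by rw [this, mul_one]
  calc _ ≤ ENNReal.ofReal q * ∫⁻ l in Set.Ioi (0 : ℝ), ∫⁻ ξ, Φ l ξ := by gcongr
    _ = ENNReal.ofReal q * ∫⁻ ξ, ∫⁻ l in Set.Ioi (0 : ℝ), Φ l ξ := by
        rw [lintegral_lintegral_swap hΦm.aemeasurable]
    _ ≤ ENNReal.ofReal q * ∫⁻ ξ, ENNReal.ofReal (4 * K ^ (q - 2) / (q - 2)) * ‖h ξ‖ₑ ^ (2 : ℝ) := by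
        gcongr with ξ
        exact h2 ξ
    _ ≤ ENNReal.ofReal q * (ENNReal.ofReal (4 * K ^ (q - 2) / (q - 2)) *
        ENNReal.ofReal (H ^ (2 : ℝ))) := by
        rw [lintegral_const_mul' _ _ ENNReal.ofReal_ne_top]
        gcongr
    _ = _ := by
        have hq0 : 0 ≤ q := by linarith
        rw [← ENNReal.ofReal_mul (by positivity), ← ENNReal.ofReal_mul hq0]
        congr 1
        rw [hK, Real.mul_rpow (by positivity) hH.le, show H ^ q = H ^ (q - 2) * H ^ (2 : ℝ) by
          rw [← Real.rpow_add hH]; congr 1; ring]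
        ring

end WeakType

/-! ### Fourier multipliers from `L^p` to `L^q` -/

section Multipliers

open FourierTransform

variable {n : ℕ}

/-- The Fourier transform of `w h` is in `L^q` for `h` in `L²`, with norm at most `C ‖h‖`. -/
def WeightBound (w : Space n → ℝ) (q : ℝ≥0∞) [Fact (1 ≤ q)] (C : ℝ) : Prop :=
  ∀ h : Lp ℂ 2 (volume : Measure (Space n)), ∃ u : Lp ℂ q (volume : Measure (Space n)),
    HasFT u (fun ξ => (w ξ : ℂ) * h ξ) ∧ ‖u‖ ≤ C * ‖h‖

theorem hasFT_zero : HasFT (0 : Space n → ℂ) 0 := fun φ => by simp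

theorem weightBound_of_weakType {w : Space n → ℝ} {θ B : ℝ} (hw : Measurable w)
    (hw0 : ∀ ξ, 0 ≤ w ξ) (hθ : 0 < θ) (hB : 0 < B)
    (hwB : ∀ t, 0 < t → volume {ξ | t < w ξ} ≤ ENNReal.ofReal (B * t ^ (-(2 + 2 * θ))))
    {q : ℝ≥0∞} [Fact (1 ≤ q)] (hq : q = ENNReal.ofReal (2 + 2 / θ)) :
    ∃ C, 0 ≤ C ∧ WeightBound w q C := by
  set q' : ℝ := 2 + 2 / θ with hq'
  have hq0 : 0 < q' := by positivity
  have hq2 : 0 < q' - 2 := by rw [hq', add_sub_cancel_left]; positivity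
  set D : ℝ := q' * (4 * (2 * Real.sqrt (2 * B + B / θ)) ^ (q' - 2) / (q' - 2)) with hD
  have hD0 : 0 ≤ D := by positivity
  refine ⟨D ^ (1 / q'), by positivity, fun h => ?_⟩
  by_cases h0 : h = 0
  · refine ⟨0, hasFT_zero.congr (Lp.coeFn_zero _ _ _).symm ?_, by simp [h0]⟩
    rw [h0]
    filter_upwards [Lp.coeFn_zero ℂ 2 (volume : Measure (Space n))] with ξ hξ
    rw [hξ]; simp
  have hH : 0 < ‖h‖ := norm_pos_iff.2 h0
  obtain ⟨u, hum, hu, hun⟩ := exists_hasFT_weighted hw hw0 hθ hB hwB hq'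
    (Lp.stronglyMeasurable h).measurable hH (by
      rw [← eLpNorm_two_rpow, ← ENNReal.ofReal_rpow_of_nonneg hH.le two_pos.le,
        ofReal_norm, Lp.enorm_def])
  have hq0' : q ≠ 0 := by rw [hq]; simpa using hq0
  have hqt : q ≠ ∞ := by rw [hq]; exact ENNReal.ofReal_ne_top
  have hqr : q.toReal = q' := by rw [hq, ENNReal.toReal_ofReal hq0.le]
  have hn : eLpNorm u q volume ≤ ENNReal.ofReal (D ^ (1 / q') * ‖h‖) := by
    rw [eLpNorm_eq_lintegral_rpow_enorm_toReal hq0' hqt, hqr]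
    have e : ∫⁻ x, ‖u x‖ₑ ^ q' = ∫⁻ x, ENNReal.ofReal (‖u x‖ ^ q') :=
      lintegral_congr fun x => by
        rw [← ofReal_norm, ENNReal.ofReal_rpow_of_nonneg (norm_nonneg _) hq0.le]
    rw [e]
    calc _ ≤ ENNReal.ofReal (D * ‖h‖ ^ q') ^ (1 / q') := by gcongr
      _ = _ := by
        rw [ENNReal.ofReal_rpow_of_nonneg (by positivity) (by positivity),
          Real.mul_rpow hD0 (by positivity), ← Real.rpow_mul hH.le, mul_one_div_cancel hq0.ne',
          Real.rpow_one]
  have hmem : MemLp u q volume := ⟨hum, lt_of_le_of_lt hn ENNReal.ofReal_lt_top⟩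
  refine ⟨hmem.toLp u, hu.congr hmem.coeFn_toLp.symm (ae_eq_refl _), ?_⟩
  rw [Lp.norm_toLp]
  exact ENNReal.toReal_le_of_le_ofReal (by positivity) hn

theorem weightBound_one [Fact ((1 : ℝ≥0∞) ≤ 2)] : WeightBound (fun _ : Space n => 1) 2 1 := by
  intro h
  obtain ⟨u, hu, hn⟩ := exists_hasFT_of_memLp_two (Lp.memLp h)
  refine ⟨u, by simpa using hu, ?_⟩
  rw [hn, Lp.toLp_coeFn, one_mul]

theorem HasFT.lp_eq {q : ℝ≥0∞} [hq : Fact (1 ≤ q)] {u v : Lp ℂ q (volume : Measure (Space n))}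
    {F : Space n → ℂ} (hu : HasFT u F) (hv : HasFT v F) : u = v :=
  Lp.ext (HasFT.ae_eq ((Lp.memLp u).locallyIntegrable hq.out)
    ((Lp.memLp v).locallyIntegrable hq.out) hu hv)

/-- A function in `L^q` is determined by its Fourier transform, so the arbitrarily chosen `u`
depends linearly on `h`. -/
theorem WeightBound.exists_clm {w : Space n → ℝ} {q : ℝ≥0∞} [Fact (1 ≤ q)] {C : ℝ}
    (hw : WeightBound w q C) :
    ∃ T : Lp ℂ 2 (volume : Measure (Space n)) →L[ℂ] Lp ℂ q (volume : Measure (Space n)),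
      (∀ h, HasFT (T h) (fun ξ => (w ξ : ℂ) * h ξ)) ∧ ∀ h, ‖T h‖ ≤ C * ‖h‖ := by
  choose T hT hTn using hw
  let T' : Lp ℂ 2 (volume : Measure (Space n)) →ₗ[ℂ] Lp ℂ q (volume : Measure (Space n)) :=
    { toFun := T
      map_add' := fun a b => by
        refine (hT (a + b)).lp_eq (((hT a).add (hT b)).congr (Lp.coeFn_add _ _).symm ?_)
        filter_upwards [Lp.coeFn_add a b] with ξ hξ
        rw [hξ, Pi.add_apply, mul_add]
      map_smul' := fun c a => by
        refine (hT (c • a)).lp_eq (((hT a).const_mul c).congr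
          (Lp.coeFn_smul c (T a)).symm ?_)
        filter_upwards [Lp.coeFn_smul c a] with ξ hξ
        rw [hξ, Pi.smul_apply, smul_eq_mul, mul_left_comm] }
  exact ⟨T'.mkContinuous C hTn, hT, hTn⟩

theorem jb_rpow_eq (K : ℝ) (ξ : Space n) : jb ξ ^ K = (1 + ‖ξ‖ ^ 2) ^ (K / 2) := by
  rw [jb, Real.sqrt_eq_rpow, ← Real.rpow_mul (by positivity)]
  congr 1; ring

theorem jb_rpow_hasTemperateGrowth (K : ℝ) :
    (fun ξ : Space n => ((jb ξ ^ K : ℝ) : ℂ)).HasTemperateGrowth := by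
  simp only [jb_rpow_eq]
  have h2 : (fun ξ : Space n => (1 + ‖ξ‖ ^ 2) ^ (K / 2)).HasTemperateGrowth := by fun_prop
  fun_prop

theorem memLp_jb_mul_schwartz (K : ℝ) (φ : 𝓢(Space n, ℂ)) (p : ℝ≥0∞) :
    MemLp (fun ξ => ((jb ξ ^ K : ℝ) : ℂ) * φ ξ) p volume := by
  have := (SchwartzMap.smulLeftCLM ℂ (fun ξ : Space n => ((jb ξ ^ K : ℝ) : ℂ)) φ).memLp p volume
  refine this.ae_eq (Eventually.of_forall fun ξ => ?_)
  simp [SchwartzMap.smulLeftCLM_apply_apply (jb_rpow_hasTemperateGrowth K)]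

theorem integrable_jb_rpow {K : ℝ} (hK : (n : ℝ) < K) :
    Integrable (fun ξ : Space n => jb ξ ^ (-K)) := by
  have : (Module.finrank ℝ (Space n) : ℝ) < K := by simpa using hK
  refine (integrable_rpow_neg_one_add_norm_sq (μ := (volume : Measure (Space n))) this).congr
    (Eventually.of_forall fun ξ => ?_)
  simp only [jb_rpow_eq]

theorem memLp_two_jb_rpow {K : ℝ} (hK : (n : ℝ) < K) :
    MemLp (fun ξ : Space n => jb ξ ^ (-K)) 2 volume := by
  have hc : Continuous fun ξ : Space n => jb ξ ^ (-K) :=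
    continuous_jb.rpow_const fun ξ => Or.inl (jb_pos ξ).ne'
  rw [memLp_two_iff_integrable_sq_norm hc.aestronglyMeasurable]
  refine (integrable_jb_rpow (K := 2 * K) (by have : (0:ℝ) ≤ n := by positivity
                                              linarith)).congr (Eventually.of_forall fun ξ => ?_)
  have := jb_pos ξ
  change _ = ‖jb ξ ^ (-K)‖ ^ 2
  rw [Real.norm_of_nonneg (by positivity), ← Real.rpow_natCast, ← Real.rpow_mul this.le,
    Nat.cast_ofNat, neg_mul, mul_comm K]

/-- The adjoint of `T` evaluated at `g`: the pairing with `g` composed with `T` is a bounded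
functional on `L²`. -/
theorem exists_riesz_representation {p q : ℝ≥0∞} [Fact (1 ≤ p)] [Fact (1 ≤ q)]
    [ENNReal.HolderConjugate p q] {C : ℝ} (hC : 0 ≤ C)
    (T : Lp ℂ 2 (volume : Measure (Space n)) →L[ℂ] Lp ℂ q (volume : Measure (Space n)))
    (hT : ∀ h, ‖T h‖ ≤ C * ‖h‖) :
    ∃ D, 0 ≤ D ∧ ∀ g : Lp ℂ p (volume : Measure (Space n)),
      ∃ H : Lp ℂ 2 (volume : Measure (Space n)), ‖H‖ ≤ D * ‖g‖ ∧
        ∀ h, ∫ x, g x * T h x = ∫ ξ, h ξ * (starRingEnd ℂ) (H ξ) := by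
  let P := (ContinuousLinearMap.mul ℂ ℂ).lpPairing (volume : Measure (Space n)) p q
  refine ⟨‖P‖ * C, by positivity, fun g => ?_⟩
  let ℓ : StrongDual ℂ (Lp ℂ 2 (volume : Measure (Space n))) := (P g).comp T
  have hℓn : ‖ℓ‖ ≤ ‖P‖ * C * ‖g‖ := by
    refine ContinuousLinearMap.opNorm_le_bound _ (by positivity) fun h => ?_
    calc ‖P g (T h)‖ ≤ ‖P‖ * ‖g‖ * ‖T h‖ := P.le_opNorm₂ g (T h)
      _ ≤ ‖P‖ * ‖g‖ * (C * ‖h‖) := by gcongr; exact hT h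
      _ = _ := by ring
  refine ⟨(InnerProductSpace.toDual ℂ (Lp ℂ 2 (volume : Measure (Space n)))).symm ℓ, ?_,
    fun h => ?_⟩
  · rwa [LinearIsometryEquiv.norm_map]
  · have h1 := InnerProductSpace.toDual_symm_apply (x := h) (y := ℓ)
    rw [L2.inner_def] at h1
    have h2 : ℓ h = ∫ x, g x * T h x :=
      ContinuousLinearMap.lpPairing_eq_integral (ContinuousLinearMap.mul ℂ ℂ) g (T h)
    rw [← h2, ← h1]
    rfl

theorem memLp_two_schwartz_div {w : Space n → ℝ} (hw : Measurable w) {K C' : ℝ}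
    (hwpos : ∀ᵐ ξ, 0 < w ξ) (hwK : ∀ᵐ ξ, (w ξ)⁻¹ ≤ C' * jb ξ ^ K) (φ : 𝓢(Space n, ℂ)) :
    MemLp (fun ξ => φ ξ / (w ξ : ℂ)) 2 volume := by
  refine MemLp.of_le_mul (c := |C'|) (memLp_jb_mul_schwartz K φ 2)
    (φ.continuous.measurable.div (Complex.measurable_ofReal.comp hw)).aestronglyMeasurable ?_
  filter_upwards [hwpos, hwK] with ξ h1 h2
  have hJ := jb_pos ξ
  rw [norm_div, norm_mul, Complex.norm_real, Complex.norm_real, Real.norm_of_nonneg h1.le,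
    Real.norm_of_nonneg (by positivity), div_eq_mul_inv]
  calc _ ≤ ‖φ ξ‖ * (C' * jb ξ ^ K) := by gcongr
    _ ≤ ‖φ ξ‖ * (|C'| * jb ξ ^ K) := by gcongr; exact le_abs_self _
    _ = _ := by ring

/-- The dual form of the weight bound: `w ĝ` is in `L²` for `g ∈ L^p`. The reflection of `w` appears
because the transform of `𝓕 φ` is `φ(-ξ)`. -/
theorem exists_isFT_div_weight {p q : ℝ≥0∞} [Fact (1 ≤ p)] [hq1 : Fact (1 ≤ q)]
    [ENNReal.HolderConjugate p q] {w : Space n → ℝ} (hw : Measurable w) {C K C' : ℝ} (hC : 0 ≤ C)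
    (hwpos : ∀ᵐ ξ, 0 < w ξ) (hwK : ∀ᵐ ξ, (w ξ)⁻¹ ≤ C' * jb ξ ^ K)
    (hb : WeightBound (fun ξ => w (-ξ)) q C) :
    ∃ D, 0 ≤ D ∧ ∀ g : Lp ℂ p (volume : Measure (Space n)), ∃ H : Space n → ℂ,
      MemLp H 2 volume ∧ eLpNorm H 2 volume ≤ ENNReal.ofReal (D * ‖g‖) ∧
      IsFT (g : Distr n) (fun ξ => H ξ / w ξ) := by
  obtain ⟨T, hT, hTn⟩ := hb.exists_clm
  obtain ⟨D, hD, hDg⟩ := exists_riesz_representation (p := p) hC T hTn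
  refine ⟨D, hD, fun g => ?_⟩
  obtain ⟨H₀, hH₀n, hH₀⟩ := hDg g
  have hmp : MeasurePreserving (fun ξ : Space n => -ξ) volume volume :=
    Measure.measurePreserving_neg _
  have hHmem : MemLp (fun ξ => (starRingEnd ℂ) (H₀ (-ξ))) 2 volume :=
    ((Lp.memLp H₀).star).comp_measurePreserving hmp
  refine ⟨_, hHmem, ?_, fun φ => ?_⟩
  · have e : eLpNorm (fun ξ => (starRingEnd ℂ) (H₀ (-ξ))) 2 volume = eLpNorm H₀ 2 volume := by
      rw [← eLpNorm_comp_measurePreserving (Lp.aestronglyMeasurable H₀) hmp]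
      exact eLpNorm_congr_norm_ae (Eventually.of_forall fun ξ => by simp)
    rw [e, ← Lp.enorm_def, ← ofReal_norm]
    exact ENNReal.ofReal_le_ofReal hH₀n
  · have hφw := memLp_two_schwartz_div hw hwpos hwK φ
    have hφw' : MemLp (fun ξ => φ (-ξ) / (w (-ξ) : ℂ)) 2 volume := hφw.comp_measurePreserving hmp
    refine ⟨(hφw.integrable_mul hHmem).congr (Eventually.of_forall fun ξ => ?_), ?_⟩
    · simp only [Pi.mul_apply]; ring
    -- The operator applied to `φ(-ξ) / w(-ξ)` returns `𝓕 φ`, so the representation formula computes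
    -- the pairing of `g` with `𝓕 φ`.
    have hTh : HasFT (T (hφw'.toLp _)) fun ξ => φ (-ξ) := by
      refine (hT _).congr (ae_eq_refl _) ?_
      have hwpos' : ∀ᵐ ξ : Space n, 0 < w (-ξ) := hmp.quasiMeasurePreserving.ae hwpos
      filter_upwards [hφw'.coeFn_toLp, hwpos'] with ξ h1 h2
      rw [h1]
      have : (w (-ξ) : ℂ) ≠ 0 := by exact_mod_cast h2.ne'
      field_simp
    have hTφ := HasFT.ae_eq ((Lp.memLp (T (hφw'.toLp _))).locallyIntegrable hq1.out)
      ((𝓕 φ).integrable.locallyIntegrable) hTh (hasFT_fourier φ)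
    have e1 : (g : Distr n) (𝓕 φ) = ∫ x, g x * T (hφw'.toLp _) x := by
      rw [Lp.toTemperedDistribution_apply]
      refine integral_congr_ae ?_
      filter_upwards [hTφ] with x hx
      rw [hx, smul_eq_mul, mul_comm]
    rw [e1, hH₀, ← hmp.integral_comp (MeasurableEquiv.neg (Space n)).measurableEmbedding]
    refine integral_congr_ae ?_
    filter_upwards [hmp.quasiMeasurePreserving.ae hφw'.coeFn_toLp] with ξ h1
    rw [h1, neg_neg]
    ring

/-- Multipliers that are admissible with a bound `A` map `L^p` to `L^q`, with norm at most `C A`. -/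
def MultiplierBound (p q : ℝ≥0∞) [Fact (1 ≤ p)] [Fact (1 ≤ q)]
    (Adm : ℝ → (Space n → ℂ) → Prop) : Prop :=
  ∃ C : ℝ, 0 ≤ C ∧ ∀ g : Lp ℂ p (volume : Measure (Space n)), ∃ G : Space n → ℂ,
    (∃ K : ℝ, Integrable (fun ξ => ((jb ξ ^ (-K) : ℝ) : ℂ) * G ξ)) ∧ IsFT (g : Distr n) G ∧
    ∀ A, 0 ≤ A → ∀ M : Space n → ℂ, AEStronglyMeasurable M volume → Adm A M →
      ∃ u : Lp ℂ q (volume : Measure (Space n)), IsFT (u : Distr n) (fun ξ => M ξ * G ξ) ∧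
        ‖u‖ ≤ C * A * ‖g‖

/-- The `TT*` argument: `M ĝ = w · (M / w²) · (w ĝ)`, where `w ĝ ∈ L²` by duality, `M / w²` is
bounded by `A`, and multiplication by `w` followed by the inverse transform takes `L²` to `L^q`. -/
theorem multiplierBound_weight {p q : ℝ≥0∞} [Fact (1 ≤ p)] [Fact (1 ≤ q)]
    [ENNReal.HolderConjugate p q] {w : Space n → ℝ} (hw : Measurable w) {C₁ C₂ K C' : ℝ}
    (hC₁ : 0 ≤ C₁) (hC₂ : 0 ≤ C₂)
    (hwpos : ∀ᵐ ξ, 0 < w ξ) (hwK : ∀ᵐ ξ, (w ξ)⁻¹ ≤ C' * jb ξ ^ K)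
    (hb₁ : WeightBound w q C₁) (hb₂ : WeightBound (fun ξ => w (-ξ)) q C₂) :
    MultiplierBound p q fun A (M : Space n → ℂ) => ∀ᵐ ξ, ‖M ξ‖ ≤ A * w ξ ^ 2 := by
  obtain ⟨D, hD, hDg⟩ := exists_isFT_div_weight (p := p) hw hC₂ hwpos hwK hb₂
  refine ⟨C₁ * D, by positivity, fun g => ?_⟩
  obtain ⟨H, hH, hHn, hFT⟩ := hDg g
  have hwm : Measurable fun ξ => (w ξ : ℂ) := Complex.measurable_ofReal.comp hw
  refine ⟨_, ⟨K + n + 1, ?_⟩, hFT, fun A hA M hM hMA => ?_⟩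
  · have hd : MemLp (fun ξ => ((jb ξ ^ (-(K + n + 1)) : ℝ) : ℂ) / (w ξ : ℂ)) 2 volume := by
      have hc : Continuous fun ξ : Space n => jb ξ ^ (-(K + n + 1)) :=
        continuous_jb.rpow_const fun ξ => Or.inl (jb_pos ξ).ne'
      refine MemLp.of_le_mul (c := |C'|) (memLp_two_jb_rpow (n := n) (lt_add_one (n : ℝ)))
        ((Complex.measurable_ofReal.comp hc.measurable).div hwm).aestronglyMeasurable ?_
      filter_upwards [hwpos, hwK] with ξ h1 h2
      have hJ := jb_pos ξ
      rw [norm_div, Complex.norm_real, Complex.norm_real, Real.norm_of_nonneg h1.le,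
        Real.norm_of_nonneg (by positivity), Real.norm_of_nonneg (by positivity), div_eq_mul_inv]
      calc _ ≤ jb ξ ^ (-(K + n + 1)) * (C' * jb ξ ^ K) := by gcongr
        _ = C' * (jb ξ ^ (-(K + n + 1)) * jb ξ ^ K) := by ring
        _ = C' * jb ξ ^ (-((n : ℝ) + 1)) := by rw [← Real.rpow_add hJ]; congr 2; ring
        _ ≤ _ := by gcongr; exact le_abs_self _
    refine (hd.integrable_mul hH).congr (Eventually.of_forall fun ξ => ?_)
    simp only [Pi.mul_apply]; ring
  · have hh : MemLp (fun ξ => M ξ / (w ξ : ℂ) ^ 2 * H ξ) 2 volume := by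
      refine MemLp.of_le_mul (c := A) hH
        ((hM.aemeasurable.div (hwm.pow_const 2).aemeasurable).aestronglyMeasurable.mul hH.1) ?_
      filter_upwards [hMA, hwpos] with ξ h1 h2
      rw [norm_mul, norm_div, norm_pow, Complex.norm_real, Real.norm_of_nonneg h2.le]
      gcongr
      rwa [div_le_iff₀ (by positivity)]
    have hhn : ‖hh.toLp _‖ ≤ A * (D * ‖g‖) := by
      rw [Lp.norm_toLp]
      refine ENNReal.toReal_le_of_le_ofReal (by positivity) ?_
      rw [ENNReal.ofReal_mul hA]
      refine le_trans ?_ (mul_le_mul_right hHn _)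
      refine eLpNorm_le_mul_eLpNorm_of_ae_le_mul ?_ 2
      filter_upwards [hMA, hwpos] with ξ h1 h2
      rw [norm_mul, norm_div, norm_pow, Complex.norm_real, Real.norm_of_nonneg h2.le]
      gcongr
      rwa [div_le_iff₀ (by positivity)]
    obtain ⟨u, hu, hun⟩ := hb₁ (hh.toLp _)
    refine ⟨u, (hu.congr (ae_eq_refl _) ?_).isFT, ?_⟩
    · filter_upwards [hh.coeFn_toLp, hwpos] with ξ h1 h2
      rw [h1]
      have : (w ξ : ℂ) ≠ 0 := by exact_mod_cast h2.ne'
      field_simp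
    · calc _ ≤ _ := hun
        _ ≤ C₁ * (A * (D * ‖g‖)) := by gcongr
        _ = _ := by ring

theorem isFT_L1 (g : Lp ℂ 1 (volume : Measure (Space n))) :
    Continuous (𝓕 (g : Space n → ℂ)) ∧ (∀ ξ, ‖𝓕 (g : Space n → ℂ) ξ‖ ≤ ‖g‖) ∧
      IsFT (g : Distr n) (𝓕 (g : Space n → ℂ)) := by
  have hg : Integrable g := L1.integrable_coeFn g
  have hci : Continuous fun p : Space n × Space n => (innerₗ (Space n)) p.1 p.2 :=
    continuous_inner
  have hc : Continuous (𝓕 (g : Space n → ℂ)) :=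
    VectorFourier.fourierIntegral_continuous Real.continuous_fourierChar hci hg
  have hn : ∀ ξ, ‖𝓕 (g : Space n → ℂ) ξ‖ ≤ ‖g‖ := fun ξ => by
    rw [L1.norm_eq_integral_norm]
    exact VectorFourier.norm_fourierIntegral_le_integral_norm _ _ _ _ _
  refine ⟨hc, hn, fun φ => ⟨φ.integrable.mul_bdd hc.aestronglyMeasurable
    (Eventually.of_forall hn), ?_⟩⟩
  have h := VectorFourier.integral_fourierIntegral_smul_eq_flip (μ := volume) (ν := volume)
    (e := Real.fourierChar) (L := innerₗ (Space n)) (f := φ) (g := g)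
    Real.continuous_fourierChar hci φ.integrable hg
  rw [show (innerₗ (Space n)).flip = innerₗ (Space n) by ext a b; simp] at h
  rw [Lp.toTemperedDistribution_apply, SchwartzMap.fourier_coe]
  exact h

theorem multiplierBound_one_top [Fact ((1 : ℝ≥0∞) ≤ 1)] [Fact ((1 : ℝ≥0∞) ≤ ∞)] :
    MultiplierBound 1 ∞ fun A (M : Space n → ℂ) => Integrable M ∧ ∫ ξ, ‖M ξ‖ ≤ A := by
  refine ⟨1, zero_le_one, fun g => ?_⟩
  obtain ⟨hc, hn, hFT⟩ := isFT_L1 g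
  refine ⟨_, ⟨n + 1, ?_⟩, hFT, fun A hA M _ ⟨hM, hMA⟩ => ?_⟩
  · exact (integrable_jb_rpow (lt_add_one (n : ℝ))).ofReal.mul_bdd hc.aestronglyMeasurable
      (Eventually.of_forall hn)
  · have hMG : Integrable fun ξ => M ξ * 𝓕 (g : Space n → ℂ) ξ :=
      hM.mul_bdd hc.aestronglyMeasurable (Eventually.of_forall hn)
    have hb : ∀ x, ‖𝓕⁻ (fun ξ => M ξ * 𝓕 (g : Space n → ℂ) ξ) x‖ ≤ A * ‖g‖ := fun x => by
      refine (norm_fourierInv_le _ x).trans ?_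
      calc _ ≤ ∫ ξ, ‖M ξ‖ * ‖g‖ := by
            refine integral_mono hMG.norm (hM.norm.mul_const _) fun ξ => ?_
            simp only [norm_mul]
            gcongr
            exact hn ξ
        _ ≤ _ := by rw [integral_mul_const]; gcongr
    have hmem : MemLp (𝓕⁻ fun ξ => M ξ * 𝓕 (g : Space n → ℂ) ξ) ∞ volume :=
      memLp_top_of_bound (continuous_fourierInv hMG).aestronglyMeasurable _
        (Eventually.of_forall hb)
    refine ⟨hmem.toLp _, ((hasFT_fourierInv hMG).congr hmem.coeFn_toLp.symm
      (ae_eq_refl _)).isFT, ?_⟩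
    rw [Lp.norm_toLp, one_mul]
    refine ENNReal.toReal_le_of_le_ofReal (by positivity) ?_
    rw [eLpNorm_exponent_top]
    exact eLpNormEssSup_le_of_ae_bound (Eventually.of_forall hb)

end Multipliers

/-! ### Multipliers with finitely many singularities -/

section SingularWeights

variable {n : ℕ}

/-- If the sum exceeds `t`, some term exceeds `t / card Z`, so `ξ` lies in a ball around one of the
points, of radius proportional to `t^{-1/a}`. -/
theorem volume_lt_sum_rpow_le {Z : Finset (Space n)} (hZ : Z.Nonempty) {a : ℝ} (ha : 0 < a) :
    ∃ B : ℝ, 0 < B ∧ ∀ t, 0 < t → volume {ξ : Space n | t < ∑ z ∈ Z, ‖ξ - z‖ ^ (-a)} ≤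
      ENNReal.ofReal (B * t ^ (-(n / a))) := by
  obtain ⟨N, hN⟩ : ∃ N : ℝ, N = Z.card := ⟨_, rfl⟩
  have hcard : 0 < N := by rw [hN]; exact_mod_cast hZ.card_pos
  set v : ℝ := (volume (Metric.ball (0 : Space n) 1)).toReal with hv
  have hvt : volume (Metric.ball (0 : Space n) 1) = ENNReal.ofReal v :=
    (ENNReal.ofReal_toReal measure_ball_lt_top.ne).symm
  have hv0 : 0 < v := ENNReal.toReal_pos
    (Metric.measure_ball_pos _ _ one_pos).ne' measure_ball_lt_top.ne
  refine ⟨N * (N⁻¹ ^ (-(n / a)) * v), by positivity, fun t ht => ?_⟩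
  set s : ℝ := N⁻¹ * t with hs
  have hs0 : 0 < s := by positivity
  have hsub : {ξ : Space n | t < ∑ z ∈ Z, ‖ξ - z‖ ^ (-a)} ⊆
      ⋃ z ∈ Z, Metric.closedBall z (s ^ (-(1 / a))) := by
    intro ξ hξ
    have hξ' : t < ∑ z ∈ Z, ‖ξ - z‖ ^ (-a) := hξ
    by_contra hcon
    simp only [Set.mem_iUnion, Metric.mem_closedBall, dist_eq_norm, not_exists, not_le] at hcon
    have hle : ∑ z ∈ Z, ‖ξ - z‖ ^ (-a) ≤ ∑ _z ∈ Z, s := by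
      refine Finset.sum_le_sum fun z hz => ?_
      have h1 := (hcon z hz).le
      have h2 := Real.rpow_le_rpow_of_nonpos (by positivity) h1 (by linarith : -a ≤ 0)
      rwa [← Real.rpow_mul hs0.le, neg_mul_neg, one_div_mul_cancel ha.ne', Real.rpow_one] at h2
    rw [Finset.sum_const, nsmul_eq_mul, ← hN, hs, mul_inv_cancel_left₀ hcard.ne'] at hle
    exact absurd hξ' hle.not_gt
  calc _ ≤ ∑ z ∈ Z, volume (Metric.closedBall z (s ^ (-(1 / a)))) :=
        (measure_mono hsub).trans (measure_biUnion_finset_le _ _)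
    _ = ∑ _z ∈ Z, ENNReal.ofReal (s ^ (-(n / a)) * v) := by
        refine Finset.sum_congr rfl fun z _ => ?_
        rw [Measure.addHaar_closedBall _ _ (by positivity), hvt,
          ← ENNReal.ofReal_mul (by positivity)]
        congr 2
        rw [← Real.rpow_natCast, ← Real.rpow_mul hs0.le, finrank_euclideanSpace_fin]
        congr 1; ring
    _ = _ := by
        rw [Finset.sum_const, nsmul_eq_mul, ← ENNReal.ofReal_natCast, ← hN,
          ← ENNReal.ofReal_mul (by positivity), hs, Real.mul_rpow (by positivity) ht.le]
        congr 1; ring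

theorem measurable_sum_rpow (Z : Finset (Space n)) (a : ℝ) :
    Measurable fun ξ : Space n => ∑ z ∈ Z, ‖ξ - z‖ ^ a :=
  Finset.measurable_sum _ fun z _ => ((measurable_id.sub_const z).norm).pow_const a

theorem ae_ne_finset (hn : 0 < n) (Z : Finset (Space n)) : ∀ᵐ ξ : Space n, ∀ z ∈ Z, ξ ≠ z := by
  have : Nonempty (Fin n) := ⟨⟨0, hn⟩⟩
  rw [Finset.eventually_all]
  intro z _
  rw [ae_iff]
  simp

theorem MultiplierBound.mono {p q : ℝ≥0∞} [Fact (1 ≤ p)] [Fact (1 ≤ q)]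
    {Adm Adm' : ℝ → (Space n → ℂ) → Prop} (h : MultiplierBound p q Adm) {c : ℝ} (hc : 0 ≤ c)
    (hA : ∀ A, 0 ≤ A → ∀ M, Adm' A M → Adm (c * A) M) : MultiplierBound p q Adm' := by
  obtain ⟨C, hC, H⟩ := h
  refine ⟨C * c, by positivity, fun g => ?_⟩
  obtain ⟨G, hG, hFT, hM⟩ := H g
  refine ⟨G, hG, hFT, fun A hA0 M hm hadm => ?_⟩
  obtain ⟨u, hu, hun⟩ := hM (c * A) (by positivity) M hm (hA A hA0 M hadm)
  exact ⟨u, hu, hun.trans_eq (by ring)⟩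

/-- The weight carries half of the singularity, so that its square dominates the multiplier. It lies
in weak `L^{n/a}` with `n/a = 2 / (1/p - 1/q)`, and for conjugate exponents the Paley inequality
then lands exactly in `L^q`. -/
theorem multiplierBound_singular (hn : 0 < n) {p q : ℝ≥0∞} [Fact (1 ≤ p)] [Fact (1 ≤ q)]
    (hp1 : 1 < p) (hp2 : p ≤ 2) (hpq : p⁻¹ + q⁻¹ = 1) {Z : Finset (Space n)} (hZ : Z.Nonempty) :
    MultiplierBound p q fun A (M : Space n → ℂ) => ∀ᵐ ξ, ‖M ξ‖ ≤
      A * ∑ z ∈ Z, ‖ξ - z‖ ^ (-((n : ℝ) * ((p⁻¹).toReal - (q⁻¹).toReal))) := by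
  have : ENNReal.HolderConjugate p q := ⟨by rw [hpq, inv_one]⟩
  have hp0 : p⁻¹ ≠ ∞ := ENNReal.inv_ne_top.2 (zero_lt_one.trans hp1).ne'
  have hpinv1 : p⁻¹ < 1 := ENNReal.inv_lt_one.2 hp1
  have hpinv2 : (2 : ℝ≥0∞)⁻¹ ≤ p⁻¹ := ENNReal.inv_le_inv.2 hp2
  have hq0 : q⁻¹ ≠ ∞ := fun h => by rw [h, add_top] at hpq; exact ENNReal.top_ne_one hpq
  set x := (p⁻¹).toReal with hx
  set y := (q⁻¹).toReal with hy
  have hxy : x + y = 1 := by rw [hx, hy, ← ENNReal.toReal_add hp0 hq0, hpq, ENNReal.toReal_one]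
  have hx1 : x < 1 := by
    have := ENNReal.toReal_strict_mono ENNReal.one_ne_top hpinv1
    rwa [ENNReal.toReal_one] at this
  have hx2 : 1 / 2 ≤ x := by
    have := ENNReal.toReal_mono hp0 hpinv2
    rwa [ENNReal.toReal_inv, ENNReal.toReal_ofNat, ← one_div] at this
  have hy0 : 0 < y := by linarith
  have hqy : q = ENNReal.ofReal y⁻¹ := by
    rw [ENNReal.ofReal_inv_of_pos hy0, hy, ENNReal.ofReal_toReal hq0, inv_inv]
  rcases hx2.eq_or_lt with h2 | h2
  -- For `p = 2` the singularity disappears, the sum of powers is the constant `card Z`, and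
  -- Plancherel suffices.
  · have hq2 : q = 2 := by rw [hqy, show y = 2⁻¹ by linarith, inv_inv]; simp
    subst hq2
    have h := multiplierBound_weight (p := p) (q := 2) (w := fun _ : Space n => 1)
      measurable_const (K := 0) (C' := 1) zero_le_one zero_le_one
      (Eventually.of_forall fun _ => one_pos)
      (Eventually.of_forall fun _ => by simp) weightBound_one weightBound_one
    refine h.mono (c := Z.card) (Nat.cast_nonneg _) fun A hA M hM => ?_
    filter_upwards [hM] with ξ hξ
    rw [show x - y = 0 by linarith, mul_zero, neg_zero] at hξ
    simp only [Real.rpow_zero, Finset.sum_const, nsmul_eq_mul, mul_one] at hξ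
    simpa [mul_comm] using hξ
  · set e := x - y with he
    have he0 : 0 < e := by linarith
    have hn0 : (0 : ℝ) < n := by exact_mod_cast hn
    set a : ℝ := n * e / 2 with ha
    have ha0 : 0 < a := by positivity
    -- Solves `n / a = 2 + 2θ`; since `x + y = 1`, also `2 + 2 / θ = 1 / y = q`.
    set θ : ℝ := 2 * y / e with hθ
    have hθ0 : 0 < θ := by positivity
    have hb : (n : ℝ) / a = 2 + 2 * θ := by
      rw [ha, hθ]; field_simp; linarith
    have hqθ : q = ENNReal.ofReal (2 + 2 / θ) := by
      rw [hqy]; congr 1; rw [hθ]; field_simp; linarith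
    obtain ⟨B, hB, hvol⟩ := volume_lt_sum_rpow_le hZ ha0
    rw [hb] at hvol
    set w : Space n → ℝ := fun ξ => ∑ z ∈ Z, ‖ξ - z‖ ^ (-a) with hw
    have hwm : Measurable w := measurable_sum_rpow Z (-a)
    have hw0 : ∀ ξ, 0 ≤ w ξ := fun ξ => Finset.sum_nonneg fun z _ => by positivity
    obtain ⟨C₁, hC₁, hb₁⟩ := weightBound_of_weakType hwm hw0 hθ0 hB hvol hqθ
    have hmp : MeasurePreserving (fun ξ : Space n => -ξ) volume volume :=
      Measure.measurePreserving_neg _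
    obtain ⟨C₂, hC₂, hb₂⟩ := weightBound_of_weakType (w := fun ξ => w (-ξ))
      (hwm.comp measurable_neg) (fun ξ => hw0 (-ξ)) hθ0 hB (fun t ht => by
        refine le_trans (le_of_eq ?_) (hvol t ht)
        exact hmp.measure_preimage (measurableSet_lt measurable_const hwm).nullMeasurableSet) hqθ
    obtain ⟨z₀, hz₀⟩ := hZ
    have hwz : ∀ ξ, ‖ξ - z₀‖ ^ (-a) ≤ w ξ := fun ξ =>
      Finset.single_le_sum (f := fun z => ‖ξ - z‖ ^ (-a)) (fun z _ => by positivity) hz₀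
    have hpos : ∀ᵐ ξ : Space n, 0 < ‖ξ - z₀‖ := by
      filter_upwards [ae_ne_finset hn Z] with ξ hξ
      exact norm_pos_iff.2 (sub_ne_zero.2 (hξ z₀ hz₀))
    have hwpos : ∀ᵐ ξ, 0 < w ξ := by
      filter_upwards [hpos] with ξ hξ
      exact lt_of_lt_of_le (by positivity) (hwz ξ)
    have hwK : ∀ᵐ ξ, (w ξ)⁻¹ ≤ (1 + ‖z₀‖) ^ a * jb ξ ^ a := by
      filter_upwards [hpos] with ξ hξ
      have hJ := jb_pos ξ
      calc (w ξ)⁻¹ ≤ (‖ξ - z₀‖ ^ (-a))⁻¹ := by gcongr; exact hwz ξ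
        _ = ‖ξ - z₀‖ ^ a := by rw [Real.rpow_neg hξ.le, inv_inv]
        _ ≤ ((1 + ‖z₀‖) * jb ξ) ^ a := by
            gcongr
            refine (norm_sub_le _ _).trans ?_
            nlinarith [norm_le_jb ξ, one_le_jb ξ, norm_nonneg z₀]
        _ = _ := Real.mul_rpow (by positivity) hJ.le
    refine (multiplierBound_weight (p := p) hwm hC₁ hC₂ hwpos hwK hb₁ hb₂).mono zero_le_one
      fun A hA M hM => ?_
    filter_upwards [hM] with ξ hξ
    rw [one_mul]
    refine hξ.trans ?_
    gcongr
    have e2 : ∀ z, ‖ξ - z‖ ^ (-((n : ℝ) * e)) = (‖ξ - z‖ ^ (-a)) ^ 2 := fun z => by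
      rw [← Real.rpow_natCast, ← Real.rpow_mul (norm_nonneg _), ha]
      congr 1; push_cast; ring
    simp only [e2]
    exact Finset.sum_sq_le_sq_sum_of_nonneg fun z _ => by positivity

end SingularWeights

/-! ### Decay of the solution multipliers -/

section Decay

variable {n m : ℕ}

theorem exists_one_add_rpow_mul_exp_le (ρ : ℝ) {c : ℝ} (hc : 0 < c) :
    ∃ C : ℝ, 0 < C ∧ ∀ y, 0 ≤ y → (1 + y) ^ ρ * Real.exp (-c * y) ≤ C := by
  set K := ⌈ρ⌉₊
  refine ⟨(K.factorial : ℝ) / c ^ K * Real.exp c, by positivity, fun y hy => ?_⟩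
  have h1 : (1 + y) ^ ρ ≤ (1 + y) ^ K := by
    rw [← Real.rpow_natCast]
    exact Real.rpow_le_rpow_of_exponent_le (by linarith) (Nat.le_ceil ρ)
  have h2 := Real.pow_div_factorial_le_exp (c * (1 + y)) (by positivity) K
  have hf : (0 : ℝ) < K.factorial := by exact_mod_cast K.factorial_pos
  rw [div_le_iff₀ hf, mul_pow] at h2
  have e1 : Real.exp (c * (1 + y)) * Real.exp (-c * y) = Real.exp c := by
    rw [← Real.exp_add]; congr 1; ring
  calc _ ≤ (1 + y) ^ K * Real.exp (-c * y) := by gcongr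
    _ = (c ^ K * (1 + y) ^ K) * Real.exp (-c * y) / c ^ K := by field_simp
    _ ≤ (Real.exp (c * (1 + y)) * K.factorial) * Real.exp (-c * y) / c ^ K := by gcongr
    _ = (Real.exp (c * (1 + y)) * Real.exp (-c * y)) * K.factorial / c ^ K := by ring
    _ = _ := by rw [e1]; ring

theorem bracket_pos (t : ℝ) : 0 < bracket t := Real.sqrt_pos.2 (by positivity)

theorem bracket_le {t : ℝ} (ht : 0 ≤ t) : bracket t ≤ 1 + t := by
  rw [bracket, Real.sqrt_le_left (by positivity)]; nlinarith

theorem bracket_rpow_neg_ge {ρ t : ℝ} (hρ : 0 ≤ ρ) (ht : 0 ≤ t) :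
    (1 + t) ^ (-ρ) ≤ bracket t ^ (-ρ) :=
  Real.rpow_le_rpow_of_nonpos (bracket_pos t) (bracket_le ht) (by linarith)

theorem exists_exp_le_bracket {ρ c : ℝ} (hρ : 0 ≤ ρ) (hc : 0 < c) :
    ∃ C : ℝ, 0 < C ∧ ∀ t, 0 ≤ t → Real.exp (-c * t) ≤ C * bracket t ^ (-ρ) := by
  obtain ⟨C, hC, h⟩ := exists_one_add_rpow_mul_exp_le ρ hc
  refine ⟨C, hC, fun t ht => ?_⟩
  have h1 := h t ht
  have h2 : 0 < (1 + t) ^ ρ := by positivity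
  calc Real.exp (-c * t) = ((1 + t) ^ ρ * Real.exp (-c * t)) * (1 + t) ^ (-ρ) := by
        rw [Real.rpow_neg (by positivity)]; field_simp
    _ ≤ C * (1 + t) ^ (-ρ) := by gcongr
    _ ≤ _ := mul_le_mul_of_nonneg_left (bracket_rpow_neg_ge hρ ht) hC.le

/-- For `x < 1` one has `(1 + t) x^s ≤ 1 + t x^s`, and `(1 + y)^ρ e^{-cy}` is bounded in `y = t
x^s`. Hence the power `x^{a+κ}` is converted into decay in time, at the price of the singularity
`x^{-a}`. -/
theorem exists_power_exp_le_bracket {a κ s c : ℝ} (ha : 0 ≤ a) (hκ : 0 ≤ κ) (hs : 0 < s)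
    (hc : 0 < c) : ∃ C : ℝ, 0 < C ∧ ∀ t x, 0 ≤ t → 0 < x → x < 1 →
      x ^ κ * Real.exp (-c * t * x ^ s) ≤ C * bracket t ^ (-((a + κ) / s)) * x ^ (-a) := by
  set ρ := (a + κ) / s with hρ
  have hρ0 : 0 ≤ ρ := by positivity
  obtain ⟨C, hC, h⟩ := exists_one_add_rpow_mul_exp_le ρ hc
  refine ⟨C, hC, fun t x ht hx hx1 => ?_⟩
  have hxs : 0 < x ^ s := by positivity
  have hxs1 : x ^ s ≤ 1 := Real.rpow_le_one hx.le hx1.le hs.le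
  have h1 := h (t * x ^ s) (by positivity)
  have e1 : x ^ (a + κ) = (x ^ s) ^ ρ := by
    rw [← Real.rpow_mul hx.le, hρ, mul_div_cancel₀ _ hs.ne']
  have h2 : x ^ (a + κ) * (1 + t) ^ ρ ≤ (1 + t * x ^ s) ^ ρ := by
    rw [e1, ← Real.mul_rpow hxs.le (by positivity)]
    gcongr
    nlinarith
  have h3 : x ^ (a + κ) * (1 + t) ^ ρ * Real.exp (-c * t * x ^ s) ≤ C := by
    refine le_trans ?_ h1
    rw [mul_assoc (-c)]
    gcongr
  have h4 : 0 < (1 + t) ^ ρ := by positivity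
  calc x ^ κ * Real.exp (-c * t * x ^ s)
      = (x ^ (a + κ) * (1 + t) ^ ρ * Real.exp (-c * t * x ^ s)) * (1 + t) ^ (-ρ) * x ^ (-a) := by
        rw [Real.rpow_add hx, Real.rpow_neg hx.le, Real.rpow_neg (by positivity)]
        have : 0 < x ^ a := by positivity
        field_simp
    _ ≤ C * (1 + t) ^ (-ρ) * x ^ (-a) := by gcongr
    _ ≤ _ := mul_le_mul_of_nonneg_right
        (mul_le_mul_of_nonneg_left (bracket_rpow_neg_ge hρ0 ht) hC.le) (by positivity)

/-- Adding the point `0` lets `|ξ|^{-a}` dominate `⟨ξ⟩^{-N}` as soon as `N ≥ a`. High frequencies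
are thus covered by the same multiplier theorem, and the endpoint `N = a` is reached without a
dyadic decomposition. -/
theorem exists_envelope_le_singular (Z : Finset (Space n)) {a κ s c δ N : ℝ} (ha : 0 ≤ a)
    (hκ : 0 ≤ κ) (hs : 0 < s) (hc : 0 < c) (hδ : 0 < δ) (hN : a ≤ N) :
    ∃ C : ℝ, 0 ≤ C ∧ ∀ t, 0 ≤ t → ∀ ξ : Space n, (∀ z ∈ insert 0 Z, ξ ≠ z) →
      envelope Z δ c κ s t ξ * jb ξ ^ (-N) ≤
        C * bracket t ^ (-((a + κ) / s)) * ∑ z ∈ insert 0 Z, ‖ξ - z‖ ^ (-a) := by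
  obtain ⟨C₁, hC₁, h₁⟩ := exists_exp_le_bracket (ρ := (a + κ) / s) (by positivity) hδ
  obtain ⟨C₂, hC₂, h₂⟩ := exists_power_exp_le_bracket ha hκ hs hc
  have hcard : (0 : ℝ) ≤ Z.card := Nat.cast_nonneg _
  refine ⟨C₁ + Z.card * C₂, by nlinarith, fun t ht ξ hξ => ?_⟩
  set S := ∑ z ∈ insert 0 Z, ‖ξ - z‖ ^ (-a) with hS
  have hSz : ∀ z ∈ insert 0 Z, ‖ξ - z‖ ^ (-a) ≤ S := fun z hz =>
    Finset.single_le_sum (f := fun z => ‖ξ - z‖ ^ (-a)) (fun z _ => by positivity) hz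
  have hξ0 : 0 < ‖ξ‖ := norm_pos_iff.2 (hξ 0 (Finset.mem_insert_self _ _))
  have hJ := jb_pos ξ
  have hb := bracket_pos t
  have hJN : jb ξ ^ (-N) ≤ S := by
    refine le_trans ?_ (hSz 0 (Finset.mem_insert_self _ _))
    rw [sub_zero]
    exact (Real.rpow_le_rpow_of_exponent_le (one_le_jb ξ) (by linarith)).trans
      (Real.rpow_le_rpow_of_nonpos hξ0 (norm_le_jb ξ) (by linarith))
  have hJ1 : jb ξ ^ (-N) ≤ 1 := Real.rpow_le_one_of_one_le_of_nonpos (one_le_jb ξ) (by linarith)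
  have hS0 : 0 ≤ S := le_trans (by positivity) hJN
  rw [envelope, add_mul, add_mul C₁, add_mul]
  refine add_le_add ?_ ?_
  · have := h₁ t ht
    gcongr
  · rw [Finset.sum_mul, mul_assoc, mul_assoc, ← nsmul_eq_mul, ← Finset.sum_const]
    refine Finset.sum_le_sum fun z hz => ?_
    have hz' : z ∈ insert 0 Z := Finset.mem_insert_of_mem hz
    have hzpos : 0 < ‖ξ - z‖ := norm_pos_iff.2 (sub_ne_zero.2 (hξ z hz'))
    split_ifs with h
    · calc _ ≤ (C₂ * bracket t ^ (-((a + κ) / s)) * ‖ξ - z‖ ^ (-a)) * 1 := by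
            exact mul_le_mul (h₂ t _ ht hzpos h) hJ1 (by positivity) (by positivity)
        _ ≤ _ := by
            rw [mul_one, mul_assoc]
            gcongr
            exact hSz z hz'
    · rw [zero_mul]
      exact mul_nonneg hC₂.le (mul_nonneg (Real.rpow_nonneg hb.le _) hS0)

theorem integrable_power_exp {κ s c : ℝ} (hκ : 0 ≤ κ) (hs : 0 < s) (hc : 0 < c) :
    Integrable fun x : Space n => ‖x‖ ^ κ * Real.exp (-c * ‖x‖ ^ s) := by
  obtain ⟨C, hC, h⟩ := exists_one_add_rpow_mul_exp_le ((κ + n + 1) / s) hc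
  have hint : Integrable fun x : Space n => (1 + ‖x‖) ^ (-((n : ℝ) + 1)) :=
    integrable_one_add_norm (by simp)
  have hcont : Continuous fun x : Space n => ‖x‖ ^ κ * Real.exp (-c * ‖x‖ ^ s) := by
    refine (continuous_norm.rpow_const fun x => Or.inr hκ).mul
      (Real.continuous_exp.comp (continuous_const.mul (continuous_norm.rpow_const fun x =>
        Or.inr hs.le)))
  refine (hint.const_mul (C * 2 ^ (κ + n + 1))).mono' hcont.aestronglyMeasurable
    (Eventually.of_forall fun x => ?_)
  have hx := norm_nonneg x
  rw [Real.norm_of_nonneg (by positivity)]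
  set y := ‖x‖
  have h1 := h (y ^ s) (by positivity)
  have h2 : ((1 + y) / 2) ^ s ≤ 1 + y ^ s := by
    rcases le_total y 1 with hy | hy
    · have : ((1 + y) / 2) ^ s ≤ 1 := Real.rpow_le_one (by positivity) (by linarith) hs.le
      have : 0 ≤ y ^ s := by positivity
      linarith
    · have : ((1 + y) / 2) ^ s ≤ y ^ s := by gcongr; linarith
      linarith
  have h3 : ((1 + y) / 2) ^ (κ + n + 1) ≤ (1 + y ^ s) ^ ((κ + n + 1) / s) := by
    calc _ = (((1 + y) / 2) ^ s) ^ ((κ + n + 1) / s) := by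
          rw [← Real.rpow_mul (by positivity), mul_div_cancel₀ _ hs.ne']
      _ ≤ _ := by gcongr
  have h4 : ((1 + y) / 2) ^ (κ + n + 1) * Real.exp (-c * y ^ s) ≤ C :=
    le_trans (by gcongr) h1
  rw [Real.div_rpow (by positivity) two_pos.le, div_mul_eq_mul_div, div_le_iff₀ (by positivity)]
    at h4
  have h5 : y ^ κ ≤ (1 + y) ^ κ := by gcongr; linarith
  calc y ^ κ * Real.exp (-c * y ^ s) ≤ (1 + y) ^ κ * Real.exp (-c * y ^ s) := by gcongr
    _ = ((1 + y) ^ (κ + n + 1) * Real.exp (-c * y ^ s)) * (1 + y) ^ (-((n : ℝ) + 1)) := by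
        rw [mul_right_comm, ← Real.rpow_add (by positivity)]; congr 2; ring
    _ ≤ _ := by gcongr

/-- Scaling by `(1 + t)^{1/s}` produces the rate `(n + κ) / s`. The factor `e^c` pays for replacing
`t` by `1 + t` where `|ξ-z| < 1`, so that small times are included. -/
theorem exists_integral_power_exp_le {κ s c : ℝ} (hκ : 0 ≤ κ) (hs : 0 < s) (hc : 0 < c) :
    ∃ C : ℝ, 0 ≤ C ∧ ∀ t, 0 ≤ t → ∀ z : Space n,
      Integrable (fun ξ : Space n =>
        if ‖ξ - z‖ < 1 then ‖ξ - z‖ ^ κ * Real.exp (-c * t * ‖ξ - z‖ ^ s) else 0) ∧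
      ∫ ξ : Space n, (if ‖ξ - z‖ < 1 then ‖ξ - z‖ ^ κ * Real.exp (-c * t * ‖ξ - z‖ ^ s) else 0) ≤
        C * bracket t ^ (-((n + κ) / s)) := by
  set f : Space n → ℝ := fun x => ‖x‖ ^ κ * Real.exp (-c * ‖x‖ ^ s) with hf
  have hfi : Integrable f := integrable_power_exp hκ hs hc
  have hf0 : ∀ x, 0 ≤ f x := fun x => by positivity
  have hI : 0 ≤ ∫ x, f x := integral_nonneg hf0
  refine ⟨Real.exp c * ∫ x, f x, by positivity, fun t ht z => ?_⟩
  set l : ℝ := (1 + t) ^ (1 / s) with hl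
  have hl0 : 0 < l := by positivity
  have hls : l ^ s = 1 + t := by
    rw [hl, ← Real.rpow_mul (by positivity), one_div_mul_cancel hs.ne', Real.rpow_one]
  have hgi : Integrable fun ξ : Space n => Real.exp c * l ^ (-κ) * f (l • (ξ - z)) :=
    (((integrable_comp_smul_iff volume f hl0.ne').2 hfi).comp_sub_right z).const_mul _
  have hle : ∀ ξ : Space n, (if ‖ξ - z‖ < 1 then
      ‖ξ - z‖ ^ κ * Real.exp (-c * t * ‖ξ - z‖ ^ s) else 0) ≤
      Real.exp c * l ^ (-κ) * f (l • (ξ - z)) := by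
    intro ξ
    split_ifs with h
    · set x := ‖ξ - z‖ with hx
      have hx0 : 0 ≤ x := norm_nonneg _
      have hx1 : x ^ s ≤ 1 := Real.rpow_le_one hx0 h.le hs.le
      have e1 : l ^ (-κ) * l ^ κ = 1 := by rw [← Real.rpow_add hl0]; simp
      have e2 : Real.exp c * l ^ (-κ) * f (l • (ξ - z)) =
          x ^ κ * Real.exp (c - c * ((1 + t) * x ^ s)) := by
        rw [hf]
        simp only [norm_smul, Real.norm_of_nonneg hl0.le, ← hx]
        rw [Real.mul_rpow hl0.le hx0, Real.mul_rpow hl0.le hx0, hls, sub_eq_add_neg, Real.exp_add,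
          neg_mul]
        calc _ = (l ^ (-κ) * l ^ κ) * (x ^ κ * (Real.exp c * Real.exp (-(c * ((1 + t) * x ^ s))))) := by
              ring
          _ = _ := by rw [e1, one_mul]
      rw [e2]
      gcongr
      nlinarith
    · have := hf0 (l • (ξ - z))
      positivity
  have hnn : ∀ ξ : Space n, 0 ≤ (if ‖ξ - z‖ < 1 then
      ‖ξ - z‖ ^ κ * Real.exp (-c * t * ‖ξ - z‖ ^ s) else 0) := fun ξ => by
    split_ifs <;> positivity
  have hmeas : Measurable (fun ξ : Space n => if ‖ξ - z‖ < 1 then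
      ‖ξ - z‖ ^ κ * Real.exp (-c * t * ‖ξ - z‖ ^ s) else 0) := by
    have hm : Measurable fun ξ : Space n => ‖ξ - z‖ := (measurable_id.sub_const z).norm
    exact Measurable.ite (measurableSet_lt hm measurable_const)
      ((hm.pow_const κ).mul (((hm.pow_const s).const_mul _).exp)) measurable_const
  have hi := hgi.mono' hmeas.aestronglyMeasurable (Eventually.of_forall fun ξ => by
    rw [Real.norm_of_nonneg (hnn ξ)]; exact hle ξ)
  refine ⟨hi, (integral_mono hi hgi hle).trans ?_⟩
  have hl' : 0 ≤ l := hl0.le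
  rw [integral_const_mul, integral_sub_right_eq_self (fun ξ => f (l • ξ)),
    Measure.integral_comp_smul, finrank_euclideanSpace_fin, abs_of_nonneg (by positivity),
    smul_eq_mul]
  have e3 : l ^ (-κ) * (l ^ n)⁻¹ = (1 + t) ^ (-((n + κ) / s)) := by
    rw [← Real.rpow_natCast, ← Real.rpow_neg hl', ← Real.rpow_add hl0, hl,
      ← Real.rpow_mul (by positivity)]
    congr 1; field_simp; ring
  calc _ = (Real.exp c * ∫ x, f x) * (l ^ (-κ) * (l ^ n)⁻¹) := by ring
    _ ≤ _ := by
      rw [e3]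
      exact mul_le_mul_of_nonneg_left (bracket_rpow_neg_ge (by positivity) ht) (by positivity)

theorem exists_integral_envelope_le (Z : Finset (Space n)) {κ s c δ N : ℝ}
    (hκ : 0 ≤ κ) (hs : 0 < s) (hc : 0 < c) (hδ : 0 < δ) (hN : n < N) :
    ∃ C : ℝ, 0 ≤ C ∧ ∀ t, 0 ≤ t → Integrable (fun ξ => envelope Z δ c κ s t ξ * jb ξ ^ (-N)) ∧
      ∫ ξ, envelope Z δ c κ s t ξ * jb ξ ^ (-N) ≤ C * bracket t ^ (-((n + κ) / s)) := by
  obtain ⟨C₁, hC₁, h₁⟩ := exists_exp_le_bracket (ρ := (n + κ) / s) (by positivity) hδ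
  obtain ⟨C₂, hC₂, h₂⟩ := exists_integral_power_exp_le (n := n) hκ hs hc
  have hJi := integrable_jb_rpow hN
  have hJ0 : 0 ≤ ∫ ξ : Space n, jb ξ ^ (-N) :=
    integral_nonneg fun ξ => Real.rpow_nonneg (jb_pos ξ).le _
  have hcard : (0 : ℝ) ≤ Z.card := Nat.cast_nonneg _
  have hn : (0 : ℝ) ≤ n := Nat.cast_nonneg _
  refine ⟨C₁ * (∫ ξ : Space n, jb ξ ^ (-N)) + Z.card * C₂,
    add_nonneg (mul_nonneg hC₁.le hJ0) (mul_nonneg hcard hC₂), fun t ht => ?_⟩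
  have hb := bracket_pos t
  have hsum : Integrable fun ξ : Space n => ∑ z ∈ Z,
      if ‖ξ - z‖ < 1 then ‖ξ - z‖ ^ κ * Real.exp (-c * t * ‖ξ - z‖ ^ s) else 0 :=
    integrable_finsetSum _ fun z _ => (h₂ t ht z).1
  have hdom : Integrable fun ξ : Space n => Real.exp (-δ * t) * jb ξ ^ (-N) + ∑ z ∈ Z,
      if ‖ξ - z‖ < 1 then ‖ξ - z‖ ^ κ * Real.exp (-c * t * ‖ξ - z‖ ^ s) else 0 :=
    (hJi.const_mul _).add hsum
  have hle : ∀ ξ : Space n, envelope Z δ c κ s t ξ * jb ξ ^ (-N) ≤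
      Real.exp (-δ * t) * jb ξ ^ (-N) + ∑ z ∈ Z,
      if ‖ξ - z‖ < 1 then ‖ξ - z‖ ^ κ * Real.exp (-c * t * ‖ξ - z‖ ^ s) else 0 := by
    intro ξ
    rw [envelope, add_mul]
    gcongr
    refine mul_le_of_le_one_right (Finset.sum_nonneg fun z _ => ?_)
      (Real.rpow_le_one_of_one_le_of_nonpos (one_le_jb ξ) (by linarith))
    split_ifs <;> positivity
  have hm : AEStronglyMeasurable (fun ξ : Space n => envelope Z δ c κ s t ξ * jb ξ ^ (-N)) volume :=
    (aestronglyMeasurable_const.add hsum.aestronglyMeasurable).mul hJi.aestronglyMeasurable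
  have hi : Integrable (fun ξ => envelope Z δ c κ s t ξ * jb ξ ^ (-N)) :=
    hdom.mono' hm (Eventually.of_forall fun ξ => by
      have h1 := envelope_nonneg Z δ c κ s t ξ
      have h2 := jb_pos ξ
      rw [Real.norm_of_nonneg (by positivity)]
      exact hle ξ)
  refine ⟨hi, (integral_mono hi hdom hle).trans ?_⟩
  rw [integral_add (hJi.const_mul _) hsum, integral_const_mul,
    integral_finsetSum _ fun z _ => (h₂ t ht z).1, add_mul]
  refine add_le_add ?_ ?_
  · rw [mul_right_comm]
    gcongr
    exact h₁ t ht
  · rw [mul_assoc, ← nsmul_eq_mul, ← Finset.sum_const]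
    exact Finset.sum_le_sum fun z _ => (h₂ t ht z).2

variable [NeZero m]

/-- The Fourier multiplier that maps `⟨D⟩^{N+|α|+r-j} f_j` to the contribution of `f_j` to
`∂_t^r ∂_x^α u(t)`. -/
def solMult (L : Operator n m) (N : ℝ) (r : ℕ) (α : Fin n →₀ ℕ) (j : Fin m) (t : ℝ)
    (η : Space n) : ℂ :=
  Complex.I ^ α.degree * xiPow α ((2 * Real.pi) • η) *
    fundSol (L.odeCoeff ((2 * Real.pi) • η)) j (Polynomial.X ^ r) t *
    ((jb ((2 * Real.pi) • η) ^ (-(N + α.degree + r - (j : ℕ))) : ℝ) : ℂ)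

theorem continuous_solMult (L : Operator n m) (N : ℝ) (r : ℕ) (α : Fin n →₀ ℕ) (j : Fin m)
    (t : ℝ) : Continuous (solMult L N r α j t) := by
  have hs : Continuous fun η : Space n => (2 * Real.pi) • η := continuous_const_smul _
  refine ((continuous_const.mul ((continuous_xiPow α).comp hs)).mul
    ((continuous_fundSol j _).comp (((L.continuous_odeCoeff).comp hs).prodMk
      continuous_const))).mul (Complex.continuous_ofReal.comp ?_)
  exact (continuous_jb.comp hs).rpow_const fun η => Or.inl (jb_pos _).ne'

theorem FundSolBound.norm_solMult_le {L : Operator n m} {Z : Finset (Space n)} {κ s : ℝ} {r : ℕ}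
    {α : Fin n →₀ ℕ} (h : FundSolBound L Z κ s r α Set.univ) (N : ℝ) :
    ∃ C δ c : ℝ, 0 < C ∧ 0 < δ ∧ 0 < c ∧ ∀ (η : Space n) (j : Fin m) (t : ℝ), 0 ≤ t →
      ‖solMult L N r α j t η‖ ≤ C * (envelope Z δ c κ s t ((2 * Real.pi) • η) *
        jb ((2 * Real.pi) • η) ^ (-N)) := by
  obtain ⟨C, δ, c, hC, hδ, hc, H⟩ := h
  refine ⟨C, δ, c, hC, hδ, hc, fun η j t ht => ?_⟩
  set ξ := (2 * Real.pi) • η with hξ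
  have hJ := jb_pos ξ
  have h1 := H ξ (Set.mem_univ _) j t ht
  rw [solMult, norm_mul, norm_mul, norm_mul, norm_pow, Complex.norm_I, one_pow, one_mul,
    Complex.norm_real, Real.norm_of_nonneg (by positivity)]
  calc _ ≤ C * envelope Z δ c κ s t ξ * jb ξ ^ ((α.degree : ℝ) + r - (j : ℕ)) *
        jb ξ ^ (-(N + α.degree + r - (j : ℕ))) := by gcongr
    _ = _ := by
        rw [mul_assoc, ← Real.rpow_add hJ, ← mul_assoc]
        congr 2; ring

/-- For `p = 1` the `L¹` norm of the multiplier is used, for `p > 1` its domination by singular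
powers. The transform `G` is chosen before `j` and `t`, so a single representative of `ĝ` serves the
solution at all times. -/
theorem exists_solMult_estimate (hn : 0 < n) {L : Operator n m} {Z : Finset (Space n)} {κ s : ℝ}
    {r : ℕ} {α : Fin n →₀ ℕ} (hκ : 0 ≤ κ) (hs : 0 < s) (h : FundSolBound L Z κ s r α Set.univ)
    {p q : ℝ≥0∞} [hp1 : Fact (1 ≤ p)] [Fact (1 ≤ q)] (hp2 : p ≤ 2) (hpq : p⁻¹ + q⁻¹ = 1) {N : ℝ}
    (hN : 1 < p → (n : ℝ) * ((p⁻¹).toReal - (q⁻¹).toReal) ≤ N) (hN1 : p = 1 → (n : ℝ) < N) :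
    ∃ C : ℝ, 0 ≤ C ∧ ∀ g : Lp ℂ p (volume : Measure (Space n)), ∃ G : Space n → ℂ,
      (∃ K : ℝ, Integrable (fun ξ => ((jb ξ ^ (-K) : ℝ) : ℂ) * G ξ)) ∧ IsFT (g : Distr n) G ∧
      ∀ (j : Fin m) (t : ℝ), 0 ≤ t → ∃ u : Lp ℂ q (volume : Measure (Space n)),
        IsFT (u : Distr n) (fun η => solMult L N r α j t η * G η) ∧
        ‖u‖ ≤ C * bracket t ^ (-((n * ((p⁻¹).toReal - (q⁻¹).toReal) + κ) / s)) * ‖g‖ := by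
  obtain ⟨C₀, δ, c, hC₀, hδ, hc, hM⟩ := h.norm_solMult_le N
  have hpi : 0 < 2 * Real.pi := by positivity
  rcases hp1.out.eq_or_lt with h1 | h1
  · subst h1
    have hq : q = ∞ := by
      rw [inv_one] at hpq
      have : q⁻¹ = 0 := by
        have h2 : (1 : ℝ≥0∞) + q⁻¹ = 1 + 0 := by rw [hpq, add_zero]
        exact (ENNReal.add_right_inj ENNReal.one_ne_top).1 h2
      exact ENNReal.inv_eq_zero.1 this
    subst hq
    obtain ⟨C₁, hC₁, H₁⟩ := exists_integral_envelope_le Z hκ hs hc hδ (hN1 rfl)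
    obtain ⟨C₂, hC₂, H₂⟩ := multiplierBound_one_top (n := n)
    refine ⟨C₂ * (C₀ * C₁), by positivity, fun g => ?_⟩
    obtain ⟨G, hK, hG, hGM⟩ := H₂ g
    refine ⟨G, hK, hG, fun j t ht => ?_⟩
    have hb := bracket_pos t
    obtain ⟨hi, hile⟩ := H₁ t ht
    have hi' : Integrable fun η : Space n => C₀ * (envelope Z δ c κ s t ((2 * Real.pi) • η) *
        jb ((2 * Real.pi) • η) ^ (-N)) :=
      ((integrable_comp_smul_iff volume _ hpi.ne').2 hi).const_mul C₀
    have hSi : Integrable (solMult L N r α j t) :=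
      hi'.mono' (continuous_solMult L N r α j t).aestronglyMeasurable
        (Eventually.of_forall fun η => hM η j t ht)
    obtain ⟨u, hu, hun⟩ := hGM (C₀ * (C₁ * bracket t ^ (-((n + κ) / s)))) (by positivity)
      (solMult L N r α j t) (continuous_solMult L N r α j t).aestronglyMeasurable ⟨hSi, by
        refine (integral_mono hSi.norm hi' fun η => hM η j t ht).trans ?_
        rw [integral_const_mul]
        gcongr
        rw [Measure.integral_comp_smul volume
          (fun ξ => envelope Z δ c κ s t ξ * jb ξ ^ (-N)) (2 * Real.pi), smul_eq_mul]
        refine le_trans (mul_le_of_le_one_left (integral_nonneg fun ξ =>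
          mul_nonneg (envelope_nonneg _ _ _ _ _ _ _) (Real.rpow_nonneg (jb_pos ξ).le _)) ?_) hile
        rw [abs_of_nonneg (by positivity)]
        refine inv_le_one_of_one_le₀ (one_le_pow₀ ?_)
        linarith [Real.pi_gt_three]⟩
    refine ⟨u, hu, hun.trans_eq ?_⟩
    rw [inv_one, ENNReal.toReal_one, ENNReal.inv_top, ENNReal.toReal_zero, sub_zero, mul_one]
    ring
  · set a : ℝ := n * ((p⁻¹).toReal - (q⁻¹).toReal) with ha
    have ha0 : 0 ≤ a := by
      refine mul_nonneg (Nat.cast_nonneg _) (sub_nonneg.2 ?_)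
      have hp0 : p⁻¹ ≠ ∞ := ENNReal.inv_ne_top.2 (zero_lt_one.trans h1).ne'
      refine ENNReal.toReal_mono hp0 ?_
      have h2 : (2 : ℝ≥0∞)⁻¹ ≤ p⁻¹ := ENNReal.inv_le_inv.2 hp2
      by_contra hcon
      rw [not_le] at hcon
      have h3 : (1 : ℝ≥0∞) < 1 := by
        calc (1 : ℝ≥0∞) = 2⁻¹ + 2⁻¹ := ENNReal.inv_two_add_inv_two.symm
          _ < p⁻¹ + q⁻¹ := ENNReal.add_lt_add_of_le_of_lt (by simp) h2 (h2.trans_lt hcon)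
          _ = 1 := hpq
      exact lt_irrefl _ h3
    obtain ⟨C₁, hC₁, H₁⟩ := exists_envelope_le_singular Z ha0 hκ hs hc hδ (hN h1)
    -- The symbols are evaluated at `2πη`, which moves the singular points to `z / 2π`.
    set Z' : Finset (Space n) := (insert 0 Z).image fun z => (2 * Real.pi)⁻¹ • z with hZ'
    have hZ'n : Z'.Nonempty := (Finset.insert_nonempty _ _).image _
    obtain ⟨C₂, hC₂, H₂⟩ := multiplierBound_singular hn h1 hp2 hpq hZ'n
    refine ⟨C₂ * (C₀ * C₁), by positivity, fun g => ?_⟩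
    obtain ⟨G, hK, hG, hGM⟩ := H₂ g
    refine ⟨G, hK, hG, fun j t ht => ?_⟩
    have hb := bracket_pos t
    obtain ⟨u, hu, hun⟩ := hGM (C₀ * C₁ * bracket t ^ (-((a + κ) / s))) (by positivity)
      (solMult L N r α j t) (continuous_solMult L N r α j t).aestronglyMeasurable (by
        filter_upwards [ae_ne_finset hn Z'] with η hη
        have hη' : ∀ z ∈ insert 0 Z, (2 * Real.pi) • η ≠ z := fun z hz heq => by
          refine hη _ (Finset.mem_image_of_mem _ hz) ?_
          rw [← heq, smul_smul, inv_mul_cancel₀ hpi.ne', one_smul]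
        refine (hM η j t ht).trans ?_
        have h2 := H₁ t ht _ hη'
        calc _ ≤ C₀ * (C₁ * bracket t ^ (-((a + κ) / s)) *
              ∑ z ∈ insert 0 Z, ‖(2 * Real.pi) • η - z‖ ^ (-a)) := by gcongr
          _ ≤ C₀ * (C₁ * bracket t ^ (-((a + κ) / s)) * ∑ z ∈ Z', ‖η - z‖ ^ (-a)) := by
              gcongr
              rw [hZ', Finset.sum_image fun x _ y _ hxy =>
                smul_right_injective _ (inv_ne_zero hpi.ne') hxy]
              refine Finset.sum_le_sum fun z hz => ?_
              have e1 : (2 * Real.pi) • η - z = (2 * Real.pi) • (η - (2 * Real.pi)⁻¹ • z) := by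
                rw [smul_sub, smul_smul, mul_inv_cancel₀ hpi.ne', one_smul]
              have hpos : 0 < ‖η - (2 * Real.pi)⁻¹ • z‖ :=
                norm_pos_iff.2 (sub_ne_zero.2 (hη _ (Finset.mem_image_of_mem _ hz)))
              rw [e1, norm_smul, Real.norm_of_nonneg hpi.le]
              refine Real.rpow_le_rpow_of_nonpos hpos ?_ (by linarith)
              nlinarith [Real.pi_gt_three]
          _ = _ := by ring)
    exact ⟨u, hu, hun.trans_eq (by ring)⟩

end Decay

/-! ### Differential operators as Fourier multipliers -/

section Symbols

open FourierTransform

variable {n : ℕ}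

theorem coord_hasTemperateGrowth (i : Fin n) :
    (fun η : Space n => (((2 * Real.pi) • η) i : ℂ)).HasTemperateGrowth := by
  have h : (fun η : Space n => (((2 * Real.pi) • η) i : ℂ)) =
      ⇑(Complex.ofRealCLM.comp ((2 * Real.pi) • EuclideanSpace.proj (𝕜 := ℝ) i)) := by
    ext η; simp
  rw [h]
  exact ContinuousLinearMap.hasTemperateGrowth _

theorem pow_hasTemperateGrowth {g : Space n → ℂ} (hg : g.HasTemperateGrowth) (k : ℕ) :
    (fun η => g η ^ k).HasTemperateGrowth := hg.pow k

theorem prod_hasTemperateGrowth {ι : Type*} (l : List ι) {g : ι → Space n → ℂ}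
    (hg : ∀ i, (g i).HasTemperateGrowth) :
    (fun η => (l.map fun i => g i η).prod).HasTemperateGrowth := by
  induction l with
  | nil => simp
  | cons i l ih =>
    simp only [List.map_cons, List.prod_cons]
    exact (hg i).mul ih

theorem partialX_eq_fourierMultiplier (i : Fin n) :
    partialX i = TemperedDistribution.fourierMultiplierCLM ℂ
      (fun η : Space n => Complex.I * (((2 * Real.pi) • η) i : ℂ)) := by
  ext1 T
  change LineDeriv.lineDerivOp (EuclideanSpace.single i (1 : ℝ)) T = _
  have hg : (fun η : Space n => ((inner ℝ η (EuclideanSpace.single i (1 : ℝ)) : ℝ) : ℂ)).HasTemperateGrowth := by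
    fun_prop
  rw [TemperedDistribution.lineDeriv_eq_fourierMultiplierCLM,
    ← smul_apply, ← TemperedDistribution.fourierMultiplierCLM_smul hg]
  congr 2
  ext η
  simp [EuclideanSpace.inner_single_right]
  ring

theorem fourierMultiplier_pow {g : Space n → ℂ} (hg : g.HasTemperateGrowth) (k : ℕ) :
    TemperedDistribution.fourierMultiplierCLM ℂ g ^ k =
      TemperedDistribution.fourierMultiplierCLM ℂ (fun η => g η ^ k) := by
  induction k with
  | zero => simp; rfl
  | succ k ih =>
    rw [pow_succ, ih]
    exact (TemperedDistribution.fourierMultiplierCLM_compL_fourierMultiplierCLM hg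
      (pow_hasTemperateGrowth hg k)).trans (by congr 1; ext η; simp [pow_succ, mul_comm])

theorem fourierMultiplier_list_prod {ι : Type*} (l : List ι) {g : ι → Space n → ℂ}
    (hg : ∀ i, (g i).HasTemperateGrowth) :
    (l.map fun i => TemperedDistribution.fourierMultiplierCLM ℂ (g i)).prod =
      TemperedDistribution.fourierMultiplierCLM ℂ (fun η => (l.map fun i => g i η).prod) := by
  induction l with
  | nil => simp; rfl
  | cons i l ih =>
    simp only [List.map_cons, List.prod_cons]
    rw [ih]
    exact (TemperedDistribution.fourierMultiplierCLM_compL_fourierMultiplierCLM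
      (prod_hasTemperateGrowth l hg) (hg i)).trans (by congr 1; ext η; simp [mul_comm])

/-- The symbol of `∂_x^α`. -/
def dxSymbol (α : Fin n →₀ ℕ) (η : Space n) : ℂ :=
  Complex.I ^ α.degree * xiPow α ((2 * Real.pi) • η)

theorem dxSymbol_eq (α : Fin n →₀ ℕ) : dxSymbol α = fun η : Space n =>
    ((List.finRange n).map fun i => (Complex.I * (((2 * Real.pi) • η) i : ℂ)) ^ α i).prod := by
  ext η
  rw [← List.ofFn_eq_map, List.prod_ofFn, dxSymbol, xiPow, Finsupp.degree_eq_sum,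
    ← Finset.prod_pow_eq_pow_sum, ← Finset.prod_mul_distrib]
  simp only [mul_pow]

theorem dxSymbol_factor_hasTemperateGrowth (i : Fin n) :
    (fun η : Space n => Complex.I * (((2 * Real.pi) • η) i : ℂ)).HasTemperateGrowth :=
  (Function.HasTemperateGrowth.const Complex.I).mul (coord_hasTemperateGrowth i)

theorem dxSymbol_hasTemperateGrowth (α : Fin n →₀ ℕ) : (dxSymbol α).HasTemperateGrowth := by
  rw [dxSymbol_eq]
  exact prod_hasTemperateGrowth _ fun i =>
    pow_hasTemperateGrowth (dxSymbol_factor_hasTemperateGrowth i) _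

theorem partialXPow_eq_fourierMultiplier (α : Fin n →₀ ℕ) :
    partialXPow α = TemperedDistribution.fourierMultiplierCLM ℂ (dxSymbol α) := by
  rw [partialXPow, dxSymbol_eq, ← fourierMultiplier_list_prod _ fun i =>
    pow_hasTemperateGrowth (dxSymbol_factor_hasTemperateGrowth i) _]
  simp only [partialX_eq_fourierMultiplier,
    fourierMultiplier_pow (dxSymbol_factor_hasTemperateGrowth _)]

theorem evalAt_eq_sum_dxSymbol (P : MvPolynomial (Fin n) ℂ) (η : Space n) :
    evalAt P ((2 * Real.pi) • η) =
      ∑ α ∈ P.support, (P.coeff α * (-Complex.I) ^ α.degree) * dxSymbol α η := by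
  rw [evalAt, MvPolynomial.eval_eq']
  refine Finset.sum_congr rfl fun α _ => ?_
  rw [dxSymbol, ← mul_assoc, mul_assoc (P.coeff α), ← mul_pow, neg_mul, Complex.I_mul_I, neg_neg,
    one_pow, mul_one, xiPow]

theorem evalAt_hasTemperateGrowth (P : MvPolynomial (Fin n) ℂ) :
    (fun η : Space n => evalAt P ((2 * Real.pi) • η)).HasTemperateGrowth := by
  simp only [evalAt_eq_sum_dxSymbol]
  exact Function.HasTemperateGrowth.sum fun α _ =>
    (Function.HasTemperateGrowth.const _).mul (dxSymbol_hasTemperateGrowth α)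

theorem polyDx_eq_fourierMultiplier (P : MvPolynomial (Fin n) ℂ) :
    polyDx P = TemperedDistribution.fourierMultiplierCLM ℂ
      (fun η : Space n => evalAt P ((2 * Real.pi) • η)) := by
  simp only [evalAt_eq_sum_dxSymbol]
  rw [TemperedDistribution.fourierMultiplierCLM_sum ℂ (s := P.support)
    (g := fun α η => (P.coeff α * (-Complex.I) ^ α.degree) * dxSymbol α η) fun α _ =>
    (Function.HasTemperateGrowth.const _).mul (dxSymbol_hasTemperateGrowth α), polyDx]
  refine Finset.sum_congr rfl fun α _ => ?_
  rw [partialXPow_eq_fourierMultiplier,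
    ← TemperedDistribution.fourierMultiplierCLM_smul (dxSymbol_hasTemperateGrowth α)]
  rfl

theorem polyDx_apply_fourier (P : MvPolynomial (Fin n) ℂ) (T : Distr n) (φ : 𝓢(Space n, ℂ)) :
    polyDx P T (𝓕 φ) = T (𝓕 (SchwartzMap.smulLeftCLM ℂ
      (fun η : Space n => evalAt P ((2 * Real.pi) • η)) φ)) := by
  rw [polyDx_eq_fourierMultiplier, TemperedDistribution.fourierMultiplierCLM_apply_apply,
    fourierInv_fourier_eq]

theorem IsFT.fourierMultiplier {T : Distr n} {G g : Space n → ℂ} (hg : g.HasTemperateGrowth)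
    (h : IsFT T G) :
    IsFT (TemperedDistribution.fourierMultiplierCLM ℂ g T) fun η => g η * G η := fun φ => by
  obtain ⟨h1, h2⟩ := h (SchwartzMap.smulLeftCLM ℂ g φ)
  have e : (fun ξ => SchwartzMap.smulLeftCLM ℂ g φ ξ * G ξ) = fun ξ => φ ξ * (g ξ * G ξ) := by
    ext ξ
    rw [SchwartzMap.smulLeftCLM_apply_apply hg, smul_eq_mul]; ring
  rw [e] at h1 h2
  refine ⟨h1, ?_⟩
  rw [TemperedDistribution.fourierMultiplierCLM_apply_apply, fourierInv_fourier_eq, h2]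

theorem bracketD_eq (σ : ℝ) : bracketD n σ = TemperedDistribution.fourierMultiplierCLM ℂ
    (fun η : Space n => ((jb ((2 * Real.pi) • η) ^ σ : ℝ) : ℂ)) := by
  rw [bracketD]
  congr 1
  ext η
  rw [jb_rpow_eq]

theorem jb_two_pi_hasTemperateGrowth (σ : ℝ) :
    (fun η : Space n => ((jb ((2 * Real.pi) • η) ^ σ : ℝ) : ℂ)).HasTemperateGrowth := by
  have := bracket_hasTemperateGrowth n σ
  simpa only [jb_rpow_eq] using this

theorem bracketD_neg_bracketD (σ : ℝ) (T : Distr n) : bracketD n (-σ) (bracketD n σ T) = T := by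
  rw [bracketD_eq, bracketD_eq, TemperedDistribution.fourierMultiplierCLM_fourierMultiplierCLM_apply
    (jb_two_pi_hasTemperateGrowth σ) (jb_two_pi_hasTemperateGrowth (-σ))]
  have : (fun η : Space n => ((jb ((2 * Real.pi) • η) ^ σ : ℝ) : ℂ)) *
      (fun η : Space n => ((jb ((2 * Real.pi) • η) ^ (-σ) : ℝ) : ℂ)) = fun _ => 1 := by
    ext η
    rw [Pi.mul_apply, ← Complex.ofReal_mul, ← Real.rpow_add (jb_pos _)]
    simp
  rw [this]
  simp

theorem IsFT.of_bracketD {T : Distr n} {σ : ℝ} {G : Space n → ℂ} (h : IsFT (bracketD n σ T) G) :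
    IsFT T fun η => ((jb ((2 * Real.pi) • η) ^ (-σ) : ℝ) : ℂ) * G η := by
  have h1 := h.fourierMultiplier (jb_two_pi_hasTemperateGrowth (n := n) (-σ))
  rwa [← bracketD_eq, bracketD_neg_bracketD] at h1

/-- Integrability up to polynomial growth. -/
def TempInt (F : Space n → ℂ) : Prop :=
  ∃ K : ℝ, Integrable (fun ξ => ((jb ξ ^ (-K) : ℝ) : ℂ) * F ξ)

theorem TempInt.mul {F g : Space n → ℂ} (hF : TempInt F) (hg : Continuous g) {C K' : ℝ}
    (hb : ∀ ξ, ‖g ξ‖ ≤ C * jb ξ ^ K') : TempInt fun ξ => g ξ * F ξ := by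
  obtain ⟨K, hK⟩ := hF
  refine ⟨K + K', ?_⟩
  have hc : Continuous fun ξ : Space n => ((jb ξ ^ (-K') : ℝ) : ℂ) * g ξ :=
    (Complex.continuous_ofReal.comp
      (continuous_jb.rpow_const fun ξ => Or.inl (jb_pos ξ).ne')).mul hg
  refine (hK.bdd_mul hc.aestronglyMeasurable (c := C) (Eventually.of_forall fun ξ => ?_)).congr
    (Eventually.of_forall fun ξ => ?_)
  · have hJ := jb_pos ξ
    rw [norm_mul, Complex.norm_real, Real.norm_of_nonneg (by positivity)]
    calc _ ≤ jb ξ ^ (-K') * (C * jb ξ ^ K') := by gcongr; exact hb ξ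
      _ = C * (jb ξ ^ (-K') * jb ξ ^ K') := by ring
      _ = C := by rw [← Real.rpow_add hJ]; simp
  · have e : jb ξ ^ (-(K + K')) = jb ξ ^ (-K') * jb ξ ^ (-K) := by
      rw [← Real.rpow_add (jb_pos ξ)]; congr 1; ring
    simp only [e, Complex.ofReal_mul]
    ring

theorem TempInt.integrable_schwartz_mul {F : Space n → ℂ} (hF : TempInt F) (φ : 𝓢(Space n, ℂ)) :
    Integrable fun ξ => φ ξ * F ξ := by
  obtain ⟨K, hK⟩ := hF
  set ψ := SchwartzMap.smulLeftCLM ℂ (fun ξ : Space n => ((jb ξ ^ K : ℝ) : ℂ)) φ with hψ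
  refine (hK.bdd_mul ψ.continuous.aestronglyMeasurable (c := ‖ψ.toBoundedContinuousFunction‖)
    (Eventually.of_forall fun ξ => ψ.toBoundedContinuousFunction.norm_coe_le_norm ξ)).congr
    (Eventually.of_forall fun ξ => ?_)
  have e : jb ξ ^ K * jb ξ ^ (-K) = 1 := by rw [← Real.rpow_add (jb_pos ξ)]; simp
  have e' : ((jb ξ ^ K : ℝ) : ℂ) * ((jb ξ ^ (-K) : ℝ) : ℂ) = 1 := by
    rw [← Complex.ofReal_mul, e, Complex.ofReal_one]
  simp only [hψ, SchwartzMap.smulLeftCLM_apply_apply (jb_rpow_hasTemperateGrowth K), smul_eq_mul]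
  linear_combination (φ ξ * F ξ) * e'

theorem TempInt.sum {ι : Type*} {s : Finset ι} {F : ι → Space n → ℂ} (hF : ∀ i, TempInt (F i)) :
    TempInt fun ξ => ∑ i ∈ s, F i ξ := by
  classical
  have hmono : ∀ {G : Space n → ℂ} {K K' : ℝ}, K ≤ K' →
      Integrable (fun ξ => ((jb ξ ^ (-K) : ℝ) : ℂ) * G ξ) →
      Integrable (fun ξ => ((jb ξ ^ (-K') : ℝ) : ℂ) * G ξ) := by
    intro G K K' hKK' hK
    have hc : Continuous fun ξ : Space n => ((jb ξ ^ (-(K' - K)) : ℝ) : ℂ) :=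
      Complex.continuous_ofReal.comp
        (continuous_jb.rpow_const fun ξ => Or.inl (jb_pos ξ).ne')
    refine (hK.bdd_mul hc.aestronglyMeasurable (c := 1) (Eventually.of_forall fun ξ => ?_)).congr
      (Eventually.of_forall fun ξ => ?_)
    · have hJ := jb_pos ξ
      rw [Complex.norm_real, Real.norm_of_nonneg (by positivity)]
      exact Real.rpow_le_one_of_one_le_of_nonpos (one_le_jb ξ) (by linarith)
    · have e : jb ξ ^ (-K') = jb ξ ^ (-(K' - K)) * jb ξ ^ (-K) := by
        rw [← Real.rpow_add (jb_pos ξ)]; congr 1; ring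
      simp only [e, Complex.ofReal_mul]
      ring
  induction s using Finset.induction_on with
  | empty => exact ⟨0, by simp⟩
  | insert i s hi ih =>
    obtain ⟨K, hK⟩ := ih
    obtain ⟨K', hK'⟩ := hF i
    refine ⟨max K' K, ?_⟩
    simp only [Finset.sum_insert hi, mul_add]
    exact (hmono (le_max_left _ _) hK').add (hmono (le_max_right _ _) hK)

/-- Divide by a power of `⟨ξ⟩` to land in `L¹`, multiply the resulting distribution back, and invert
the Fourier transform. -/
theorem TempInt.exists_isFT {F : Space n → ℂ} (hF : TempInt F) : ∃ T : Distr n, IsFT T F := by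
  obtain ⟨K, hK⟩ := id hF
  have : Fact ((1 : ℝ≥0∞) ≤ 1) := ⟨le_rfl⟩
  set g : Lp ℂ 1 (volume : Measure (Space n)) := hK.toL1 _ with hg
  refine ⟨𝓕⁻ (TemperedDistribution.smulLeftCLM ℂ (fun ξ : Space n => ((jb ξ ^ K : ℝ) : ℂ))
    (g : Distr n)), fun φ => ⟨hF.integrable_schwartz_mul φ, ?_⟩⟩
  rw [TemperedDistribution.fourierInv_apply, fourierInv_fourier_eq,
    TemperedDistribution.smulLeftCLM_apply_apply, Lp.toTemperedDistribution_apply]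
  refine integral_congr_ae ?_
  filter_upwards [hK.coeFn_toL1] with ξ hξ
  have e : jb ξ ^ K * jb ξ ^ (-K) = 1 := by rw [← Real.rpow_add (jb_pos ξ)]; simp
  have e' : ((jb ξ ^ K : ℝ) : ℂ) * ((jb ξ ^ (-K) : ℝ) : ℂ) = 1 := by
    rw [← Complex.ofReal_mul, e, Complex.ofReal_one]
  rw [hg, hξ, SchwartzMap.smulLeftCLM_apply_apply (jb_rpow_hasTemperateGrowth K), smul_eq_mul,
    smul_eq_mul]
  linear_combination (φ ξ * F ξ) * e'

theorem jb_two_pi_le (η : Space n) : jb ((2 * Real.pi) • η) ≤ 2 * Real.pi * jb η := by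
  have hpi := Real.pi_gt_three
  rw [jb, jb, Real.sqrt_le_left (by positivity), mul_pow, Real.sq_sqrt (by positivity), norm_smul,
    Real.norm_of_nonneg (by positivity), mul_pow]
  nlinarith [sq_nonneg ‖η‖]

theorem jb_two_pi_rpow_le (σ : ℝ) (η : Space n) :
    jb ((2 * Real.pi) • η) ^ σ ≤ (2 * Real.pi) ^ |σ| * jb η ^ |σ| := by
  have hJ := jb_pos η
  calc _ ≤ jb ((2 * Real.pi) • η) ^ |σ| :=
        Real.rpow_le_rpow_of_exponent_le (one_le_jb _) (le_abs_self σ)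
    _ ≤ (2 * Real.pi * jb η) ^ |σ| :=
        Real.rpow_le_rpow (jb_pos _).le (jb_two_pi_le η) (abs_nonneg σ)
    _ = _ := Real.mul_rpow (by positivity) hJ.le

end Symbols

/-! ### The explicit solution and the decay estimate -/

section Solution

open FourierTransform

variable {n m : ℕ}

/-- Differentiation under the integral with domination only for `t ≥ 0`, where the fundamental
solutions are controlled. The difference quotients are dominated through the mean value inequality
on the half line. -/
theorem hasDerivWithinAt_integral_Ici {f f' : ℝ → Space n → ℂ} {bound : Space n → ℝ}
    (hf : ∀ t, 0 ≤ t → Integrable (f t)) (hb : ∀ t, 0 ≤ t → ∀ ξ, ‖f' t ξ‖ ≤ bound ξ)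
    (hbi : Integrable bound)
    (hd : ∀ t, 0 ≤ t → ∀ ξ, HasDerivAt (fun s => f s ξ) (f' t ξ) t) {t : ℝ} (ht : 0 ≤ t) :
    HasDerivWithinAt (fun s => ∫ ξ, f s ξ) (∫ ξ, f' t ξ) (Set.Ici 0) t := by
  rw [hasDerivWithinAt_iff_tendsto_slope]
  have hmem : ∀ᶠ s in 𝓝[Set.Ici 0 \ {t}] t, s ∈ Set.Ici (0 : ℝ) \ {t} := self_mem_nhdsWithin
  have key : Tendsto (fun s => ∫ ξ, slope (fun s => f s ξ) t s) (𝓝[Set.Ici 0 \ {t}] t)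
      (𝓝 (∫ ξ, f' t ξ)) := by
    refine tendsto_integral_filter_of_dominated_convergence bound ?_ ?_ hbi ?_
    · filter_upwards [hmem] with s hs
      exact ((((hf s hs.1).sub (hf t ht)).smul ((s - t)⁻¹)).aestronglyMeasurable)
    · filter_upwards [hmem] with s hs
      refine Eventually.of_forall fun ξ => ?_
      have h1 := (convex_Ici (0 : ℝ)).norm_image_sub_le_of_norm_hasDerivWithin_le
        (f := fun s => f s ξ) (f' := fun s => f' s ξ) (C := bound ξ)
        (fun x hx => (hd x hx ξ).hasDerivWithinAt) (fun x hx => hb x hx ξ) ht hs.1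
      rw [slope_def_module, norm_smul, norm_inv]
      have hpos : 0 < ‖s - t‖ := norm_pos_iff.2 (sub_ne_zero.2 hs.2)
      rw [inv_mul_le_iff₀ hpos, mul_comm]
      exact h1
    · refine Eventually.of_forall fun ξ => ?_
      exact (hasDerivWithinAt_iff_tendsto_slope.1 (hd t ht ξ).hasDerivWithinAt)
  refine key.congr' ?_
  filter_upwards [hmem] with s hs
  simp only [slope_def_module]
  rw [integral_smul, integral_sub (hf s hs.1) (hf t ht)]

theorem IsTimeDeriv.unique {k : ℕ} {u v v' : ℝ → Distr n} (h : IsTimeDeriv k u v)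
    (h' : IsTimeDeriv k u v') : ∀ t, 0 ≤ t → v t = v' t := by
  induction k generalizing v v' with
  | zero => exact fun t ht => (h t ht).trans (h' t ht).symm
  | succ k ih =>
    obtain ⟨w, hw, hwv⟩ := h
    obtain ⟨w', hw', hwv'⟩ := h'
    intro t ht
    ext φ
    refine ((uniqueDiffOn_Ici (0 : ℝ)) t ht).eq_deriv _ (hwv t ht φ) ?_
    exact (hwv' t ht φ).congr (fun s hs => by rw [ih hw hw' s hs]) (by rw [ih hw hw' t ht])

theorem odeCoeff_two_pi_hasTemperateGrowth (L : Operator n m) (i : Fin m) :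
    (fun η : Space n => L.odeCoeff ((2 * Real.pi) • η) i).HasTemperateGrowth :=
  ((Function.HasTemperateGrowth.const _).mul (evalAt_hasTemperateGrowth (L.coeff i))).neg

theorem smulLeft_odeCoeff (L : Operator n m) (i : Fin m) (φ : 𝓢(Space n, ℂ)) :
    SchwartzMap.smulLeftCLM ℂ (fun η : Space n => L.odeCoeff ((2 * Real.pi) • η) i) φ =
      -Complex.I ^ (m - (i : ℕ)) • SchwartzMap.smulLeftCLM ℂ
        (fun η : Space n => evalAt (L.coeff i) ((2 * Real.pi) • η)) φ := by
  ext η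
  rw [SchwartzMap.smulLeftCLM_apply_apply (odeCoeff_two_pi_hasTemperateGrowth L i),
    smul_apply,
    SchwartzMap.smulLeftCLM_apply_apply (evalAt_hasTemperateGrowth (L.coeff i)), Operator.odeCoeff]
  simp only [smul_eq_mul]
  ring

theorem equation_fourier {L : Operator n m} {U : ℕ → Distr n}
    (hU : (-Complex.I) ^ m • U m +
        ∑ k : Fin m, (-Complex.I) ^ (k : ℕ) • polyDx (L.coeff k) (U k) = 0) (φ : 𝓢(Space n, ℂ)) :
    U m (𝓕 φ) = ∑ i : Fin m, U i (𝓕 (SchwartzMap.smulLeftCLM ℂ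
      (fun η : Space n => L.odeCoeff ((2 * Real.pi) • η) i) φ)) := by
  have hI : ∀ k, Complex.I ^ k * (-Complex.I) ^ k = 1 := fun k => by
    rw [← mul_pow, mul_neg, Complex.I_mul_I, neg_neg, one_pow]
  have h1 : U m = -∑ k : Fin m, Complex.I ^ (m - (k : ℕ)) • polyDx (L.coeff k) (U k) := by
    -- Multiplication by `i^m` removes the factor `(-i)^m` and turns `(-i)^k` into `i^{m-k}`, the
    -- factor in `odeCoeff`.
    have h2 := congrArg (fun T => Complex.I ^ m • T) hU
    replace h2 := h2.trans (show Complex.I ^ m • (0 : Distr n) = 0 by ext φ; simp [smul_apply])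
    simp only [smul_add, smul_smul, hI, one_smul, Finset.smul_sum] at h2
    rw [eq_neg_iff_add_eq_zero, ← h2]
    congr 1
    refine Finset.sum_congr rfl fun k _ => ?_
    congr 1
    have e : Complex.I ^ m = Complex.I ^ (m - (k : ℕ)) * Complex.I ^ (k : ℕ) := by
      rw [← pow_add]; congr 1; omega
    rw [e, mul_assoc, hI, mul_one]
  rw [h1, neg_apply, sum_distr_apply, ← Finset.sum_neg_distrib]
  refine Finset.sum_congr rfl fun k _ => ?_
  rw [smul_apply, polyDx_apply_fourier, smulLeft_odeCoeff,
    FourierTransform.fourier_smul, map_smul, neg_smul]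

variable [NeZero m]

/-- The case without vanishing is used only as polynomial control in `ξ`, uniform in time and for
every order `k`. It makes the explicit formula differentiable arbitrarily often. -/
theorem FundSolBound.exists_norm_fundSol_le {L : Operator n m} {Z : Finset (Space n)} {s : ℝ}
    {k : ℕ} (h : FundSolBound L Z 0 s k 0 Set.univ) :
    ∃ C : ℝ, 0 ≤ C ∧ ∀ (ξ : Space n) (j : Fin m) (t : ℝ), 0 ≤ t →
      ‖fundSol (L.odeCoeff ξ) j (Polynomial.X ^ k) t‖ ≤ C * jb ξ ^ (k : ℝ) := by
  obtain ⟨C, δ, c, hC, hδ, hc, H⟩ := h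
  have hZ : (0 : ℝ) ≤ Z.card := Nat.cast_nonneg _
  refine ⟨C * (1 + Z.card), mul_nonneg hC.le (by linarith), fun ξ j t ht => ?_⟩
  have h1 := H ξ (Set.mem_univ _) j t ht
  have h2 : ‖xiPow (0 : Fin n →₀ ℕ) ξ‖ = 1 := by simp [xiPow]
  rw [h2, one_mul] at h1
  have hJ := jb_pos ξ
  have h3 : envelope Z δ c 0 s t ξ ≤ 1 + Z.card := by
    unfold envelope
    refine add_le_add (Real.exp_le_one_iff.2 (by nlinarith)) ?_
    rw [← nsmul_one, ← Finset.sum_const]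
    refine Finset.sum_le_sum fun z _ => ?_
    split_ifs
    · rw [Real.rpow_zero, one_mul, Real.exp_le_one_iff]
      have : 0 ≤ ‖ξ - z‖ ^ s := by positivity
      have := mul_nonneg (mul_nonneg hc.le ht) this
      linarith
    · exact zero_le_one
  refine h1.trans (mul_le_mul (mul_le_mul_of_nonneg_left h3 hC.le)
    (Real.rpow_le_rpow_of_exponent_le (one_le_jb ξ) ?_) (by positivity)
    (mul_nonneg hC.le (by linarith)))
  have : (0 : ℝ) ≤ ((j : ℕ) : ℝ) := Nat.cast_nonneg _
  simp only [map_zero, Nat.cast_zero, zero_add]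
  linarith

theorem fundSol_X_pow_order (b : Fin m → ℂ) (j : Fin m) (t : ℝ) :
    fundSol b j (Polynomial.X ^ m) t =
      ∑ i : Fin m, b i * fundSol b j (Polynomial.X ^ (i : ℕ)) t := by
  have h := fundSol_charPoly_mul b j 1 t
  rw [mul_one, charPoly, fundSol_sub, fundSol_sum, sub_eq_zero] at h
  rw [h]
  exact Finset.sum_congr rfl fun i _ => fundSol_C_mul b j (b i) _ t

/-- The Fourier transform of the `k`-th time derivative of the solution whose data have the Fourier
transforms `F j`. -/
def solFT (L : Operator n m) (F : Fin m → Space n → ℂ) (k : ℕ) (t : ℝ) (η : Space n) : ℂ :=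
  ∑ j, fundSol (L.odeCoeff ((2 * Real.pi) • η)) j (Polynomial.X ^ k) t * F j η

variable {L : Operator n m} {F : Fin m → Space n → ℂ}

theorem norm_fundSol_two_pi_le {C : ℝ} {k : ℕ} (hC : 0 ≤ C)
    (h : ∀ (ξ : Space n) (j : Fin m) (t : ℝ), 0 ≤ t →
      ‖fundSol (L.odeCoeff ξ) j (Polynomial.X ^ k) t‖ ≤ C * jb ξ ^ (k : ℝ))
    (η : Space n) (j : Fin m) {t : ℝ} (ht : 0 ≤ t) :
    ‖fundSol (L.odeCoeff ((2 * Real.pi) • η)) j (Polynomial.X ^ k) t‖ ≤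
      (C * (2 * Real.pi) ^ |(k : ℝ)|) * jb η ^ |(k : ℝ)| := by
  rw [mul_assoc]
  exact (h _ j t ht).trans (mul_le_mul_of_nonneg_left (jb_two_pi_rpow_le _ η) hC)

theorem continuous_fundSol_two_pi (L : Operator n m) (j : Fin m) (Q : Polynomial ℂ) (t : ℝ) :
    Continuous fun η : Space n => fundSol (L.odeCoeff ((2 * Real.pi) • η)) j Q t := by
  have hs : Continuous fun η : Space n => (2 * Real.pi) • η := continuous_const_smul _
  have h := (continuous_fundSol j Q).comp
    ((L.continuous_odeCoeff.comp hs).prodMk (continuous_const (y := t)))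
  exact h

theorem tempInt_solFT (hF : ∀ j, TempInt (F j)) {k : ℕ}
    (hB : ∃ C : ℝ, 0 ≤ C ∧ ∀ (ξ : Space n) (j : Fin m) (t : ℝ), 0 ≤ t →
      ‖fundSol (L.odeCoeff ξ) j (Polynomial.X ^ k) t‖ ≤ C * jb ξ ^ (k : ℝ)) {t : ℝ} (ht : 0 ≤ t) :
    TempInt (solFT L F k t) := by
  obtain ⟨C, hC, h⟩ := hB
  exact TempInt.sum fun j => (hF j).mul (continuous_fundSol_two_pi L j _ t)
    fun η => norm_fundSol_two_pi_le hC h η j ht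

theorem hasDerivWithinAt_solFT (hF : ∀ j, TempInt (F j))
    (hB : ∀ k : ℕ, ∃ C : ℝ, 0 ≤ C ∧ ∀ (ξ : Space n) (j : Fin m) (t : ℝ), 0 ≤ t →
      ‖fundSol (L.odeCoeff ξ) j (Polynomial.X ^ k) t‖ ≤ C * jb ξ ^ (k : ℝ)) (k : ℕ)
    (φ : 𝓢(Space n, ℂ)) {t : ℝ} (ht : 0 ≤ t) :
    HasDerivWithinAt (fun s => ∫ η, φ η * solFT L F k s η) (∫ η, φ η * solFT L F (k + 1) t η)
      (Set.Ici 0) t := by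
  obtain ⟨C, hC, h⟩ := hB (k + 1)
  have hJc : Continuous fun η : Space n =>
      (((C * (2 * Real.pi) ^ |((k + 1 : ℕ) : ℝ)|) * jb η ^ |((k + 1 : ℕ) : ℝ)| : ℝ) : ℂ) :=
    Complex.continuous_ofReal.comp (continuous_const.mul
      (continuous_jb.rpow_const fun ξ => Or.inl (jb_pos ξ).ne'))
  have hJb : ∀ η : Space n, ‖(((C * (2 * Real.pi) ^ |((k + 1 : ℕ) : ℝ)|) *
      jb η ^ |((k + 1 : ℕ) : ℝ)| : ℝ) : ℂ)‖ ≤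
      (C * (2 * Real.pi) ^ |((k + 1 : ℕ) : ℝ)|) * jb η ^ |((k + 1 : ℕ) : ℝ)| := fun η => by
    have hJ := jb_pos η
    rw [Complex.norm_real, Real.norm_of_nonneg (by positivity)]
  have hbound : Integrable fun η : Space n => ∑ j, ‖φ η * ((((C * (2 * Real.pi) ^
      |((k + 1 : ℕ) : ℝ)|) * jb η ^ |((k + 1 : ℕ) : ℝ)| : ℝ) : ℂ) * F j η)‖ :=
    integrable_finsetSum _ fun j _ => (((hF j).mul hJc hJb).integrable_schwartz_mul φ).norm
  refine hasDerivWithinAt_integral_Ici (f := fun s η => φ η * solFT L F k s η)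
    (f' := fun s η => φ η * solFT L F (k + 1) s η) (fun s hs =>
    (tempInt_solFT hF (hB k) hs).integrable_schwartz_mul φ) (fun s hs η => ?_) hbound
    (fun s hs η => ?_) ht
  · rw [solFT, Finset.mul_sum]
    refine (norm_sum_le _ _).trans (Finset.sum_le_sum fun j _ => ?_)
    have h1 := norm_fundSol_two_pi_le hC h η j hs
    have hJ := jb_pos η
    rw [norm_mul, norm_mul, norm_mul, norm_mul, Complex.norm_real,
      Real.norm_of_nonneg (by positivity)]
    gcongr
  · refine HasDerivAt.const_mul _ (HasDerivAt.fun_sum fun j _ => HasDerivAt.mul_const ?_ _)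
    rw [pow_succ']
    exact fundSol_hasDerivAt _ j _ s

theorem solFT_zero (F : Fin m → Space n → ℂ) (k : Fin m) : solFT L F k 0 = F k := by
  ext η
  rw [solFT, Finset.sum_eq_single k]
  · rw [fundSol_X_pow_zero _ _ _ k.2, if_pos rfl, one_mul]
  · intro j _ hj
    rw [fundSol_X_pow_zero _ _ _ k.2, if_neg fun h => hj (Fin.ext h.symm), zero_mul]
  · exact fun h => absurd (Finset.mem_univ k) h

theorem solFT_order (F : Fin m → Space n → ℂ) (t : ℝ) (η : Space n) :
    solFT L F m t η = ∑ i : Fin m, L.odeCoeff ((2 * Real.pi) • η) i * solFT L F i t η := by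
  simp only [solFT, fundSol_X_pow_order, Finset.mul_sum, Finset.sum_mul]
  rw [Finset.sum_comm]
  exact Finset.sum_congr rfl fun i _ => Finset.sum_congr rfl fun j _ => by ring

theorem exists_fourier_eq (φ : 𝓢(Space n, ℂ)) :
    ∃ ψ : 𝓢(Space n, ℂ), (𝓕 ψ : 𝓢(Space n, ℂ)) = φ :=
  ⟨𝓕⁻ φ, fourier_fourierInv_eq φ⟩

/-- The explicit formula defines curves with time derivatives of all orders. Its difference from the
given solution has zero data, so uniqueness on the Fourier side identifies the two. This yields
`∂_t^r u` even for `r > m`, although only `m` derivatives are assumed. -/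
theorem exists_explicit_solution {f : Fin m → Distr n} (hF : ∀ j, TempInt (F j))
    (hfF : ∀ j, IsFT (f j) (F j))
    (hB : ∀ k : ℕ, ∃ C : ℝ, 0 ≤ C ∧ ∀ (ξ : Space n) (j : Fin m) (t : ℝ), 0 ≤ t →
      ‖fundSol (L.odeCoeff ξ) j (Polynomial.X ^ k) t‖ ≤ C * jb ξ ^ (k : ℝ))
    {u : ℝ → Distr n} (hu : L.IsSolution f u) :
    ∃ V : ℕ → ℝ → Distr n, (∀ k, IsTimeDeriv k u (V k)) ∧
      ∀ k t, 0 ≤ t → IsFT (V k t) (solFT L F k t) := by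
  have hex : ∀ k t, ∃ T : Distr n, 0 ≤ t → IsFT T (solFT L F k t) := fun k t => by
    by_cases ht : 0 ≤ t
    · obtain ⟨T, hT⟩ := (tempInt_solFT hF (hB k) ht).exists_isFT
      exact ⟨T, fun _ => hT⟩
    · exact ⟨0, fun h => absurd h ht⟩
  choose V hV using hex
  have hVd : ∀ k t, 0 ≤ t → ∀ φ : 𝓢(Space n, ℂ),
      HasDerivWithinAt (fun s => V k s φ) (V (k + 1) t φ) (Set.Ici 0) t := by
    intro k t ht φ
    obtain ⟨ψ, rfl⟩ := exists_fourier_eq φ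
    have h := hasDerivWithinAt_solFT hF hB k ψ ht
    rw [← (hV (k + 1) t ht ψ).2] at h
    exact h.congr (fun s hs => (hV k s hs ψ).2) (hV k t ht ψ).2
  obtain ⟨U, hUd, hUeq, hU0⟩ := hu
  have hUd' : ∀ k < m, ∀ t, 0 ≤ t → ∀ φ : 𝓢(Space n, ℂ),
      HasDerivWithinAt (fun s => U k s φ) (U (k + 1) t φ) (Set.Ici 0) t := by
    intro k hk t ht φ
    obtain ⟨w, hw, hwd⟩ := hUd (k + 1) hk
    have he := (hUd k hk.le).unique hw
    exact (hwd t ht φ).congr (fun s hs => by rw [he s hs]) (by rw [he t ht])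
  have hzero := cauchy_problem_unique (m := m)
    (a := fun i η => L.odeCoeff ((2 * Real.pi) • η) i)
    (V := fun k t => 𝓕 (U k t - V k t)) (Nat.pos_of_ne_zero (NeZero.ne m))
    (odeCoeff_two_pi_hasTemperateGrowth L)
    (fun k hk t ht φ => (hUd' k hk t ht (𝓕 φ)).sub (hVd k t ht (𝓕 φ)))
    (fun t ht φ => by
      simp only [TemperedDistribution.fourier_apply, sub_apply]
      -- The given solution satisfies the transformed equation by hypothesis; the explicit one
      -- satisfies it pointwise in frequency, by `solFT_order`.
      rw [equation_fourier (U := fun k => U k t) (hUeq t ht) φ, Finset.sum_sub_distrib]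
      congr 1
      rw [(hV m t ht.le φ).2]
      simp only [(hV _ t ht.le _).2]
      rw [← integral_finsetSum Finset.univ (f := fun (i : Fin m) η =>
        (SchwartzMap.smulLeftCLM ℂ (fun η : Space n => L.odeCoeff ((2 * Real.pi) • η) i) φ) η *
          solFT L F i t η) fun i _ => (hV i t ht.le _).1]
      refine integral_congr_ae (Eventually.of_forall fun η => ?_)
      simp only [solFT_order, Finset.mul_sum,
        SchwartzMap.smulLeftCLM_apply_apply (odeCoeff_two_pi_hasTemperateGrowth L _), smul_eq_mul]
      exact Finset.sum_congr rfl fun i _ => by ring)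
    (fun k hk => by
      have h1 : V k 0 = f ⟨k, hk⟩ := by
        have h2 := hV k 0 le_rfl
        rw [show solFT L F k 0 = F ⟨k, hk⟩ from solFT_zero F ⟨k, hk⟩] at h2
        exact h2.unique (hfF _)
      change 𝓕 (U k 0 - V k 0) = 0
      rw [h1, hU0 ⟨k, hk⟩, sub_self]
      ext φ; rfl)
  have huV : ∀ t, 0 ≤ t → V 0 t = u t := by
    intro t ht
    have h1 : 𝓕 (U 0 t - V 0 t) = 0 := hzero t ht
    have h2 : U 0 t - V 0 t = 0 := by
      ext φ
      obtain ⟨ψ, rfl⟩ := exists_fourier_eq φ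
      rw [← TemperedDistribution.fourier_apply, h1]
      rfl
    rw [← sub_eq_zero.1 h2]
    exact hUd 0 (Nat.zero_le m) t ht
  refine ⟨V, fun k => ?_, hV⟩
  induction k with
  | zero => exact huV
  | succ k ih => exact ⟨V k, ih, hVd k⟩

theorem IsFT.sum {ι : Type*} {s : Finset ι} {T : ι → Distr n} {G : ι → Space n → ℂ}
    (h : ∀ i, IsFT (T i) (G i)) : IsFT (∑ i ∈ s, T i) fun ξ => ∑ i ∈ s, G i ξ := fun φ => by
  simp only [Finset.mul_sum]
  refine ⟨integrable_finsetSum _ fun i _ => (h i φ).1, ?_⟩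
  rw [sum_distr_apply, integral_finsetSum _ fun i _ => (h i φ).1]
  exact Finset.sum_congr rfl fun i _ => (h i φ).2

/-- Each datum is `⟨D⟩^{-σ}` of an `L^p` function, with `σ = N + |α| + r - j`; the Bessel potential
is absorbed into `solMult`, and the multiplier estimate is summed over `j`. The family `h0` enters
only through the explicit solution. -/
theorem decayEstimate_of_fundSolBound (hn : 0 < n) {Z : Finset (Space n)} {κ s : ℝ}
    {r : ℕ} {α : Fin n →₀ ℕ} (hκ : 0 ≤ κ) (hs : 0 < s) (h : FundSolBound L Z κ s r α Set.univ)
    (h0 : ∀ k, FundSolBound L Z 0 s k 0 Set.univ)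
    {p q : ℝ≥0∞} [Fact (1 ≤ p)] [Fact (1 ≤ q)] (hp2 : p ≤ 2) (hpq : p⁻¹ + q⁻¹ = 1) {N : ℝ}
    (hN : 1 < p → (n : ℝ) * ((p⁻¹).toReal - (q⁻¹).toReal) ≤ N) (hN1 : p = 1 → (n : ℝ) < N) :
    DecayEstimate L p q N r α ((n * ((p⁻¹).toReal - (q⁻¹).toReal) + κ) / s) := by
  obtain ⟨C, hC, H⟩ := exists_solMult_estimate hn hκ hs h hp2 hpq hN hN1
  set ρ := (n * ((p⁻¹).toReal - (q⁻¹).toReal) + κ) / s with hρ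
  refine ⟨C + 1, by linarith, fun f hf u hu => ?_⟩
  have hg : ∀ j : Fin m, ∃ g : Lp ℂ p (volume : Measure (Space n)),
      (g : Distr n) = bracketD n (N + α.degree + r - (j : ℕ)) (f j) := fun j => by
    have h1 := hf j
    rw [sobolevNorm, lpNorm, iInf_lt_iff] at h1
    obtain ⟨g, h2⟩ := h1
    obtain ⟨h3, -⟩ := iInf_lt_iff.1 h2
    exact ⟨g, h3⟩
  choose g hg using hg
  choose G hG hGFT hGM using fun j => H (g j)
  set F : Fin m → Space n → ℂ := fun j η =>
    ((jb ((2 * Real.pi) • η) ^ (-(N + α.degree + r - (j : ℕ))) : ℝ) : ℂ) * G j η with hFdef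
  have hF : ∀ j, TempInt (F j) := fun j => by
    refine TempInt.mul (C := (2 * Real.pi) ^ |-(N + α.degree + r - (j : ℕ))|)
      (K' := |-(N + α.degree + r - (j : ℕ))|) (hG j) (Complex.continuous_ofReal.comp
      ((continuous_jb.comp (continuous_const_smul (2 * Real.pi))).rpow_const
        fun ξ => Or.inl (jb_pos _).ne')) (fun η => ?_)
    have hJ := jb_pos ((2 * Real.pi) • η)
    rw [Complex.norm_real, Real.norm_of_nonneg (by positivity)]
    exact jb_two_pi_rpow_le _ η
  have hfF : ∀ j, IsFT (f j) (F j) := fun j => by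
    have h1 := hGFT j
    rw [hg j] at h1
    exact h1.of_bracketD
  obtain ⟨V, hVd, hV⟩ := exists_explicit_solution hF hfF
    (fun k => (h0 k).exists_norm_fundSol_le) hu
  refine ⟨V r, hVd r, fun t ht => ?_⟩
  choose w hw hwn using fun j => hGM j j t ht
  have hFT : partialXPow α (V r t) = ((∑ j, w j : Lp ℂ q (volume : Measure (Space n))) : Distr n) := by
    have h1 := (hV r t ht).fourierMultiplier (dxSymbol_hasTemperateGrowth α)
    rw [← partialXPow_eq_fourierMultiplier] at h1
    have h2 : ((∑ j, w j : Lp ℂ q (volume : Measure (Space n))) : Distr n) =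
        ∑ j, (w j : Distr n) :=
      map_sum (Lp.toTemperedDistributionCLM ℂ (volume : Measure (Space n)) q) w Finset.univ
    rw [h2]
    refine h1.unique ?_
    have h3 := IsFT.sum (s := Finset.univ) hw
    convert h3 using 2 with η
    rw [solFT, Finset.mul_sum]
    refine Finset.sum_congr rfl fun j _ => ?_
    rw [hFdef, dxSymbol, solMult]
    ring
  have hsob : ∀ j : Fin m, sobolevNorm (N + α.degree + r - (j : ℕ)) p (f j) =
      ENNReal.ofReal ‖g j‖ := fun j => by
    rw [sobolevNorm, ← hg j, lpNorm_coe, ofReal_norm, Lp.enorm_def]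
  rw [hFT, lpNorm_coe, ← Lp.enorm_def, ← ofReal_norm]
  simp only [hsob]
  have hb := bracket_pos t
  rw [← ENNReal.ofReal_sum_of_nonneg fun j _ => norm_nonneg (g j),
    ← ENNReal.ofReal_mul (by positivity)]
  refine ENNReal.ofReal_le_ofReal ((norm_sum_le _ _).trans ?_)
  rw [Finset.mul_sum]
  refine Finset.sum_le_sum fun j _ => (hwn j).trans ?_
  gcongr
  linarith

end Solution

/-! ### Vanishing orders of `ξ^α τ(ξ)^r` -/

section Vanishing

variable {n : ℕ}

/-- Local boundedness phrased as vanishing of order `0`, so that all cases of the theorem use one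
format. -/
theorem eventually_norm_le_of_continuousAt {E : Type*} [SeminormedAddCommGroup E]
    {f : Space n → E} {ξ₀ : Space n} (h : ContinuousAt f ξ₀) :
    ∃ c : ℝ, 0 < c ∧ ∀ᶠ ξ in 𝓝 ξ₀, ‖f ξ‖ ≤ c * ‖ξ - ξ₀‖ ^ (0 : ℝ) := by
  refine ⟨‖f ξ₀‖ + 1, by positivity, ?_⟩
  filter_upwards [h.norm.eventually_lt continuousAt_const (lt_add_one ‖f ξ₀‖)] with ξ hξ
  rw [Real.rpow_zero, mul_one]
  exact hξ.le

theorem eventually_mul_le_rpow_add {f g : Space n → ℝ} {ξ₀ : Space n} {a b : ℝ} (ha : 0 ≤ a)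
    (hb : 0 ≤ b) (hf0 : ∀ ξ, 0 ≤ f ξ) (hg0 : ∀ ξ, 0 ≤ g ξ)
    (hf : ∃ c : ℝ, 0 < c ∧ ∀ᶠ ξ in 𝓝 ξ₀, f ξ ≤ c * ‖ξ - ξ₀‖ ^ a)
    (hg : ∃ c : ℝ, 0 < c ∧ ∀ᶠ ξ in 𝓝 ξ₀, g ξ ≤ c * ‖ξ - ξ₀‖ ^ b) :
    ∃ c : ℝ, 0 < c ∧ ∀ᶠ ξ in 𝓝 ξ₀, f ξ * g ξ ≤ c * ‖ξ - ξ₀‖ ^ (a + b) := by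
  obtain ⟨c, hc, hf⟩ := hf
  obtain ⟨d, hd, hg⟩ := hg
  refine ⟨c * d, mul_pos hc hd, ?_⟩
  filter_upwards [hf, hg] with ξ h1 h2
  rw [Real.rpow_add_of_nonneg (norm_nonneg _) ha hb]
  exact (mul_le_mul h1 h2 (hg0 ξ) ((hf0 ξ).trans h1)).trans_eq (by ring)

theorem eventually_pow_le_rpow_mul {f : Space n → ℝ} {ξ₀ : Space n} {a : ℝ} (r : ℕ)
    (hf0 : ∀ ξ, 0 ≤ f ξ) (hf : ∃ c : ℝ, 0 < c ∧ ∀ᶠ ξ in 𝓝 ξ₀, f ξ ≤ c * ‖ξ - ξ₀‖ ^ a) :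
    ∃ c : ℝ, 0 < c ∧ ∀ᶠ ξ in 𝓝 ξ₀, f ξ ^ r ≤ c * ‖ξ - ξ₀‖ ^ (r * a) := by
  obtain ⟨c, hc, hf⟩ := hf
  refine ⟨c ^ r, pow_pos hc r, ?_⟩
  filter_upwards [hf] with ξ h
  rw [mul_comm (r : ℝ) a, Real.rpow_mul_natCast (norm_nonneg _), ← mul_pow]
  exact pow_le_pow_left₀ (hf0 ξ) h r

theorem eventually_xiPow_le_rpow (α : Fin n →₀ ℕ) :
    ∃ c : ℝ, 0 < c ∧ ∀ᶠ ξ in 𝓝 (0 : Space n), ‖xiPow α ξ‖ ≤ c * ‖ξ - 0‖ ^ (α.degree : ℝ) :=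
  ⟨1, one_pos, Eventually.of_forall fun ξ => by
    rw [one_mul, sub_zero, Real.rpow_natCast]
    exact norm_xiPow_le_norm_pow α ξ⟩

end Vanishing

end HypCauchy

end

/-- All four estimates are instances of `main a b`, with `κ = a + b`. Here `a` is an order of
vanishing of `ξ^α` at the exceptional points, namely `|α|` if they can only be `0` and otherwise
`0`; `b` is one of `τ_k^r`, namely `r s₁` under the assumption of (b) and otherwise `0`. -/
theorem mainTheorem10 {n m : ℕ} (hn : 0 < n) (hm : 0 < m)
    (L : HypCauchy.Operator n m) (hL : L.StrictlyHyperbolic)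
    (τ : Fin m → HypCauchy.Space n → ℂ) (hτ : L.IsCharRoots τ)
    (hcont : ∀ (k : Fin m) (ξ₀ : HypCauchy.Space n), (τ k ξ₀).im = 0 → ContinuousAt (τ k) ξ₀)
    (hstab : ∀ (k : Fin m) (ξ : HypCauchy.Space n), 0 ≤ (τ k ξ).im)
    (H1 : ∀ k : Fin m, ∃ δ : ℝ, 0 < δ ∧
      ∀ᶠ ξ in Bornology.cobounded (HypCauchy.Space n), δ ≤ (τ k ξ).im)
    (s : ℝ) (hs : 0 < s)
    (H2 : ∀ ξ₀ : HypCauchy.Space n,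
      (∀ k l : Fin m, (τ k ξ₀).im = 0 → (τ l ξ₀).im = 0 → k = l) ∧
      ∀ k : Fin m, (τ k ξ₀).im = 0 →
        ∃ c : ℝ, 0 < c ∧ ∀ᶠ ξ in 𝓝 ξ₀, ‖ξ - ξ₀‖ ^ s ≤ c * (τ k ξ).im)
    (hfin : {ξ₀ : HypCauchy.Space n | ∃ k : Fin m, (τ k ξ₀).im = 0}.Finite)
    (p q : ℝ≥0∞) [Fact (1 ≤ p)] [Fact (1 ≤ q)] (hp : p ≤ 2) (hpq : p⁻¹ + q⁻¹ = 1)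
    (N : ℝ) (hN : 1 < p → (n : ℝ) * ((p⁻¹).toReal - (q⁻¹).toReal) ≤ N)
    (hN1 : p = 1 → (n : ℝ) < N)
    (r : ℕ) (α : Fin n →₀ ℕ) :
    HypCauchy.DecayEstimate L p q N r α (n / s * ((p⁻¹).toReal - (q⁻¹).toReal)) ∧
    ((∀ (k : Fin m) (ξ₀ : HypCauchy.Space n), (τ k ξ₀).im = 0 → ξ₀ = 0) →
      HypCauchy.DecayEstimate L p q N r α
        (n / s * ((p⁻¹).toReal - (q⁻¹).toReal) + α.degree / s)) ∧
    (∀ s₁ : ℝ, 0 < s₁ →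
      (∀ (k : Fin m) (ξ₀ : HypCauchy.Space n), (τ k ξ₀).im = 0 →
        ∃ c₁ : ℝ, 0 < c₁ ∧ ∀ᶠ ξ in 𝓝 ξ₀, ‖τ k ξ‖ ≤ c₁ * ‖ξ - ξ₀‖ ^ s₁) →
      HypCauchy.DecayEstimate L p q N r α
        (n / s * ((p⁻¹).toReal - (q⁻¹).toReal) + r * s₁ / s) ∧
      ((∀ (k : Fin m) (ξ₀ : HypCauchy.Space n), (τ k ξ₀).im = 0 → ξ₀ = 0) →
        HypCauchy.DecayEstimate L p q N r α
          (n / s * ((p⁻¹).toReal - (q⁻¹).toReal) + α.degree / s + r * s₁ / s))) := by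
  have : NeZero m := ⟨hm.ne'⟩
  have hZ : ∀ (k : Fin m) (ξ₀ : HypCauchy.Space n), (τ k ξ₀).im = 0 → ξ₀ ∈ hfin.toFinset :=
    fun k ξ₀ h => hfin.mem_toFinset.2 ⟨k, h⟩
  have hx0 : ∀ (α : Fin n →₀ ℕ) (ξ₀ : HypCauchy.Space n), ∃ c : ℝ, 0 < c ∧ ∀ᶠ ξ in 𝓝 ξ₀,
      ‖HypCauchy.xiPow α ξ‖ ≤ c * ‖ξ - ξ₀‖ ^ (0 : ℝ) := fun α ξ₀ =>
    HypCauchy.eventually_norm_le_of_continuousAt (HypCauchy.continuous_xiPow α).continuousAt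
  have hτ0 : ∀ (r : ℕ) (k : Fin m) (ξ₀ : HypCauchy.Space n), (τ k ξ₀).im = 0 →
      ∃ c : ℝ, 0 < c ∧ ∀ᶠ ξ in 𝓝 ξ₀, ‖τ k ξ‖ ^ r ≤ c * ‖ξ - ξ₀‖ ^ (r * 0 : ℝ) :=
    fun r k ξ₀ h => HypCauchy.eventually_pow_le_rpow_mul r (fun _ => norm_nonneg _)
      (HypCauchy.eventually_norm_le_of_continuousAt (hcont k ξ₀ h))
  have bound : ∀ (r : ℕ) (α : Fin n →₀ ℕ) (a b : ℝ), 0 ≤ a → 0 ≤ b →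
      (∀ (k : Fin m) (ξ₀ : HypCauchy.Space n), (τ k ξ₀).im = 0 → ∃ c : ℝ, 0 < c ∧
        ∀ᶠ ξ in 𝓝 ξ₀, ‖HypCauchy.xiPow α ξ‖ ≤ c * ‖ξ - ξ₀‖ ^ a) →
      (∀ (k : Fin m) (ξ₀ : HypCauchy.Space n), (τ k ξ₀).im = 0 → ∃ c : ℝ, 0 < c ∧
        ∀ᶠ ξ in 𝓝 ξ₀, ‖τ k ξ‖ ^ r ≤ c * ‖ξ - ξ₀‖ ^ b) →
      HypCauchy.FundSolBound L hfin.toFinset (a + b) s r α Set.univ :=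
    fun r α a b ha hb hx ht => HypCauchy.fundSolBound_univ hL hτ hcont hstab H1 H2 hZ
      fun k ξ₀ h => HypCauchy.eventually_mul_le_rpow_add ha hb (fun _ => norm_nonneg _)
        (fun _ => pow_nonneg (norm_nonneg _) _) (hx k ξ₀ h) (ht k ξ₀ h)
  -- Here `α = 0` and no vanishing is claimed, for every order `k`: the crude bounds behind the
  -- explicit solution. The exponent `k * 0` is the form in which `hτ0` delivers order zero.
  have h0 : ∀ k : ℕ, HypCauchy.FundSolBound L hfin.toFinset 0 s k 0 Set.univ := fun k => by
    have h := bound k 0 0 (k * 0) le_rfl (by simp) (fun _ ξ₀ _ => hx0 0 ξ₀) (hτ0 k)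
    rwa [mul_zero, add_zero] at h
  have main : ∀ a b : ℝ, 0 ≤ a → 0 ≤ b →
      (∀ (k : Fin m) (ξ₀ : HypCauchy.Space n), (τ k ξ₀).im = 0 → ∃ c : ℝ, 0 < c ∧
        ∀ᶠ ξ in 𝓝 ξ₀, ‖HypCauchy.xiPow α ξ‖ ≤ c * ‖ξ - ξ₀‖ ^ a) →
      (∀ (k : Fin m) (ξ₀ : HypCauchy.Space n), (τ k ξ₀).im = 0 → ∃ c : ℝ, 0 < c ∧
        ∀ᶠ ξ in 𝓝 ξ₀, ‖τ k ξ‖ ^ r ≤ c * ‖ξ - ξ₀‖ ^ b) →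
      HypCauchy.DecayEstimate L p q N r α
        ((n * ((p⁻¹).toReal - (q⁻¹).toReal) + (a + b)) / s) := fun a b ha hb hx ht =>
    HypCauchy.decayEstimate_of_fundSolBound hn (add_nonneg ha hb) hs (bound r α a b ha hb hx ht) h0
      hp hpq hN hN1
  have hα : (∀ (k : Fin m) (ξ₀ : HypCauchy.Space n), (τ k ξ₀).im = 0 → ξ₀ = 0) →
      ∀ (k : Fin m) (ξ₀ : HypCauchy.Space n), (τ k ξ₀).im = 0 → ∃ c : ℝ, 0 < c ∧
        ∀ᶠ ξ in 𝓝 ξ₀, ‖HypCauchy.xiPow α ξ‖ ≤ c * ‖ξ - ξ₀‖ ^ (α.degree : ℝ) :=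
    fun hzero k ξ₀ h => by
      rw [hzero k ξ₀ h]
      exact HypCauchy.eventually_xiPow_le_rpow α
  refine ⟨?_, fun hzero => ?_, fun s₁ hs₁ hvan => ?_⟩
  · convert main 0 (r * 0) le_rfl (by simp) (fun _ ξ₀ _ => hx0 α ξ₀) (hτ0 r) using 1
    ring
  · convert main α.degree (r * 0) (Nat.cast_nonneg _) (by simp) (hα hzero) (hτ0 r) using 1
    ring
  · have ht : ∀ (k : Fin m) (ξ₀ : HypCauchy.Space n), (τ k ξ₀).im = 0 → ∃ c : ℝ, 0 < c ∧
        ∀ᶠ ξ in 𝓝 ξ₀, ‖τ k ξ‖ ^ r ≤ c * ‖ξ - ξ₀‖ ^ (r * s₁) := fun k ξ₀ h =>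
      HypCauchy.eventually_pow_le_rpow_mul r (fun _ => norm_nonneg _) (hvan k ξ₀ h)
    refine ⟨?_, fun hzero => ?_⟩
    · convert main 0 (r * s₁) le_rfl (by positivity) (fun _ ξ₀ _ => hx0 α ξ₀) ht using 1
      ring
    · convert main α.degree (r * s₁) (Nat.cast_nonneg _) (by positivity) (hα hzero) ht using 1
      ring
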